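/- **Setting.** There are $N$ items, of which a set $S$ of exactly $K$ is defective; a test on a set of items is positive iff the set contains a defective item. The *regular-SAFFRON ensemble* with parameters $\ell, M, r, p$, where $Mr=N\ell$ and $p\ge 1$, is the following random family of tests. * *Graph.* Each of the $N$ items has $\ell$ half-edges and each of the $M$ bins has $r$ half-edges; the two sets of $N\ell=Mr$ half-edges are paired by a uniformly random bijection. An item lies in a bin if at least one edge joins them. * *Signature matrix.* For $1\le j\le r$ let $b_j\in\{0,1\}^{\lceil\log_2 r\rceil}$ be the binary expansion of $j-1$ and $\overline{b}_j$ its complement. Let $\pi^1,\dots,\pi^{p-1}$ be independent uniformly random permutations of $\{1,\dots,r\}$, independent of the graph, and $\pi^0=\mathrm{id}$. The $j$-th column $u_j$ of the $2p\lceil\log_2 r\rceil\times r$ matrix $U_{r,p}$ is the concatenation of $b_{\pi^0_j},\overline b_{\pi^0_j},\dots,b_{\pi^{p-1}_j},\overline b_{\pi^{p-1}_j}$. * *Tests.* Each bin has $2p\lceil\log_2 r\rceil$ tests: the $j$-th item of the bin, in increasing order, gets the column $u_j$, and items outside the bin get the zero column. *Decoder.* The graph and the permutations are stored in advance. The singleton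 bin decoder reads from the first section of the results of a bin the only possible position $j$, and outputs the $j$-th item of the bin if the results equal $u_j$. Given the position $i$ of an already decoded item of a bin, the double-ton bin decoder reads from the first section the only possible second position $j$, and outputs the $j$-th item of the bin if the results equal $u_i\vee u_j$. The peeling decoder applies the singleton decoder to all bins and puts the decoded items in a queue; then, until the queue is empty, it moves an item from the queue to the set of peeled items, applies the double-ton decoder to each bin at its $\ell$ edges, and puts the newly decoded items in the queue. The output is the set of peeled items. Each operation on a single bit or test result costs one step; each table look-up, and each query or update of the queue and the sets, costs a number of steps proportional to the bit length $\lceil\log_2(N\ell)\rceil+1$ of an index. **Theorem.** For every $\epsilon\in(0,1)$ there are an integer $\ell=\ell_\epsilon\ge1$ and a real $c_\epsilon>0$, which may be taken as follows for the listed values of $\epsilon$, | $\epsilon$ | $10^{-3}$ | $10^{-4}$ | $10^{-5}$ | $10^{-6}$ | $10^{-7}$ | $10^{-8}$ | $10^{-9}$ | |---|---|---|---|---|---|---|---| | $c_\epsilon$ | 6.13 | 7.88 | 9.63 | 11.36 | 13.10 | 14.84 | 16.57 | | $\ell$ | 7 | 9 | 10 | 12 | 14 | 15 | 17 | such that for every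 integer $p\ge1$ there are constants $T,C,\gamma>0$ depending only on $\epsilon,p$ (and on the choice of $\ell_\epsilon,c_\epsilon$) with the following properties. Let $N,K,M,r$ run through a sequence with $K\to\infty$, $K=o(N^{1-1/p})$, $M=\lceil c_\epsilon K\rceil$ and $Mr=N\ell$. 1. The number of tests is $m=2pM\lceil\log_2\frac{N\ell}{M}\rceil$, and $m\sim 2p\,c_\epsilon K\log_2\frac{\ell N}{c_\epsilon K}$. 2. For all sufficiently large indices of the sequence and every defective set $S$ with $|S|=K$, with probability at least $1-C\frac{K^p}{N^{p-1}}-e^{-\gamma K}$ the following holds: every item in the decoder's output is defective, the output contains at least $(1-\epsilon)K$ items, and decoding takes at most $T\,K\log\frac NK$ steps. In particular this probability tends to $1$ for every choice of the sets $S$; and if moreover $\log N=o(K)$, then the failure probability is $O\!\left(\frac{K^p}{N^{p-1}}\right)$. 3. For all sufficiently large indices of the sequence, every $S$ with $|S|=K$ and every outcome of the ensemble for which the output contains only defective items, decoding takes at most $T\,K\log\frac NK$ steps. -/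

import Mathlib

open Filter Topology Asymptotics

namespace GroupTesting

/-! ### Programs with a step count -/

/-- The result of a computation together with the number of elementary steps that it took. -/
structure Timed (α : Type) where
  val : α
  steps : ℕ

/-- Running one computation after the other adds up the numbers of steps. -/
instance : Monad Timed where
  pure a := ⟨a, 0⟩
  bind x f := ⟨(f x.val).val, x.steps + (f x.val).steps⟩

/-- An operation with result `a` that takes `n` elementary steps. -/
def charge {α : Type} (n : ℕ) (a : α) : Timed α := ⟨a, n⟩

/-- Run the loop body `f` on the elements of a list, from left to right, threading a state. -/
def loop {α β : Type} (f : β → α → Timed β) : β → List α → Timed β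
  | b, [] => pure b
  | b, a :: as => do
    let b' ← f b a
    loop f b' as

/-- The price of handling one item, bin or position as a machine word (reading one entry of a
stored table, one membership query, insertion or removal in a search tree or a queue): the number
of bits of an index below `N * ℓ`, the number of edges of the graph. -/
def wordCost (N ℓ : ℕ) : ℕ := Nat.clog 2 (N * ℓ) + 1

/-! ### The ensemble of testing matrices -/

/-- A left-and-right-regular bipartite (multi)graph with `N` items of degree `ℓ` and `M` bins of
degree `r`: a pairing of the `N * ℓ` half-edges on the left with the `M * r` half-edges on the
right. -/
abbrev Graph (N M ℓ r : ℕ) : Type := (Fin N × Fin ℓ) ≃ (Fin M × Fin r)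

/-- The `0/1` adjacency matrix of the graph: its rows are the bins, its columns the items. -/
def adjacency {N M ℓ r : ℕ} (G : Graph N M ℓ r) : Matrix (Fin M) (Fin N) Bool :=
  fun i v => decide (∃ e : Fin ℓ, (G (v, e)).1 = i)

/-- The items in bin `i`, in increasing order: the non-zero indices of row `i` of the adjacency
matrix. -/
def binItems {N M ℓ r : ℕ} (G : Graph N M ℓ r) (i : Fin M) : List (Fin N) :=
  (List.finRange N).filter (fun v => adjacency G i v)

/-- The tests of one bin: `(k, false, b)` is bit `b` of section `k`, and `(k, true, b)` is bit `b`
of the complementary half of section `k`. There are `p` sections, and words have `⌈log₂ r⌉` bits. -/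
abbrev BinTest (p r : ℕ) : Type := Fin p × Bool × Fin (Nat.clog 2 r)

/-- All the tests: the tests of each of the `M` bins. -/
abbrev Test (M p r : ℕ) : Type := Fin M × BinTest p r

/-- The permutation of section `k`: the identity for `k = 0`, and the `k`-th of the `p - 1` given
permutations for `k ≥ 1`. -/
def sectionPerm {p r : ℕ} (π : Fin (p - 1) → Equiv.Perm (Fin r)) (k : Fin p) :
    Equiv.Perm (Fin r) :=
  if h : (k : ℕ) = 0 then 1 else π ⟨(k : ℕ) - 1, by have := k.isLt; omega⟩

/-- The signature matrix: in section `k`, column `j` consists of the binary expansion of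
`π^k j` (with `j` counted from `0`), followed by the complement of that expansion. -/
def signature {p r : ℕ} (π : Fin (p - 1) → Equiv.Perm (Fin r)) :
    Matrix (BinTest p r) (Fin r) Bool :=
  fun t j => xor t.2.1 (Nat.testBit (sectionPerm π t.1 j : ℕ) t.2.2)

/-- The testing matrix: the rows of bin `i` are obtained by placing the columns of `U`, in their
order, at the non-zero indices of row `i` of the adjacency matrix; the other columns are zero. -/
def testMatrix {N M ℓ r p : ℕ} (G : Graph N M ℓ r) (U : Matrix (BinTest p r) (Fin r) Bool) :
    Matrix (Test M p r) (Fin N) Bool :=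
  fun t v => decide (∃ j : Fin r, (binItems G t.1)[(j : ℕ)]? = some v ∧ U t.2 j = true)

/-- The test results when `S` is the set of defective items: the Boolean product of `A` with the
indicator vector of `S`, where a test is positive if and only if a defective item takes part. -/
def testResults {N : ℕ} {T : Type} (A : Matrix T (Fin N) Bool) (S : Finset (Fin N)) : T → Bool :=
  fun t => decide (∃ v ∈ S, A t v = true)

/-- The sample space of the ensemble: a graph, and the `p - 1` permutations that determine the
signature matrix. -/
abbrev Outcome (N M ℓ r p : ℕ) : Type :=
  Graph N M ℓ r × (Fin (p - 1) → Equiv.Perm (Fin r))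

/-- The probability of an event under the uniform distribution on a finite non-empty type. -/
noncomputable def prob {Ω : Type} (E : Ω → Prop) : ℝ := (Nat.card {ω // E ω} : ℝ) / Nat.card Ω

/-! ### The decoder

The decoder knows the graph and the permutations, which are stored in tables before the tests are
performed. A test result is read, and an operation on single bits is performed, in one step; an
entry of a table is read in `wordCost N ℓ` steps. -/

/-- Assemble a number from its bits, the lowest one first. -/
def readWord {L : ℕ} (f : Fin L → Timed Bool) : Timed ℕ :=
  loop (fun acc b => do
    let x ← f b
    charge 1 (if x then acc + 2 ^ (b : ℕ) else acc)) 0 (List.finRange L)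

/-- Check whether the results at bin `i` are the Boolean sum of the columns `l₀` and `l₁` of the
signature matrix. -/
def verifyPair {N M ℓ r p : ℕ} (ω : Outcome N M ℓ r p) (y : Test M p r → Bool)
    (i : Fin M) (l₀ l₁ : Fin r) : Timed Bool :=
  loop (fun ok k => do
    let q₀ ← charge (wordCost N ℓ) (sectionPerm ω.2 k l₀ : ℕ)
    let q₁ ← charge (wordCost N ℓ) (sectionPerm ω.2 k l₁ : ℕ)
    loop (fun ok b =>
      loop (fun ok s => do
        let e ← charge 1 (y (i, k, s, b))
        let a₀ ← charge 1 (xor s (q₀.testBit b))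
        let a₁ ← charge 1 (xor s (q₁.testBit b))
        charge 1 (ok && (e == (a₀ || a₁)))) ok [false, true])
      ok (List.finRange (Nat.clog 2 r))) true (List.finRange p)

/-- The bin decoder for singletons: read off the only possible position from section `0`, check it
on all the tests of the bin, and look up the item at that position of the bin. -/
def decodeSingleton {N M ℓ r p : ℕ} [NeZero p] (ω : Outcome N M ℓ r p) (y : Test M p r → Bool)
    (i : Fin M) : Timed (Option (Fin N)) := do
  let l ← readWord (fun b => charge 1 (y (i, 0, false, b)))
  if h : l < r then do
    let ok ← verifyPair ω y i ⟨l, h⟩ ⟨l, h⟩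
    let v ← charge (wordCost N ℓ) ((binItems ω.1 i)[l]?)
    charge 1 (if ok then v else none)
  else charge 1 none

/-- The bin decoder for resolvable double-tons, given that the item at position `l₀` of bin `i` is
already known to be defective: section `0` reveals the only possible second position (a `0` of
column `l₀` lets the bit be read from the first half, a `1` lets the complementary bit be read from
the second half); check it on all the tests of the bin and look up the item. -/
def decodeDoubleton {N M ℓ r p : ℕ} [NeZero p] (ω : Outcome N M ℓ r p) (y : Test M p r → Bool)
    (i : Fin M) (l₀ : ℕ) : Timed (Option (Fin N)) := do
  let l ← readWord (fun b => do
    let a ← charge 1 (l₀.testBit b)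
    let e ← charge 1 (y (i, 0, a, b))
    charge 1 (xor a e))
  if h : l₀ < r ∧ l < r then do
    let ok ← verifyPair ω y i ⟨l₀, h.1⟩ ⟨l, h.2⟩
    let v ← charge (wordCost N ℓ) ((binItems ω.1 i)[l]?)
    charge 1 (if ok then v else none)
  else charge 1 none

/-- Append a newly decoded item, if there is one, to the queue `D` of decoded items, unless it is
already in `D` or among the peeled items `P` (one membership query and one insertion). -/
def pushNew {N : ℕ} (ℓ : ℕ) (D P : List (Fin N)) (o : Option (Fin N)) : Timed (List (Fin N)) :=
  match o with
  | none => charge 1 D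
  | some w => charge (2 * wordCost N ℓ) (if w ∈ D ∨ w ∈ P then D else D ++ [w])

/-- The peeling iterations: move the first item `v` of the queue `D` to the list `P` of peeled
items, apply the double-ton decoder to every bin that contains `v`, and append the newly decoded
items to `D`; stop when `D` is empty. The first argument is a bound on the number of iterations
that makes the recursion structural; it is set to the number of items, which suffices since every
iteration peels a different item. -/
def peel {N M ℓ r p : ℕ} [NeZero p] (ω : Outcome N M ℓ r p) (y : Test M p r → Bool) :
    ℕ → List (Fin N) → List (Fin N) → Timed (List (Fin N))
  | 0, _, P => pure P
  | _ + 1, [], P => charge 1 P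
  | n + 1, v :: D, P => do
    let P' ← charge (2 * wordCost N ℓ) (v :: P)
    let D' ← loop (fun D e => do
      let i ← charge (wordCost N ℓ) (ω.1 (v, e)).1
      let l₀ ← charge (wordCost N ℓ) ((binItems ω.1 i).idxOf v)
      let o ← decodeDoubleton ω y i l₀
      pushNew ℓ D P' o) D (List.finRange ℓ)
    peel ω y n D' P'

/-- The whole decoder: apply the singleton decoder to all the bins, then peel. The result is the
set of the items that are declared to be defective. -/
def decode {N M ℓ r p : ℕ} [NeZero p] (ω : Outcome N M ℓ r p) (y : Test M p r → Bool) :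
    Timed (Finset (Fin N)) := do
  let D ← loop (fun D i => do
    let o ← decodeSingleton ω y i
    pushNew ℓ D [] o) [] (List.finRange M)
  let P ← peel ω y N D []
  pure P.toFinset

/-- The decoder, run on the results of the tests on the defective set `S`. -/
def run {N M ℓ r p : ℕ} [NeZero p] (S : Finset (Fin N)) (ω : Outcome N M ℓ r p) :
    Timed (Finset (Fin N)) :=
  decode ω (testResults (testMatrix ω.1 (signature ω.2)) S)

/-- Success on the defective set `S`: every item that is declared defective is defective, at least
a fraction `1 - ε` of the defective items is declared, and decoding takes at most `t` steps. -/
def Success {N M ℓ r p : ℕ} [NeZero p] (ε t : ℝ) (S : Finset (Fin N)) (ω : Outcome N M ℓ r p) :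
    Prop :=
  (run S ω).val ⊆ S ∧ (1 - ε) * (S.card : ℝ) ≤ ((run S ω).val.card : ℝ) ∧
    ((run S ω).steps : ℝ) ≤ t

/-- The tabulated constants: the error floor `ε`, the left degree `ℓ` and the ratio `c` of the
number of bins to the number of defective items. -/
noncomputable def table : List (ℝ × ℕ × ℝ) :=
  [(1 / 10 ^ 3, 7, 6.13), (1 / 10 ^ 4, 9, 7.88), (1 / 10 ^ 5, 10, 9.63), (1 / 10 ^ 6, 12, 11.36),
    (1 / 10 ^ 7, 14, 13.10), (1 / 10 ^ 8, 15, 14.84), (1 / 10 ^ 9, 17, 16.57)]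

end GroupTesting

namespace GroupTesting

/-! ### Programs -/

/-! The proof has a deterministic part and two probabilistic parts. Deterministic part: a bin with a
single defective item is always decoded, and so is a bin with two defective items one of which is
already known. Hence the output contains every `Resolved` item, that is, every item recovered within
two rounds of peeling (`mem_run_of_resolved`). Two rounds already suffice for the tabulated
constants, so no analysis of peeling until it stops is needed. Error floor: let the `K` defective
items choose their `ℓ` bins independently among `M ≈ cK` bins. The density of empty bins is about
`exp (-ℓ/c)`. With `a` just below it, the density of bins that would resolve a further item is about
`a + (ℓ/c) * pairRate ℓ a`, and an item is unresolved with probability about `(1 - a - (ℓ/c) *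
pairRate ℓ a) ^ ℓ`, which `ErrorFloor` puts below `ε`. Each of the three counts concentrates by the
bounded difference inequality (`prob_card_unresolved_le`, `ErrorFloor.exists_rate`). Passing to the
random bijection costs a factor `exp (o(K))`, because `K = o(N)` (`prob_equiv_comp_le`). False
positives: the singleton decoder makes none. For the double-ton decoder, section `0` leaves at most
one candidate column, and each of the `p - 1` independent permutations lets a wrong candidate
survive with probability at most `2/r`, by symmetry among the non-defective positions
(`prob_covers_le`), unless half of the bin is defective. A union bound over the `Kℓ` edges, with `r`
of order `N/K`, gives `O(K ^ p / N ^ (p - 1))`. Running time: it is linear in the number of bins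
plus the size of the output, times `log N`; and `K ≤ N ^ (1 - 1/p)` makes `log N` at most `p * log
(N/K)`. -/

@[simp] theorem Timed.pure_val {α : Type} (a : α) : (pure a : Timed α).val = a := rfl
@[simp] theorem Timed.pure_steps {α : Type} (a : α) : (pure a : Timed α).steps = 0 := rfl
@[simp] theorem Timed.bind_val {α β : Type} (x : Timed α) (f : α → Timed β) :
    (x >>= f).val = (f x.val).val := rfl
@[simp] theorem Timed.bind_steps {α β : Type} (x : Timed α) (f : α → Timed β) :
    (x >>= f).steps = x.steps + (f x.val).steps := rfl
@[simp] theorem charge_val {α : Type} (n : ℕ) (a : α) : (charge n a).val = a := rfl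
@[simp] theorem charge_steps {α : Type} (n : ℕ) (a : α) : (charge n a).steps = n := rfl
@[simp] theorem loop_nil {α β : Type} (f : β → α → Timed β) (b : β) : loop f b [] = pure b := rfl
@[simp] theorem loop_cons_val {α β : Type} (f : β → α → Timed β) (b : β) (a : α) (as : List α) :
    (loop f b (a :: as)).val = (loop f (f b a).val as).val := rfl
@[simp] theorem loop_cons_steps {α β : Type} (f : β → α → Timed β) (b : β) (a : α) (as : List α) :
    (loop f b (a :: as)).steps = (f b a).steps + (loop f (f b a).val as).steps := rfl

theorem loop_append_val {α β : Type} (f : β → α → Timed β) (b : β) (as bs : List α) :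
    (loop f b (as ++ bs)).val = (loop f (loop f b as).val bs).val := by
  induction as generalizing b with
  | nil => rfl
  | cons a as ih => simpa using ih _

theorem loop_map_val {α α' β : Type} (f : β → α → Timed β) (g : α' → α) (b : β) (as : List α') :
    (loop f b (as.map g)).val = (loop (fun b a => f b (g a)) b as).val := by
  induction as generalizing b with
  | nil => rfl
  | cons a as ih => simpa using ih _

theorem loop_steps_le {α β : Type} (f : β → α → Timed β) (c : ℕ) (hf : ∀ b a, (f b a).steps ≤ c)
    (b : β) (as : List α) : (loop f b as).steps ≤ as.length * c := by
  induction as generalizing b with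
  | nil => simp
  | cons a as ih =>
    have h1 := hf b a
    have h2 := ih (f b a).val
    simp only [loop_cons_steps, List.length_cons]
    linarith

/-- A loop that accumulates a conjunction computes a universal quantifier; the nested loops of
`verifyPair` are unfolded with this. -/
theorem loop_val_eq_true_iff {α : Type} (f : Bool → α → Timed Bool) (P : α → Prop)
    (hf : ∀ b a, (f b a).val = true ↔ b = true ∧ P a) (b : Bool) (as : List α) :
    (loop f b as).val = true ↔ b = true ∧ ∀ a ∈ as, P a := by
  induction as generalizing b with
  | nil => simp
  | cons a as ih => simp [ih, hf, and_assoc]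

/-- An invariant of the loop body is an invariant of the loop. -/
theorem loop_induction {α β : Type} (f : β → α → Timed β) (P : β → Prop) (as : List α)
    (hf : ∀ b, ∀ a ∈ as, P b → P (f b a).val) (b : β) (hb : P b) : P (loop f b as).val := by
  induction as generalizing b with
  | nil => exact hb
  | cons a as ih =>
    exact ih (fun b a' ha' => hf b a' (List.mem_cons_of_mem _ ha')) _ (hf b a (by simp) hb)

/-- Bits are read lowest first, so the last iteration contributes the highest bit; this drives
inductions on the word length. -/
theorem readWord_val_succ {L : ℕ} (f : Fin (L + 1) → Timed Bool) :
    (readWord f).val = (readWord fun b : Fin L => f b.castSucc).val +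
      if (f (Fin.last L)).val = true then 2 ^ L else 0 := by
  unfold readWord
  rw [List.finRange_succ_last, loop_append_val, loop_map_val]
  simp only [loop_cons_val, loop_nil, Timed.bind_val, charge_val, Timed.pure_val, Fin.val_last,
    Fin.val_castSucc]
  split <;> simp

theorem readWord_val_lt {L : ℕ} (f : Fin L → Timed Bool) : (readWord f).val < 2 ^ L := by
  induction L with
  | zero => simp [readWord]
  | succ L ih =>
    have := ih fun b => f b.castSucc
    rw [readWord_val_succ, pow_succ]
    split <;> omega

/-- The word below the top bit is less than `2 ^ L`, so adding `2 ^ L` changes bit `L` only. -/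
theorem testBit_readWord {L : ℕ} (f : Fin L → Timed Bool) (b : Fin L) :
    (readWord f).val.testBit b = (f b).val := by
  induction L with
  | zero => exact b.elim0
  | succ L ih =>
    have hlt := readWord_val_lt fun b : Fin L => f b.castSucc
    rw [readWord_val_succ]
    refine Fin.lastCases ?_ (fun b => ?_) b
    · split
      · next h => rw [add_comm, Fin.val_last, Nat.testBit_two_pow_add_eq,
          Nat.testBit_lt_two_pow hlt, h]; rfl
      · next h => rw [add_zero, Fin.val_last, Nat.testBit_lt_two_pow hlt]; simpa using h
    · rw [← ih (fun b => f b.castSucc) b, Fin.val_castSucc]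
      split
      · rw [add_comm, Nat.testBit_two_pow_add_gt b.isLt]
      · rw [add_zero]

theorem readWord_steps_le {L : ℕ} (f : Fin L → Timed Bool) (c : ℕ) (hf : ∀ b, (f b).steps ≤ c) :
    (readWord f).steps ≤ L * (c + 1) := by
  have := loop_steps_le (fun (acc : ℕ) (b : Fin L) => do
    let x ← f b
    charge 1 (if x then acc + 2 ^ (b : ℕ) else acc)) (c + 1) (fun _ b => by simpa using hf b)
    0 (List.finRange L)
  simpa [readWord] using this

/-- Two words of `L` bits with the same bits are equal. -/
theorem eq_of_testBit_fin {L x y : ℕ} (hx : x < 2 ^ L) (hy : y < 2 ^ L)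
    (h : ∀ b : Fin L, x.testBit b = y.testBit b) : x = y := by
  refine Nat.eq_of_testBit_eq fun b => ?_
  by_cases hb : b < L
  · exact h ⟨b, hb⟩
  · have hp : 2 ^ L ≤ 2 ^ b := Nat.pow_le_pow_right (by norm_num) (by omega)
    rw [Nat.testBit_lt_two_pow (by omega), Nat.testBit_lt_two_pow (by omega)]

theorem val_lt_two_pow_clog {r : ℕ} (j : Fin r) : (j : ℕ) < 2 ^ Nat.clog 2 r :=
  j.isLt.trans_le (Nat.le_pow_clog (by norm_num) r)

/-! ### Items and positions of a bin -/

section Bins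
variable {N M ℓ r p : ℕ}

theorem mem_binItems {G : Graph N M ℓ r} {i : Fin M} {v : Fin N} :
    v ∈ binItems G i ↔ ∃ e, (G (v, e)).1 = i := by
  simp [binItems, adjacency]

theorem nodup_binItems (G : Graph N M ℓ r) (i : Fin M) : (binItems G i).Nodup :=
  (List.nodup_finRange N).filter _

/-- Distinct items of a bin own distinct half-edges of it. Because of multiple edges the inequality
can be strict, and then the last columns of the signature matrix are unused in that bin. -/
theorem length_binItems_le (G : Graph N M ℓ r) (i : Fin M) : (binItems G i).length ≤ r := by
  have h : (binItems G i).toFinset ⊆ Finset.univ.image fun j => (G.symm (i, j)).1 := by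
    intro v hv
    obtain ⟨e, he⟩ := mem_binItems.1 (List.mem_toFinset.1 hv)
    refine Finset.mem_image.2 ⟨(G (v, e)).2, Finset.mem_univ _, ?_⟩
    rw [← he, Prod.mk.eta, Equiv.symm_apply_apply]
  rw [← List.toFinset_card_of_nodup (nodup_binItems G i)]
  exact (Finset.card_le_card h).trans (Finset.card_image_le.trans (by simp))

/-- The position of an item in a bin that contains it. -/
def position (G : Graph N M ℓ r) (i : Fin M) (v : Fin N) (hv : v ∈ binItems G i) : Fin r :=
  ⟨(binItems G i).idxOf v, (List.idxOf_lt_length_of_mem hv).trans_le (length_binItems_le G i)⟩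

theorem getElem?_position (G : Graph N M ℓ r) (i : Fin M) (v : Fin N) (hv : v ∈ binItems G i) :
    (binItems G i)[(position G i v hv : ℕ)]? = some v := by
  simp [position, List.getElem?_idxOf hv]

theorem eq_position {G : Graph N M ℓ r} {i : Fin M} {v : Fin N} {j : Fin r}
    (h : (binItems G i)[(j : ℕ)]? = some v) (hv : v ∈ binItems G i) : j = position G i v hv := by
  apply Fin.ext
  have h2 := getElem?_position G i v hv
  have hj : (j : ℕ) < (binItems G i).length := by
    by_contra hc
    rw [List.getElem?_eq_none (by omega)] at h
    exact absurd h (by simp)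
  exact (List.getElem?_inj hj (nodup_binItems G i)).1 (h.trans h2.symm)

/-- The positions of the defective items of a bin. -/
def defectivePositions (G : Graph N M ℓ r) (S : Finset (Fin N)) (i : Fin M) : Finset (Fin r) :=
  Finset.univ.filter fun j => ∃ v ∈ S, (binItems G i)[(j : ℕ)]? = some v

theorem mem_defectivePositions {G : Graph N M ℓ r} {S : Finset (Fin N)} {i : Fin M} {j : Fin r} :
    j ∈ defectivePositions G S i ↔ ∃ v ∈ S, (binItems G i)[(j : ℕ)]? = some v := by
  simp [defectivePositions]

theorem position_mem_defectivePositions {G : Graph N M ℓ r} {S : Finset (Fin N)} {i : Fin M}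
    {v : Fin N} (hv : v ∈ binItems G i) :
    position G i v hv ∈ defectivePositions G S i ↔ v ∈ S := by
  rw [mem_defectivePositions, getElem?_position]
  simp

theorem exists_of_mem_defectivePositions {G : Graph N M ℓ r} {S : Finset (Fin N)} {i : Fin M}
    {j : Fin r} (h : j ∈ defectivePositions G S i) :
    ∃ v ∈ S, ∃ hv : v ∈ binItems G i, j = position G i v hv := by
  obtain ⟨v, hv, hj⟩ := mem_defectivePositions.1 h
  exact ⟨v, hv, List.mem_of_getElem? hj, eq_position hj _⟩

/-- This turns statements about items into statements about positions: the results of a bin depend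
on the graph only through `defectivePositions`. -/
theorem testResults_eq_true_iff (G : Graph N M ℓ r) (U : Matrix (BinTest p r) (Fin r) Bool)
    (S : Finset (Fin N)) (i : Fin M) (t : BinTest p r) :
    testResults (testMatrix G U) S (i, t) = true ↔
      ∃ j ∈ defectivePositions G S i, U t j = true := by
  simp only [testResults, testMatrix, decide_eq_true_eq, mem_defectivePositions]
  constructor
  · rintro ⟨v, hv, j, hj, hU⟩
    exact ⟨j, ⟨v, hv, hj⟩, hU⟩
  · rintro ⟨j, ⟨v, hv, hj⟩, hU⟩
    exact ⟨v, hv, j, hj, hU⟩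

end Bins

/-! ### The bin decoders -/

/-- In a section with permutation `σ`, the Boolean sum of the columns in `D` is the Boolean sum of
the columns `l₀` and `l`. -/
def Covers {r : ℕ} (D : Finset (Fin r)) (l₀ : Fin r) (σ : Equiv.Perm (Fin r)) (l : Fin r) : Prop :=
  ∀ (b : Fin (Nat.clog 2 r)) (s : Bool),
    (∃ d ∈ D, xor s (Nat.testBit (σ d) b) = true) ↔
      (xor s (Nat.testBit (σ l₀) b) = true ∨ xor s (Nat.testBit (σ l) b) = true)

/-- Where the word of `l₀` has a `0`, the first half shows the bit of the other word; where it has a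
`1`, the complementary half shows it. So the results of one section determine the second position.
-/
theorem Covers.unique {r : ℕ} {D : Finset (Fin r)} {l₀ l l' : Fin r} {σ : Equiv.Perm (Fin r)}
    (h : Covers D l₀ σ l) (h' : Covers D l₀ σ l') : l = l' := by
  apply σ.injective
  apply Fin.ext
  refine eq_of_testBit_fin (val_lt_two_pow_clog _) (val_lt_two_pow_clog _) fun b => ?_
  have h0 := (h b false).symm.trans (h' b false)
  have h1 := (h b true).symm.trans (h' b true)
  revert h0 h1
  cases Nat.testBit (σ l) b <;> cases Nat.testBit (σ l') b <;> cases Nat.testBit (σ l₀) b <;> simp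

/-- The swap moves no position of `D`, so the results of the section stay the same, while `x`
inherits the word of `l`. This symmetry makes all positions outside `D` equally likely to be the
false candidate. -/
theorem Covers.mul_swap {r : ℕ} {D : Finset (Fin r)} {l₀ l x : Fin r} {σ : Equiv.Perm (Fin r)}
    (h : Covers D l₀ σ l) (h₀ : l₀ ∈ D) (hl : l ∉ D) (hx : x ∉ D) :
    Covers D l₀ (σ * Equiv.swap l x) x := by
  have hD : ∀ d ∈ D, (σ * Equiv.swap l x) d = σ d := fun d hd => by
    rw [Equiv.Perm.mul_apply, Equiv.swap_apply_of_ne_of_ne]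
    · rintro rfl; exact hl hd
    · rintro rfl; exact hx hd
  intro b s
  rw [hD l₀ h₀, Equiv.Perm.mul_apply, Equiv.swap_apply_right, ← h b s]
  constructor <;> rintro ⟨d, hd, h⟩ <;> refine ⟨d, hd, ?_⟩ <;> simpa [hD d hd] using h

section Decoder
variable {N M ℓ r p : ℕ}

theorem sectionPerm_zero [NeZero p] (π : Fin (p - 1) → Equiv.Perm (Fin r)) :
    sectionPerm π (0 : Fin p) = 1 := by
  simp [sectionPerm]

theorem sectionPerm_succ (π : Fin (p - 1) → Equiv.Perm (Fin r)) (k : Fin (p - 1)) :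
    sectionPerm π ⟨k + 1, by have := k.isLt; omega⟩ = π k := by
  simp [sectionPerm]

/-- The results of the tests of the ensemble. -/
abbrev results (S : Finset (Fin N)) (ω : Outcome N M ℓ r p) : Test M p r → Bool :=
  testResults (testMatrix ω.1 (signature ω.2)) S

theorem verifyPair_val_iff (ω : Outcome N M ℓ r p) (S : Finset (Fin N)) (i : Fin M)
    (l₀ l : Fin r) :
    (verifyPair ω (results S ω) i l₀ l).val = true ↔
      ∀ k, Covers (defectivePositions ω.1 S i) l₀ (sectionPerm ω.2 k) l := by
  unfold verifyPair
  rw [loop_val_eq_true_iff _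
    (fun k => Covers (defectivePositions ω.1 S i) l₀ (sectionPerm ω.2 k) l)]
  · simp
  · intro ok k
    simp only [Timed.bind_val, charge_val]
    rw [loop_val_eq_true_iff _ (fun b : Fin (Nat.clog 2 r) => ∀ s : Bool,
      (∃ d ∈ defectivePositions ω.1 S i,
        xor s (Nat.testBit (sectionPerm ω.2 k d) b) = true) ↔
      (xor s (Nat.testBit (sectionPerm ω.2 k l₀) b) = true ∨
        xor s (Nat.testBit (sectionPerm ω.2 k l) b) = true))]
    · simp [Covers]
    · intro ok b
      rw [loop_val_eq_true_iff _ (fun s =>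
        (∃ d ∈ defectivePositions ω.1 S i,
          xor s (Nat.testBit (sectionPerm ω.2 k d) b) = true) ↔
        (xor s (Nat.testBit (sectionPerm ω.2 k l₀) b) = true ∨
          xor s (Nat.testBit (sectionPerm ω.2 k l) b) = true))]
      · simp
      · intro ok s
        simp only [Timed.bind_val, charge_val, Bool.and_eq_true, beq_iff_eq]
        refine and_congr_right fun _ => ?_
        rw [Bool.eq_iff_iff, testResults_eq_true_iff, Bool.or_eq_true]
        rfl

theorem verifyPair_steps_le (ω : Outcome N M ℓ r p) (y : Test M p r → Bool) (i : Fin M)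
    (l₀ l : Fin r) :
    (verifyPair ω y i l₀ l).steps ≤ p * (2 * wordCost N ℓ + Nat.clog 2 r * 8) := by
  unfold verifyPair
  refine (loop_steps_le _ (2 * wordCost N ℓ + Nat.clog 2 r * 8) (fun ok k => ?_) _ _).trans
    (by simp)
  simp only [Timed.bind_steps, charge_val, charge_steps]
  have : ∀ (f : Bool → Fin (Nat.clog 2 r) → Timed Bool), (∀ b a, (f b a).steps ≤ 8) →
      (loop f ok (List.finRange (Nat.clog 2 r))).steps ≤ Nat.clog 2 r * 8 := fun f hf =>
    (loop_steps_le f 8 hf ok _).trans (by simp)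
  have h2 := this (fun ok b =>
      loop (fun ok s => do
        let e ← charge 1 (y (i, k, s, b))
        let a₀ ← charge 1 (xor s ((sectionPerm ω.2 k l₀ : ℕ).testBit b))
        let a₁ ← charge 1 (xor s ((sectionPerm ω.2 k l : ℕ).testBit b))
        charge 1 (ok && (e == (a₀ || a₁)))) ok [false, true]) (fun ok b => by simp)
  linarith

end Decoder

section BinDecoders
variable {N M ℓ r p : ℕ} [NeZero p]

theorem decodeSingleton_val (ω : Outcome N M ℓ r p) (y : Test M p r → Bool) (i : Fin M) (l : ℕ)
    (hl : (readWord fun b : Fin (Nat.clog 2 r) => charge 1 (y (i, 0, false, b))).val = l) :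
    (decodeSingleton ω y i).val = if h : l < r then
      (if (verifyPair ω y i ⟨l, h⟩ ⟨l, h⟩).val = true then (binItems ω.1 i)[l]? else none)
      else none := by
  subst hl
  unfold decodeSingleton
  rw [Timed.bind_val]
  split <;> rfl

theorem decodeDoubleton_val (ω : Outcome N M ℓ r p) (y : Test M p r → Bool) (i : Fin M)
    (l₀ l : ℕ)
    (hl : (readWord fun b : Fin (Nat.clog 2 r) => do
      let a ← charge 1 (l₀.testBit b)
      let e ← charge 1 (y (i, 0, a, b))
      charge 1 (xor a e)).val = l) :
    (decodeDoubleton ω y i l₀).val = if h : l₀ < r ∧ l < r then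
      (if (verifyPair ω y i ⟨l₀, h.1⟩ ⟨l, h.2⟩).val = true then (binItems ω.1 i)[l]? else none)
      else none := by
  subst hl
  unfold decodeDoubleton
  rw [Timed.bind_val]
  split <;> rfl

theorem wordCost_pos (N ℓ : ℕ) : 1 ≤ wordCost N ℓ := Nat.le_add_left _ _

/-- A bound for the number of steps of a bin decoder. -/
def binCost (N ℓ r p : ℕ) : ℕ :=
  Nat.clog 2 r * 4 + p * (2 * wordCost N ℓ + Nat.clog 2 r * 8) + wordCost N ℓ + 1

theorem decodeSingleton_steps_le (ω : Outcome N M ℓ r p) (y : Test M p r → Bool) (i : Fin M) :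
    (decodeSingleton ω y i).steps ≤ binCost N ℓ r p := by
  unfold decodeSingleton binCost
  rw [Timed.bind_steps]
  have h1 := readWord_steps_le (fun b : Fin (Nat.clog 2 r) => charge 1 (y (i, 0, false, b))) 3
    (fun b => by simp)
  split
  · next h =>
    have h2 := verifyPair_steps_le ω y i ⟨_, h⟩ ⟨_, h⟩
    simp only [Timed.bind_steps, charge_steps]
    omega
  · simp only [charge_steps]
    omega

theorem decodeDoubleton_steps_le (ω : Outcome N M ℓ r p) (y : Test M p r → Bool) (i : Fin M)
    (l₀ : ℕ) : (decodeDoubleton ω y i l₀).steps ≤ binCost N ℓ r p := by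
  unfold decodeDoubleton binCost
  rw [Timed.bind_steps]
  have h1 := readWord_steps_le (fun b : Fin (Nat.clog 2 r) => do
      let a ← charge 1 (l₀.testBit b)
      let e ← charge 1 (y (i, 0, a, b))
      charge 1 (xor a e)) 3 (fun b => by simp)
  split
  · next h =>
    have h2 := verifyPair_steps_le ω y i ⟨_, h.1⟩ ⟨_, h.2⟩
    simp only [Timed.bind_steps, charge_steps]
    omega
  · simp only [charge_steps]
    omega

theorem results_section_zero (S : Finset (Fin N)) (ω : Outcome N M ℓ r p) (i : Fin M) (s : Bool)
    (b : Fin (Nat.clog 2 r)) :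
    results S ω (i, 0, s, b) = true ↔
      ∃ j ∈ defectivePositions ω.1 S i, xor s (Nat.testBit j b) = true := by
  rw [testResults_eq_true_iff]
  simp [signature, sectionPerm_zero]

/-- The singleton decoder decodes a bin with a single defective item. -/
theorem decodeSingleton_eq_some (S : Finset (Fin N)) (ω : Outcome N M ℓ r p) (i : Fin M)
    (v : Fin N) (hv : v ∈ binItems ω.1 i)
    (hD : defectivePositions ω.1 S i = {position ω.1 i v hv}) :
    (decodeSingleton ω (results S ω) i).val = some v := by
  rw [decodeSingleton_val ω _ i (position ω.1 i v hv), dif_pos (position ω.1 i v hv).isLt, if_pos,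
    getElem?_position]
  · rw [verifyPair_val_iff]
    intro k b s
    simp [hD]
  · refine eq_of_testBit_fin (readWord_val_lt _) (val_lt_two_pow_clog _) fun b => ?_
    rw [testBit_readWord, charge_val, Bool.eq_iff_iff, results_section_zero, hD]
    simp

/-- The double-ton decoder decodes the other one of two defective items of a bin. -/
theorem decodeDoubleton_eq_some (S : Finset (Fin N)) (ω : Outcome N M ℓ r p) (i : Fin M)
    (u v : Fin N) (hu : u ∈ binItems ω.1 i) (hv : v ∈ binItems ω.1 i)
    (hD : defectivePositions ω.1 S i = {position ω.1 i u hu, position ω.1 i v hv}) :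
    (decodeDoubleton ω (results S ω) i ((binItems ω.1 i).idxOf u)).val = some v := by
  change (decodeDoubleton ω (results S ω) i (position ω.1 i u hu)).val = some v
  rw [decodeDoubleton_val ω _ i _ (position ω.1 i v hv),
    dif_pos ⟨(position ω.1 i u hu).isLt, (position ω.1 i v hv).isLt⟩, if_pos,
    getElem?_position]
  · rw [verifyPair_val_iff]
    intro k b s
    simp [hD]
  · refine eq_of_testBit_fin (readWord_val_lt _) (val_lt_two_pow_clog _) fun b => ?_
    rw [testBit_readWord]
    simp only [Timed.bind_val, charge_val]
    -- In the half selected by the bit of `u`, column `u` is `0`, so the result is the contribution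
    -- of `v` alone.
    have h := results_section_zero S ω i (Nat.testBit (position ω.1 i u hu) b) b
    rw [hD] at h
    simp only [Finset.mem_insert, Finset.mem_singleton, exists_eq_or_imp, exists_eq_left,
      Bool.xor_self, Bool.false_eq_true, false_or] at h
    rw [Bool.eq_iff_iff.2 h]
    simp

/-- The singleton decoder never declares an item that is not defective. -/
theorem mem_of_decodeSingleton (S : Finset (Fin N)) (ω : Outcome N M ℓ r p) (i : Fin M)
    (v : Fin N) (hr : 2 ≤ r) (h : (decodeSingleton ω (results S ω) i).val = some v) : v ∈ S := by
  rw [decodeSingleton_val ω _ i _ rfl] at h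
  split at h
  swap
  · exact absurd h (by simp)
  next hl =>
  split at h
  swap
  · exact absurd h (by simp)
  next hok =>
  rw [verifyPair_val_iff] at hok
  have h0 := hok 0
  rw [sectionPerm_zero] at h0
  set l : Fin r := ⟨_, hl⟩ with hldef
  -- A nonempty word is needed here: for `r = 1` there are no tests, and an empty bin would pass the
  -- check. In the half chosen below, column `l` has a `1`, so the test is positive and some item is
  -- defective.
  have hD : (defectivePositions ω.1 S i).Nonempty := by
    have hb : 0 < Nat.clog 2 r := Nat.clog_pos (by norm_num) hr
    obtain ⟨d, hd, -⟩ := (h0 ⟨0, hb⟩ (!Nat.testBit l 0)).2 (by simp)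
    exact ⟨d, hd⟩
  obtain ⟨d, hd⟩ := hD
  have hdl : d = l := by
    apply Fin.ext
    -- At each bit, look at the half where column `d` has a `1`: the test is positive, so column `l`
    -- has a `1` there too.
    refine eq_of_testBit_fin (val_lt_two_pow_clog _) (val_lt_two_pow_clog _) fun b => ?_
    have := (h0 b (!Nat.testBit d b)).1 ⟨d, hd, by simp⟩
    revert this
    simp only [Equiv.Perm.one_apply, or_self]
    cases Nat.testBit d b <;> cases Nat.testBit l b <;> simp
  obtain ⟨w, hw, hwd⟩ := mem_defectivePositions.1 hd
  rw [hdl, h] at hwd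
  rwa [Option.some.inj hwd]

/-- If the double-ton decoder, given a defective item, declares an item that is not defective,
then some column of a non-defective item completes the bin in all the sections. -/
theorem exists_covers_of_decodeDoubleton (S : Finset (Fin N)) (ω : Outcome N M ℓ r p) (i : Fin M)
    (u w : Fin N) (hu : u ∈ binItems ω.1 i)
    (h : (decodeDoubleton ω (results S ω) i ((binItems ω.1 i).idxOf u)).val = some w)
    (hw : w ∉ S) :
    ∃ l ∉ defectivePositions ω.1 S i,
      ∀ k, Covers (defectivePositions ω.1 S i) (position ω.1 i u hu) (sectionPerm ω.2 k) l := by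
  rw [decodeDoubleton_val ω _ i _ _ rfl] at h
  split at h
  swap
  · exact absurd h (by simp)
  next hl =>
  split at h
  swap
  · exact absurd h (by simp)
  next hok =>
  rw [verifyPair_val_iff] at hok
  refine ⟨⟨_, hl.2⟩, fun hmem => ?_, hok⟩
  obtain ⟨v, hv, hvd⟩ := mem_defectivePositions.1 hmem
  rw [h] at hvd
  exact hw (Option.some.inj hvd ▸ hv)

end BinDecoders

/-! ### The peeling decoder -/

section Peeling
variable {N M ℓ r p : ℕ}

theorem pushNew_steps_le (ℓ : ℕ) (D P : List (Fin N)) (o : Option (Fin N)) :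
    (pushNew ℓ D P o).steps ≤ 2 * wordCost N ℓ := by
  cases o with
  | none => have := wordCost_pos N ℓ; simp only [pushNew, charge_steps]; omega
  | some w => simp [pushNew]

theorem subset_pushNew (ℓ : ℕ) (D P : List (Fin N)) (o : Option (Fin N)) :
    D ⊆ (pushNew ℓ D P o).val := by
  cases o with
  | none => simp [pushNew]
  | some w =>
    simp only [pushNew, charge_val]
    split <;> simp

theorem mem_pushNew {ℓ : ℕ} {D P : List (Fin N)} {o : Option (Fin N)} {w : Fin N}
    (h : w ∈ (pushNew ℓ D P o).val) : w ∈ D ∨ o = some w := by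
  cases o with
  | none => exact Or.inl (by simpa [pushNew] using h)
  | some x =>
    simp only [pushNew, charge_val] at h
    split at h
    · exact Or.inl h
    · rcases List.mem_append.1 h with h | h
      · exact Or.inl h
      · exact Or.inr (by rw [List.mem_singleton.1 h])

theorem mem_pushNew_some (ℓ : ℕ) (D P : List (Fin N)) (w : Fin N) :
    w ∈ (pushNew ℓ D P (some w)).val ∨ w ∈ P := by
  simp only [pushNew, charge_val]
  split
  · next h => exact h
  · simp

/-- The queue and the peeled items together stay free of repetitions. This bounds the number of
iterations by `N`, and lets the length of the final list be counted as the size of the output. -/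
theorem nodup_pushNew (ℓ : ℕ) (D P : List (Fin N)) (o : Option (Fin N)) (h : (D ++ P).Nodup) :
    ((pushNew ℓ D P o).val ++ P).Nodup := by
  cases o with
  | none => exact h
  | some w =>
    simp only [pushNew, charge_val]
    split
    · exact h
    · next hw =>
      push Not at hw
      rw [List.append_assoc, List.singleton_append, List.nodup_middle]
      exact List.nodup_cons.2 ⟨by simpa using hw, h⟩

section Loop
variable {α : Type} (o : α → Timed (Option (Fin N))) (ℓ : ℕ) (P : List (Fin N))

/-! The loop runs the bin decoder `o` on a list and appends the decoded items to the queue. -/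

/-- The body `f` is constrained only through its value, so that these lemmas serve both the
singleton phase and the peeling iterations, whatever steps are charged. -/
theorem subset_pushLoop (f : List (Fin N) → α → Timed (List (Fin N)))
    (hf : ∀ D a, (f D a).val = (pushNew ℓ D P (o a).val).val) (D : List (Fin N)) (as : List α) :
    D ⊆ (loop f D as).val := by
  refine loop_induction f (fun D' => D ⊆ D') as (fun D' a _ h => ?_) D (List.Subset.refl D)
  rw [hf]
  exact List.Subset.trans h (subset_pushNew _ _ _ _)

theorem nodup_pushLoop (f : List (Fin N) → α → Timed (List (Fin N)))
    (hf : ∀ D a, (f D a).val = (pushNew ℓ D P (o a).val).val) (D : List (Fin N)) (as : List α)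
    (hD : (D ++ P).Nodup) : ((loop f D as).val ++ P).Nodup := by
  refine loop_induction f (fun D' => (D' ++ P).Nodup) as (fun D' a _ h => ?_) D hD
  rw [hf]
  exact nodup_pushNew _ _ _ _ h

theorem mem_pushLoop (f : List (Fin N) → α → Timed (List (Fin N)))
    (hf : ∀ D a, (f D a).val = (pushNew ℓ D P (o a).val).val) (D : List (Fin N)) (as : List α) :
    ∀ w ∈ (loop f D as).val, w ∈ D ∨ ∃ a ∈ as, (o a).val = some w := by
  refine loop_induction f (fun D' => ∀ w ∈ D', w ∈ D ∨ ∃ a ∈ as, (o a).val = some w) as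
    (fun D' a ha h w hw => ?_) D fun w hw => Or.inl hw
  rw [hf] at hw
  rcases mem_pushNew hw with hw | hw
  · exact h w hw
  · exact Or.inr ⟨a, ha, hw⟩

theorem mem_pushLoop_of_eq_some (f : List (Fin N) → α → Timed (List (Fin N)))
    (hf : ∀ D a, (f D a).val = (pushNew ℓ D P (o a).val).val) (D : List (Fin N)) (as : List α)
    (a : α) (ha : a ∈ as) (w : Fin N) (hw : (o a).val = some w) :
    w ∈ (loop f D as).val ∨ w ∈ P := by
  induction as generalizing D with
  | nil => simp at ha
  | cons a' as ih =>
    rw [loop_cons_val]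
    rcases List.mem_cons.1 ha with rfl | ha
    · rw [hf, hw]
      rcases mem_pushNew_some ℓ D P w with h | h
      · exact Or.inl (subset_pushLoop o ℓ P f hf _ _ h)
      · exact Or.inr h
    · exact ih _ ha

end Loop

variable [NeZero p] (ω : Outcome N M ℓ r p) (y : Test M p r → Bool)

/-- What the double-ton decoder finds in the bin at edge `e` of item `v`. -/
def neighbor (v : Fin N) (e : Fin ℓ) : Timed (Option (Fin N)) :=
  decodeDoubleton ω y (ω.1 (v, e)).1 ((binItems ω.1 (ω.1 (v, e)).1).idxOf v)

/-- Apply the double-ton decoder to the bin at edge `e` of item `v`. -/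
def processEdge (v : Fin N) (P D : List (Fin N)) (e : Fin ℓ) : Timed (List (Fin N)) := do
  let i ← charge (wordCost N ℓ) (ω.1 (v, e)).1
  let l₀ ← charge (wordCost N ℓ) ((binItems ω.1 i).idxOf v)
  let o ← decodeDoubleton ω y i l₀
  pushNew ℓ D P o

/-- The queue after the bins of item `v` have been processed. -/
def processItem (v : Fin N) (D P : List (Fin N)) : Timed (List (Fin N)) :=
  loop (processEdge ω y v P) D (List.finRange ℓ)

theorem peel_cons_val (n : ℕ) (v : Fin N) (D P : List (Fin N)) :
    (peel ω y (n + 1) (v :: D) P).val =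
      (peel ω y n (processItem ω y v D (v :: P)).val (v :: P)).val := rfl

theorem peel_cons_steps (n : ℕ) (v : Fin N) (D P : List (Fin N)) :
    (peel ω y (n + 1) (v :: D) P).steps =
      2 * wordCost N ℓ + ((processItem ω y v D (v :: P)).steps +
        (peel ω y n (processItem ω y v D (v :: P)).val (v :: P)).steps) := rfl

/-- A bound for the number of steps in which one item is peeled. -/
def itemCost (N ℓ r p : ℕ) : ℕ :=
  2 * wordCost N ℓ + ℓ * (4 * wordCost N ℓ + binCost N ℓ r p)

theorem processItem_steps_le (v : Fin N) (D P : List (Fin N)) :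
    (processItem ω y v D P).steps ≤ ℓ * (4 * wordCost N ℓ + binCost N ℓ r p) := by
  refine (loop_steps_le _ (4 * wordCost N ℓ + binCost N ℓ r p) (fun D e => ?_) _ _).trans
    (by simp)
  simp only [processEdge, Timed.bind_steps, charge_steps, charge_val]
  have h1 := pushNew_steps_le ℓ D P (neighbor ω y v e).val
  have h2 := decodeDoubleton_steps_le ω y (ω.1 (v, e)).1
    ((binItems ω.1 (ω.1 (v, e)).1).idxOf v)
  unfold neighbor at h1
  omega

theorem nodup_processItem {v : Fin N} {D P : List (Fin N)} (h : ((v :: D) ++ P).Nodup) :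
    ((processItem ω y v D (v :: P)).val ++ v :: P).Nodup :=
  nodup_pushLoop (neighbor ω y v) ℓ (v :: P) (processEdge ω y v (v :: P)) (fun _ _ => rfl) D _ (List.nodup_middle.2 h)

/-- Amortisation: each iteration lengthens `P` by one and costs at most `itemCost`, so the steps
telescope against the length of the peeled list. The final `1` pays for noticing the empty queue. -/
theorem peel_steps_le (n : ℕ) (D P : List (Fin N)) :
    (peel ω y n D P).steps + P.length * itemCost N ℓ r p ≤
      (peel ω y n D P).val.length * itemCost N ℓ r p + 1 := by
  induction n generalizing D P with
  | zero => simp [peel]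
  | succ n ih =>
    cases D with
    | nil => simp [peel, add_comm]
    | cons v D =>
      have h1 := ih (processItem ω y v D (v :: P)).val (v :: P)
      have h2 := processItem_steps_le ω y v D (v :: P)
      rw [peel_cons_val, peel_cons_steps]
      rw [List.length_cons, add_mul, one_mul] at h1
      have h3 : itemCost N ℓ r p = 2 * wordCost N ℓ + ℓ * (4 * wordCost N ℓ + binCost N ℓ r p) :=
        rfl
      omega

theorem nodup_peel (n : ℕ) (D P : List (Fin N)) (h : (D ++ P).Nodup) :
    (peel ω y n D P).val.Nodup := by
  induction n generalizing D P with
  | zero => exact (List.nodup_append.1 h).2.1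
  | succ n ih =>
    cases D with
    | nil => exact h
    | cons v D => exact ih _ _ (nodup_processItem ω y h)

theorem subset_peel (n : ℕ) (D P : List (Fin N)) : P ⊆ (peel ω y n D P).val := by
  induction n generalizing D P with
  | zero => exact List.Subset.refl _
  | succ n ih =>
    cases D with
    | nil => exact List.Subset.refl _
    | cons v D => exact List.Subset.trans (List.subset_cons_self v P) (ih _ _)

/-- With enough fuel, the whole queue is peeled, and so is everything that the peeled items
reveal. -/
theorem peel_complete (n : ℕ) (D P : List (Fin N)) (h : (D ++ P).Nodup) (hn : N ≤ n + P.length) :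
    D ⊆ (peel ω y n D P).val ∧ ∀ u ∈ (peel ω y n D P).val, u ∉ P → ∀ e w,
      (neighbor ω y u e).val = some w → w ∈ (peel ω y n D P).val := by
  induction n generalizing D P with
  | zero =>
    -- Without fuel, `P` already has `N` items; since there are no repetitions, nothing is left for
    -- the queue.
    have hlen : (D ++ P).length ≤ N := by simpa using h.length_le_card
    rw [List.length_append] at hlen
    have : D = [] := List.eq_nil_of_length_eq_zero (by omega)
    subst this
    exact ⟨by simp, fun u hu hu' => absurd hu hu'⟩
  | succ n ih =>
    cases D with
    | nil => exact ⟨by simp, fun u hu hu' => absurd hu hu'⟩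
    | cons v D =>
      obtain ⟨h1, h2⟩ := ih _ _ (nodup_processItem ω y h) (by rw [List.length_cons]; omega)
      have h3 := subset_peel ω y n (processItem ω y v D (v :: P)).val (v :: P)
      rw [peel_cons_val]
      refine ⟨List.cons_subset.2 ⟨h3 (by simp), List.Subset.trans
        (subset_pushLoop (neighbor ω y v) ℓ (v :: P) (processEdge ω y v (v :: P)) (fun _ _ => rfl) D _) h1⟩, ?_⟩
      intro u hu hu' e w hw
      by_cases huv : u = v
      · subst huv
        rcases mem_pushLoop_of_eq_some (neighbor ω y u) ℓ (u :: P) (processEdge ω y u (u :: P)) (fun _ _ => rfl) D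
          (List.finRange ℓ) e (List.mem_finRange e) w hw with h | h
        · exact h1 h
        · exact h3 h
      · exact h2 u hu (by simp [huv, hu']) e w hw

theorem peel_sound (S : Finset (Fin N))
    (hS : ∀ u ∈ S, ∀ e w, (neighbor ω y u e).val = some w → w ∈ S) (n : ℕ) (D P : List (Fin N))
    (hD : ∀ v ∈ D, v ∈ S) (hP : ∀ v ∈ P, v ∈ S) : ∀ v ∈ (peel ω y n D P).val, v ∈ S := by
  induction n generalizing D P with
  | zero => exact hP
  | succ n ih =>
    cases D with
    | nil => exact hP
    | cons v D =>
      have hv : v ∈ S := hD v (by simp)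
      refine ih _ _ (fun w hw => ?_) (fun w hw => ?_)
      · rcases mem_pushLoop (neighbor ω y v) ℓ (v :: P) (processEdge ω y v (v :: P)) (fun _ _ => rfl) D _ w hw with
          h | ⟨e, -, he⟩
        · exact hD w (by simp [h])
        · exact hS v hv e w he
      · rcases List.mem_cons.1 hw with rfl | h
        · exact hv
        · exact hP w h

/-- Apply the singleton decoder to bin `i`. -/
def processBin (D : List (Fin N)) (i : Fin M) : Timed (List (Fin N)) := do
  let o ← decodeSingleton ω y i
  pushNew ℓ D [] o

/-- The queue after the singleton decoder has been applied to all the bins. -/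
def singletons : Timed (List (Fin N)) :=
  loop (processBin ω y) [] (List.finRange M)

theorem decode_val : (decode ω y).val = (peel ω y N (singletons ω y).val []).val.toFinset := rfl

theorem decode_steps : (decode ω y).steps =
    (singletons ω y).steps + ((peel ω y N (singletons ω y).val []).steps + 0) := rfl

theorem nodup_singletons : ((singletons ω y).val ++ []).Nodup :=
  nodup_pushLoop (decodeSingleton ω y) ℓ [] (processBin ω y) (fun _ _ => rfl) [] _ (by simp)

/-- The bound depends on the size of the output. This is why the running time is controlled as soon
as no item is wrongly declared. -/
theorem decode_steps_le : (decode ω y).steps ≤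
    M * (binCost N ℓ r p + 2 * wordCost N ℓ) +
      (decode ω y).val.card * itemCost N ℓ r p + 1 := by
  rw [decode_val, decode_steps, List.toFinset_card_of_nodup
    (nodup_peel ω y _ _ _ (nodup_singletons ω y))]
  have h1 := peel_steps_le ω y N (singletons ω y).val []
  have h2 : (singletons ω y).steps ≤ M * (binCost N ℓ r p + 2 * wordCost N ℓ) := by
    refine (loop_steps_le _ (binCost N ℓ r p + 2 * wordCost N ℓ) (fun D i => ?_) _ _).trans
      (by simp)
    have h3 := decodeSingleton_steps_le ω y i
    have h4 := pushNew_steps_le ℓ D [] (decodeSingleton ω y i).val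
    simp only [processBin, Timed.bind_steps]
    omega
  simp only [List.length_nil, zero_mul] at h1
  omega

theorem mem_decode_of_singleton {i : Fin M} {v : Fin N}
    (h : (decodeSingleton ω y i).val = some v) : v ∈ (decode ω y).val := by
  rw [decode_val, List.mem_toFinset]
  refine (peel_complete ω y N _ [] (nodup_singletons ω y) (by simp)).1 ?_
  simpa [singletons] using mem_pushLoop_of_eq_some (decodeSingleton ω y) ℓ [] (processBin ω y) (fun _ _ => rfl) []
    (List.finRange M) i (List.mem_finRange i) v h

theorem mem_decode_of_neighbor {u w : Fin N} {e : Fin ℓ} (hu : u ∈ (decode ω y).val)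
    (h : (neighbor ω y u e).val = some w) : w ∈ (decode ω y).val := by
  rw [decode_val, List.mem_toFinset] at *
  exact (peel_complete ω y N _ [] (nodup_singletons ω y) (by simp)).2 u hu (by simp) e w h

theorem decode_subset (S : Finset (Fin N))
    (h1 : ∀ i v, (decodeSingleton ω y i).val = some v → v ∈ S)
    (h2 : ∀ u ∈ S, ∀ e w, (neighbor ω y u e).val = some w → w ∈ S) : (decode ω y).val ⊆ S := by
  intro v hv
  rw [decode_val, List.mem_toFinset] at hv
  refine peel_sound ω y S h2 N _ [] (fun w hw => ?_) (by simp) v hv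
  rcases mem_pushLoop (decodeSingleton ω y) ℓ [] (processBin ω y) (fun _ _ => rfl) [] _ w hw with h | ⟨i, -, hi⟩
  · simp at h
  · exact h1 i w hi

end Peeling
open scoped BigOperators

/-! ### Uniform probability on finite types -/

section Prob

theorem prob_nonneg {Ω : Type} (E : Ω → Prop) : 0 ≤ prob E := by unfold prob; positivity

variable {Ω Ω' : Type} [Fintype Ω] [Fintype Ω']

theorem prob_eq_expect (E : Ω → Prop) [DecidablePred E] :
    prob E = 𝔼 ω, if E ω then (1 : ℝ) else 0 := by
  rw [prob, Nat.card_eq_fintype_card, Nat.card_eq_fintype_card, Fintype.card_subtype,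
    Fintype.expect_eq_sum_div_card, Finset.sum_boole]

theorem prob_le_one (E : Ω → Prop) : prob E ≤ 1 := by
  unfold prob
  refine div_le_one_of_le₀ ?_ (by positivity)
  exact_mod_cast Nat.card_le_card_of_injective _ Subtype.val_injective

theorem prob_mono {E F : Ω → Prop} (h : ∀ ω, E ω → F ω) : prob E ≤ prob F := by
  classical
  rw [prob_eq_expect, prob_eq_expect]
  refine Finset.expect_le_expect fun ω _ => ?_
  have := h ω
  split_ifs <;> simp_all

theorem prob_or_le (E F : Ω → Prop) : prob (fun ω => E ω ∨ F ω) ≤ prob E + prob F := by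
  classical
  rw [prob_eq_expect, prob_eq_expect, prob_eq_expect, ← Finset.expect_add_distrib]
  refine Finset.expect_le_expect fun ω _ => ?_
  split_ifs <;> simp_all

theorem prob_exists_le {ι : Type} (s : Finset ι) (E : ι → Ω → Prop) :
    prob (fun ω => ∃ i ∈ s, E i ω) ≤ ∑ i ∈ s, prob (E i) := by
  classical
  simp only [prob_eq_expect]
  rw [← Finset.expect_sum_comm]
  refine Finset.expect_le_expect fun ω _ => ?_
  split_ifs with h
  · obtain ⟨i, hi, hE⟩ := h
    refine le_trans ?_ (Finset.single_le_sum (f := fun i => if E i ω then (1 : ℝ) else 0)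
      (fun i _ => by split_ifs <;> simp) hi)
    simp [hE]
  · exact Finset.sum_nonneg fun i _ => by split_ifs <;> simp

theorem prob_not [Nonempty Ω] (E : Ω → Prop) : prob (fun ω => ¬ E ω) = 1 - prob E := by
  classical
  rw [prob_eq_expect, prob_eq_expect, eq_sub_iff_add_eq, ← Finset.expect_add_distrib]
  have : ∀ ω, ((if ¬ E ω then (1 : ℝ) else 0) + if E ω then 1 else 0) = 1 := fun ω => by
    split_ifs <;> simp_all
  rw [Finset.expect_congr rfl fun ω _ => this ω, Fintype.expect_const]

theorem prob_equiv (e : Ω ≃ Ω') (E : Ω' → Prop) : prob (fun ω => E (e ω)) = prob E := by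
  classical
  rw [prob_eq_expect, prob_eq_expect]
  exact Fintype.expect_equiv e _ _ fun _ => rfl

theorem prob_prod (E : Ω × Ω' → Prop) :
    prob E = 𝔼 ω, prob fun ω' => E (ω, ω') := by
  classical
  simp only [prob_eq_expect]
  rw [← Finset.univ_product_univ, Finset.expect_product]

theorem prob_fst [Nonempty Ω'] (E : Ω → Prop) : prob (fun ω : Ω × Ω' => E ω.1) = prob E := by
  classical
  simp only [prob_eq_expect]
  rw [← Finset.univ_product_univ, Finset.expect_product]
  exact Finset.expect_congr rfl fun ω _ =>
    Fintype.expect_const (ι := Ω') (if E ω then (1 : ℝ) else 0)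

/-- A bound for the mean of a function that is small outside an event. -/
theorem expect_le_add_prob [Nonempty Ω] (f : Ω → ℝ) (E : Ω → Prop) (a : ℝ) (hf : ∀ ω, f ω ≤ 1)
    (ha : 0 ≤ a) (h : ∀ ω, ¬ E ω → f ω ≤ a) : 𝔼 ω, f ω ≤ a + prob E := by
  classical
  have : a + prob E = 𝔼 ω, (a + if E ω then (1 : ℝ) else 0) := by
    rw [Finset.expect_add_distrib, Fintype.expect_const, prob_eq_expect]
  rw [this]
  refine Finset.expect_le_expect fun ω _ => ?_
  split_ifs with hE
  · linarith [hf ω]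
  · linarith [h ω hE]

theorem prob_le_expect_div (f : Ω → ℝ) (hf : ∀ ω, 0 ≤ f ω) (a : ℝ) (ha : 0 < a) (E : Ω → Prop)
    (h : ∀ ω, E ω → a ≤ f ω) : prob E ≤ (𝔼 ω, f ω) / a := by
  classical
  rw [prob_eq_expect, Finset.expect_div]
  refine Finset.expect_le_expect fun ω _ => ?_
  split_ifs with hE
  · exact (one_le_div ha).2 (h ω hE)
  · exact div_nonneg (hf ω) ha.le

end Prob

/-! ### The method of bounded differences -/

/-- Hoeffding's lemma: `exp` lies below its chord over `[-s c, s c]`, and the linear term of the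
chord has mean zero, which leaves `cosh (s c)`. -/
theorem expect_exp_le {X : Type} [Fintype X] [Nonempty X] (Y : X → ℝ) (c : ℝ) (hc : 0 < c)
    (hY : ∀ x, |Y x| ≤ c) (h0 : 𝔼 x, Y x = 0) (s : ℝ) :
    𝔼 x, Real.exp (s * Y x) ≤ Real.exp (s ^ 2 * c ^ 2 / 2) := by
  have hconv : ∀ x, Real.exp (s * Y x) ≤
      Real.cosh (s * c) + Y x * ((Real.exp (s * c) - Real.exp (-(s * c))) / (2 * c)) := by
    intro x
    obtain ⟨h1, h2⟩ := abs_le.1 (hY x)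
    have h := convexOn_exp.2 (Set.mem_univ (s * c)) (Set.mem_univ (-(s * c)))
      (show 0 ≤ (c + Y x) / (2 * c) from div_nonneg (by linarith) (by linarith))
      (show 0 ≤ (c - Y x) / (2 * c) from div_nonneg (by linarith) (by linarith))
      (by field_simp; ring)
    rw [smul_eq_mul, smul_eq_mul, smul_eq_mul, smul_eq_mul] at h
    have e1 : (c + Y x) / (2 * c) * (s * c) + (c - Y x) / (2 * c) * -(s * c) = s * Y x := by
      field_simp; ring
    rw [e1] at h
    refine h.trans_eq ?_
    rw [Real.cosh_eq]
    field_simp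
    ring
  calc 𝔼 x, Real.exp (s * Y x)
      ≤ 𝔼 x, (Real.cosh (s * c) +
          Y x * ((Real.exp (s * c) - Real.exp (-(s * c))) / (2 * c))) :=
        Finset.expect_le_expect fun x _ => hconv x
    _ = Real.cosh (s * c) := by
        rw [Finset.expect_add_distrib, Fintype.expect_const, ← Finset.expect_mul, h0]
        ring
    _ ≤ Real.exp (s ^ 2 * c ^ 2 / 2) := by
        have := Real.cosh_le_exp_half_sq (s * c)
        rwa [mul_pow] at this

/-- McDiarmid's martingale argument, exposing the first coordinate: its conditional mean obeys
Hoeffding's lemma, and the remaining coordinates are handled by induction. -/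
theorem expect_exp_sub_expect_le {X : Type} [Fintype X] [Nonempty X] (c : ℝ) (hc : 0 < c) (s : ℝ)
    (n : ℕ) (F : (Fin n → X) → ℝ)
    (hF : ∀ f i x, |F f - F (Function.update f i x)| ≤ c) :
    𝔼 f, Real.exp (s * (F f - 𝔼 g, F g)) ≤ Real.exp (n * (s ^ 2 * c ^ 2 / 2)) := by
  induction n with
  | zero =>
    have : ∀ f : Fin 0 → X, F f = 𝔼 g, F g := fun f => by
      rw [Fintype.expect_eq_sum_div_card]
      simp [Subsingleton.elim f default]
    have h1 : ∀ f : Fin 0 → X, Real.exp (s * (F f - 𝔼 g, F g)) = 1 := fun f => by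
      rw [this f, sub_self, mul_zero, Real.exp_zero]
    rw [Finset.expect_congr rfl fun f _ => h1 f, Fintype.expect_const]
    simp
  | succ n ih =>
    have hsplit : ∀ H : (Fin (n + 1) → X) → ℝ,
        𝔼 f, H f = 𝔼 x, 𝔼 g : Fin n → X, H (Fin.cons x g) := fun H => by
      rw [← Finset.expect_product' (s := Finset.univ) (t := Finset.univ)
        (f := fun (x : X) (g : Fin n → X) => H (Fin.cons x g)), Finset.univ_product_univ]
      exact (Fintype.expect_equiv (Fin.consEquiv fun _ => X) _ _ fun _ => rfl).symm
    -- The conditional mean given the first coordinate; averaging preserves the bound `c` on its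
    -- oscillation.
    set Fbar : X → ℝ := fun x => 𝔼 g : Fin n → X, F (Fin.cons x g) with hFbar
    have hmean : 𝔼 g, F g = 𝔼 x, Fbar x := hsplit F
    have hdiff : ∀ x x', |Fbar x - Fbar x'| ≤ c := by
      intro x x'
      rw [hFbar]
      simp only
      rw [← Finset.expect_sub_distrib]
      refine (Finset.abs_expect_le _ _).trans ?_
      refine Finset.expect_le Finset.univ_nonempty fun g _ => ?_
      have := hF (Fin.cons x g) 0 x'
      rwa [Fin.update_cons_zero] at this
    have hY : ∀ x, |Fbar x - 𝔼 x, Fbar x| ≤ c := by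
      intro x
      have : Fbar x - 𝔼 x, Fbar x = 𝔼 x', (Fbar x - Fbar x') := by
        rw [Finset.expect_sub_distrib, Fintype.expect_const]
      rw [this]
      exact (Finset.abs_expect_le _ _).trans
        (Finset.expect_le Finset.univ_nonempty fun x' _ => hdiff x x')
    rw [hsplit, hmean]
    calc 𝔼 x, 𝔼 g : Fin n → X, Real.exp (s * (F (Fin.cons x g) - 𝔼 x, Fbar x))
        = 𝔼 x, Real.exp (s * (Fbar x - 𝔼 x, Fbar x)) *
            𝔼 g : Fin n → X, Real.exp (s * (F (Fin.cons x g) - Fbar x)) := by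
          refine Finset.expect_congr rfl fun x _ => ?_
          rw [Finset.mul_expect]
          refine Finset.expect_congr rfl fun g _ => ?_
          rw [← Real.exp_add]
          congr 1
          ring
      _ ≤ 𝔼 x, Real.exp (s * (Fbar x - 𝔼 x, Fbar x)) * Real.exp (n * (s ^ 2 * c ^ 2 / 2)) := by
          refine Finset.expect_le_expect fun x _ => ?_
          refine mul_le_mul_of_nonneg_left ?_ (Real.exp_pos _).le
          refine ih (fun g => F (Fin.cons x g)) fun g i x' => ?_
          have := hF (Fin.cons x g) i.succ x'
          rwa [← Fin.cons_update] at this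
      _ = (𝔼 x, Real.exp (s * (Fbar x - 𝔼 x, Fbar x))) * Real.exp (n * (s ^ 2 * c ^ 2 / 2)) := by
          rw [Finset.expect_mul]
      _ ≤ Real.exp (s ^ 2 * c ^ 2 / 2) * Real.exp (n * (s ^ 2 * c ^ 2 / 2)) := by
          refine mul_le_mul_of_nonneg_right ?_ (Real.exp_pos _).le
          refine expect_exp_le (fun x => Fbar x - 𝔼 x, Fbar x) c hc hY ?_ s
          rw [Finset.expect_sub_distrib, Fintype.expect_const, sub_self]
      _ = Real.exp ((n + 1 : ℕ) * (s ^ 2 * c ^ 2 / 2)) := by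
          rw [← Real.exp_add]
          congr 1
          push_cast
          ring

/-- The bounded difference inequality. -/
theorem prob_ge_le_of_bounded_differences {V X : Type} [Fintype V] [DecidableEq V] [Fintype X]
    [Nonempty X] (c : ℝ) (hc : 0 < c) (F : (V → X) → ℝ)
    (hF : ∀ f i x, |F f - F (Function.update f i x)| ≤ c) (t : ℝ) (ht : 0 ≤ t) (κ : ℝ)
    (hκ : 0 < κ) (hV : Fintype.card V ≤ κ) :
    prob (fun f => t ≤ F f - 𝔼 g, F g) ≤ Real.exp (-(t ^ 2 / (2 * κ * c ^ 2))) := by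
  classical
  set n := Fintype.card V with hn
  let e : V ≃ Fin n := Fintype.equivFin V
  let E : (Fin n → X) ≃ (V → X) := (e.arrowCongr (Equiv.refl X)).symm
  have hE : ∀ f : Fin n → X, E f = f ∘ e := fun f => rfl
  have hm : 𝔼 g, F g = 𝔼 g, F (E g) := (Fintype.expect_equiv E _ _ fun _ => rfl).symm
  rw [hm, ← prob_equiv E]
  -- The parameter `t / (κ c²)` minimises the Chernoff exponent `s² κ c² / 2 - s t`.
  have hmgf := expect_exp_sub_expect_le c hc (t / (κ * c ^ 2)) n (fun g => F (E g))
    (fun f i x => by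
      have := hF (E f) (e.symm i) x
      have h2 : E (Function.update f i x) = Function.update (E f) (e.symm i) x := by
        rw [hE, hE, Function.update_comp_equiv]
      rwa [h2])
  refine (prob_le_expect_div (fun f => Real.exp (t / (κ * c ^ 2) * (F (E f) - 𝔼 g, F (E g))))
    (fun f => (Real.exp_pos _).le) (Real.exp (t / (κ * c ^ 2) * t)) (Real.exp_pos _) _
    (fun f hf => Real.exp_le_exp.2
      (mul_le_mul_of_nonneg_left hf (by positivity)))).trans ?_
  rw [div_le_iff₀ (Real.exp_pos _)]
  refine hmgf.trans ?_
  rw [← Real.exp_add]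
  refine Real.exp_le_exp.2 ?_
  calc (n : ℝ) * ((t / (κ * c ^ 2)) ^ 2 * c ^ 2 / 2)
      ≤ κ * ((t / (κ * c ^ 2)) ^ 2 * c ^ 2 / 2) :=
        mul_le_mul_of_nonneg_right hV (by positivity)
    _ = -(t ^ 2 / (2 * κ * c ^ 2)) + t / (κ * c ^ 2) * t := by
        field_simp
        ring

theorem prob_le_le_of_bounded_differences {V X : Type} [Fintype V] [DecidableEq V] [Fintype X]
    [Nonempty X] (c : ℝ) (hc : 0 < c) (F : (V → X) → ℝ)
    (hF : ∀ f i x, |F f - F (Function.update f i x)| ≤ c) (t : ℝ) (ht : 0 ≤ t) (κ : ℝ)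
    (hκ : 0 < κ) (hV : Fintype.card V ≤ κ) :
    prob (fun f => F f ≤ 𝔼 g, F g - t) ≤ Real.exp (-(t ^ 2 / (2 * κ * c ^ 2))) := by
  refine (prob_mono fun f hf => ?_).trans (prob_ge_le_of_bounded_differences c hc (fun f => -F f)
    (fun f i x => ?_) t ht κ hκ hV)
  · rw [Finset.expect_neg_distrib]
    linarith
  · rw [← abs_neg]
    convert hF f i x using 2
    ring

/-! ### Items that choose their bins independently -/

section Model
variable {V B : Type} [Fintype V] [DecidableEq V] [Fintype B] [DecidableEq B] {ℓ : ℕ}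

/-- The edges of the items in `A` to the bin `b`. -/
def edgesAt (A : Finset V) (f : V → Fin ℓ → B) (b : B) : Finset (V × Fin ℓ) :=
  (A ×ˢ Finset.univ).filter fun q => f q.1 q.2 = b

/-- The number of edges of the items in `A` to the bin `b`. -/
def occ (A : Finset V) (f : V → Fin ℓ → B) (b : B) : ℕ := (edgesAt A f b).card

/-- The item `u` is the only item of one of its bins. -/
def Isolated (A : Finset V) (f : V → Fin ℓ → B) (u : V) : Prop := ∃ e, occ A f (f u e) = 1

/-- The item `v` is isolated, or shares a bin with one other item, which is isolated. -/
def Resolved (A : Finset V) (f : V → Fin ℓ → B) (v : V) : Prop :=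
  ∃ e, occ A f (f v e) = 1 ∨
    (occ A f (f v e) = 2 ∧ ∃ u ∈ A, u ≠ v ∧ (∃ e', f u e' = f v e) ∧ Isolated A f u)

open Classical in
/-- The items that are not resolved. -/
noncomputable def unresolved (A : Finset V) (f : V → Fin ℓ → B) : Finset V :=
  A.filter fun v => ¬ Resolved A f v

/-- A further item in the bin `b` would be resolved: the bin is empty, or contains one item, which
is the only item of another bin. -/
def Useful (A : Finset V) (f : V → Fin ℓ → B) (b : B) : Prop :=
  occ A f b = 0 ∨
    (occ A f b = 1 ∧ ∃ u ∈ A, ∃ e, f u e = b ∧ ∃ e', e' ≠ e ∧ occ A f (f u e') = 1)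

open Classical in
/-- The useful bins. -/
noncomputable def usefulBins (A : Finset V) (f : V → Fin ℓ → B) : Finset B :=
  Finset.univ.filter fun b => Useful A f b

/-- The empty bins. -/
def emptyBins (A : Finset V) (f : V → Fin ℓ → B) : Finset B :=
  Finset.univ.filter fun b => occ A f b = 0

omit [Fintype V] [DecidableEq V] [Fintype B] in
theorem mem_unresolved {A : Finset V} {f : V → Fin ℓ → B} {v : V} :
    v ∈ unresolved A f ↔ v ∈ A ∧ ¬ Resolved A f v := by
  simp [unresolved]

omit [Fintype V] [DecidableEq V] in
theorem mem_usefulBins {A : Finset V} {f : V → Fin ℓ → B} {b : B} :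
    b ∈ usefulBins A f ↔ Useful A f b := by
  simp [usefulBins]

omit [Fintype V] [DecidableEq V] [Fintype B] in
theorem mem_edgesAt {A : Finset V} {f : V → Fin ℓ → B} {b : B} {q : V × Fin ℓ} :
    q ∈ edgesAt A f b ↔ q.1 ∈ A ∧ f q.1 q.2 = b := by
  simp [edgesAt]

omit [Fintype V] [DecidableEq V] [Fintype B] in
theorem one_le_occ {A : Finset V} (f : V → Fin ℓ → B) {v : V} (hv : v ∈ A) (e : Fin ℓ) :
    1 ≤ occ A f (f v e) :=
  Finset.card_pos.2 ⟨(v, e), mem_edgesAt.2 ⟨hv, rfl⟩⟩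

omit [Fintype V] [DecidableEq V] [Fintype B] in
theorem occ_eq_zero_iff {A : Finset V} {f : V → Fin ℓ → B} {b : B} :
    occ A f b = 0 ↔ ∀ v ∈ A, ∀ e, f v e ≠ b := by
  rw [occ, Finset.card_eq_zero, Finset.eq_empty_iff_forall_notMem]
  simp only [mem_edgesAt, not_and, Prod.forall]
  exact ⟨fun h v hv e => h v e hv, fun h v e hv => h v hv e⟩

omit [Fintype V] [DecidableEq V] [Fintype B] in
theorem occ_congr {A : Finset V} {f g : V → Fin ℓ → B} (h : ∀ v ∈ A, f v = g v) :
    occ A f = occ A g := by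
  funext b
  unfold occ
  congr 1
  ext q
  rw [mem_edgesAt, mem_edgesAt]
  exact and_congr_right fun hq => by rw [h _ hq]

omit [Fintype V] [Fintype B] in
theorem occ_insert {A : Finset V} (f : V → Fin ℓ → B) {w : V} (hw : w ∉ A) (b : B) :
    occ (insert w A) f b = occ A f b + (Finset.univ.filter fun e => f w e = b).card := by
  have h : edgesAt (insert w A) f b = edgesAt A f b ∪
      (Finset.univ.filter fun e => f w e = b).image (Prod.mk w) := by
    ext ⟨v, e⟩
    simp only [mem_edgesAt, Finset.mem_insert, Finset.mem_union, Finset.mem_image,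
      Finset.mem_filter, Finset.mem_univ, true_and, Prod.mk.injEq]
    constructor
    · rintro ⟨rfl | h, he⟩
      · exact Or.inr ⟨e, he, rfl, rfl⟩
      · exact Or.inl ⟨h, he⟩
    · rintro (⟨h, he⟩ | ⟨e', he', rfl, rfl⟩)
      · exact ⟨Or.inr h, he⟩
      · exact ⟨Or.inl rfl, he'⟩
  rw [occ, h, Finset.card_union_of_disjoint, Finset.card_image_of_injective _
    (Prod.mk_right_injective w), occ]
  rw [Finset.disjoint_left]
  rintro ⟨v, e⟩ h1 h2
  obtain ⟨e', -, h3⟩ := Finset.mem_image.1 h2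
  obtain rfl := congrArg Prod.fst h3
  exact hw (mem_edgesAt.1 h1).1

omit [Fintype V] [Fintype B] in
theorem occ_insert_of_forall_ne {A : Finset V} (f : V → Fin ℓ → B) {w : V} (hw : w ∉ A) {b : B}
    (hb : ∀ e, f w e ≠ b) : occ (insert w A) f b = occ A f b := by
  rw [occ_insert f hw, Finset.filter_false_of_mem fun e _ => hb e]
  rfl

omit [Fintype V] [Fintype B] in
theorem occ_le_occ_insert {A : Finset V} (f : V → Fin ℓ → B) {w : V} (hw : w ∉ A) (b : B) :
    occ A f b ≤ occ (insert w A) f b := by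
  rw [occ_insert f hw]; exact Nat.le_add_right _ _

omit [Fintype V] [Fintype B] in
theorem occ_insert_of_injective {A : Finset V} (f : V → Fin ℓ → B) {w : V} (hw : w ∉ A)
    (hinj : Function.Injective (f w)) (e : Fin ℓ) :
    occ (insert w A) f (f w e) = occ A f (f w e) + 1 := by
  rw [occ_insert f hw]
  have : (Finset.univ.filter fun e' => f w e' = f w e) = {e} := by
    ext e'
    simp [hinj.eq_iff]
  rw [this, Finset.card_singleton]

omit [Fintype V] [DecidableEq V] [Fintype B] in
theorem isolated_congr {A : Finset V} {f g : V → Fin ℓ → B} (h : ∀ v ∈ A, f v = g v) {v : V}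
    (hv : v ∈ A) : Isolated A f v ↔ Isolated A g v := by
  unfold Isolated
  rw [occ_congr h, h v hv]

omit [Fintype V] [DecidableEq V] [Fintype B] in
theorem unresolved_congr {A : Finset V} {f g : V → Fin ℓ → B} (h : ∀ v ∈ A, f v = g v) :
    unresolved A f = unresolved A g := by
  ext v
  rw [mem_unresolved, mem_unresolved]
  refine and_congr_right fun hv => not_congr ?_
  unfold Resolved
  rw [occ_congr h, h v hv]
  refine exists_congr fun e => or_congr_right (and_congr_right fun _ => exists_congr fun u =>
    and_congr_right fun hu => ?_)
  rw [isolated_congr h hu, h u hu]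

omit [Fintype V] [DecidableEq V] in
theorem usefulBins_congr {A : Finset V} {f g : V → Fin ℓ → B} (h : ∀ v ∈ A, f v = g v) :
    usefulBins A f = usefulBins A g := by
  ext b
  rw [mem_usefulBins, mem_usefulBins]
  unfold Useful
  rw [occ_congr h]
  refine or_congr_right (and_congr_right fun _ => exists_congr fun u =>
    and_congr_right fun hu => ?_)
  rw [h u hu]

omit [Fintype V] [DecidableEq V] in
theorem emptyBins_congr {A : Finset V} {f g : V → Fin ℓ → B} (h : ∀ v ∈ A, f v = g v) :
    emptyBins A f = emptyBins A g := by
  unfold emptyBins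
  rw [occ_congr h]

/-! ### Changing the bins of one item -/

/-- The items of the bin `b`, if the bin has at most two edges. -/
def lightItems (A : Finset V) (f : V → Fin ℓ → B) (b : B) : Finset V :=
  if occ A f b ≤ 2 then (edgesAt A f b).image Prod.fst else ∅

omit [Fintype V] [Fintype B] in
theorem card_lightItems_le (A : Finset V) (f : V → Fin ℓ → B) (b : B) :
    (lightItems A f b).card ≤ 2 := by
  unfold lightItems
  split
  · next h => exact Finset.card_image_le.trans h
  · simp

omit [Fintype V] [Fintype B] in
theorem mem_lightItems {A : Finset V} {f : V → Fin ℓ → B} {b : B} {v : V} {e : Fin ℓ}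
    (hv : v ∈ A) (hb : f v e = b) (h : occ A f b ≤ 2) : v ∈ lightItems A f b := by
  rw [lightItems, if_pos h]
  exact Finset.mem_image.2 ⟨(v, e), mem_edgesAt.2 ⟨hv, hb⟩, rfl⟩

/-- The items that share a light bin with one of the bins `x`. -/
def lightNeighbors (A : Finset V) (f : V → Fin ℓ → B) (x : Fin ℓ → B) : Finset V :=
  Finset.univ.biUnion fun e => lightItems A f (x e)

omit [Fintype V] [Fintype B] in
theorem card_lightNeighbors_le (A : Finset V) (f : V → Fin ℓ → B) (x : Fin ℓ → B) :
    (lightNeighbors A f x).card ≤ ℓ * 2 := by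
  refine (Finset.card_biUnion_le_card_mul _ _ 2 fun e _ => card_lightItems_le A f _).trans ?_
  simp

/-- The items that share a light bin with an item in `lightNeighbors`. -/
def secondNeighbors (A : Finset V) (f : V → Fin ℓ → B) (x : Fin ℓ → B) : Finset V :=
  (lightNeighbors A f x).biUnion fun u => lightNeighbors A f (f u)

omit [Fintype V] [Fintype B] in
theorem card_secondNeighbors_le (A : Finset V) (f : V → Fin ℓ → B) (x : Fin ℓ → B) :
    (secondNeighbors A f x).card ≤ ℓ * 2 * (ℓ * 2) :=
  (Finset.card_biUnion_le_card_mul _ _ (ℓ * 2) fun _ _ => card_lightNeighbors_le A f _).trans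
    (Nat.mul_le_mul_right _ (card_lightNeighbors_le A f x))

omit [Fintype V] [Fintype B] in
-- Being resolved depends only on bins with at most two edges, and occupancies only grow. So `w` can
-- matter to `v` only by hitting a light bin of `v`, or a bin that isolates the partner of `v`.
-- Restricting to light bins keeps the number of affected items bounded in terms of `ℓ`, even if `w`
-- joins crowded bins.
theorem resolved_insert_iff {A : Finset V} (f : V → Fin ℓ → B) {w v : V} (hw : w ∉ A)
    (hv : v ∈ A) (h1 : v ∉ lightNeighbors A f (f w)) (h2 : v ∉ secondNeighbors A f (f w)) :
    Resolved (insert w A) f v ↔ Resolved A f v := by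
  have hmiss : ∀ e, occ A f (f v e) ≤ 2 → ∀ e₀, f w e₀ ≠ f v e := fun e he e₀ h =>
    h1 (Finset.mem_biUnion.2 ⟨e₀, Finset.mem_univ _, mem_lightItems hv h.symm (h ▸ he)⟩)
  have hocc : ∀ e, occ A f (f v e) ≤ 2 → occ (insert w A) f (f v e) = occ A f (f v e) :=
    fun e he => occ_insert_of_forall_ne f hw (hmiss e he)
  have hle := fun b => occ_le_occ_insert f hw b
  constructor
  · rintro ⟨e, h | ⟨h, u, hu, huv, ⟨e', he'⟩, e'', hiso⟩⟩
    · have := hle (f v e)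
      rw [hocc e (by omega)] at h
      exact ⟨e, Or.inl h⟩
    · have := hle (f v e)
      have hm := hmiss e (by omega)
      rw [hocc e (by omega)] at h
      have huA : u ∈ A := by
        rcases Finset.mem_insert.1 hu with rfl | hu
        · exact absurd he' (hm e')
        · exact hu
      have h3 := hle (f u e'')
      have h4 := one_le_occ f huA e''
      exact ⟨e, Or.inr ⟨h, u, huA, huv, ⟨e', he'⟩, e'', by omega⟩⟩
  · rintro ⟨e, h | ⟨h, u, hu, huv, ⟨e', he'⟩, e'', hiso⟩⟩
    · exact ⟨e, Or.inl ((hocc e (by omega)).trans h)⟩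
    · refine ⟨e, Or.inr ⟨(hocc e (by omega)).trans h, u, Finset.mem_insert_of_mem hu, huv,
        ⟨e', he'⟩, e'', ?_⟩⟩
      rw [occ_insert_of_forall_ne f hw, hiso]
      intro e₀ h0
      refine h2 (Finset.mem_biUnion.2 ⟨u, Finset.mem_biUnion.2 ⟨e₀, Finset.mem_univ _,
        mem_lightItems hu h0.symm (by rw [h0]; omega)⟩, Finset.mem_biUnion.2
        ⟨e', Finset.mem_univ _, mem_lightItems hv he'.symm (by rw [he']; omega)⟩⟩)

omit [Fintype V] [Fintype B] in
-- The usefulness of a bin can change only if `w` hits the bin itself, or hits a bin that isolates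
-- its single occupant.
theorem useful_insert_iff {A : Finset V} (f : V → Fin ℓ → B) {w : V} {b : B} (hw : w ∉ A)
    (h1 : ∀ e, f w e ≠ b) (h2 : ∀ u ∈ lightNeighbors A f (f w), ∀ e, f u e ≠ b) :
    Useful (insert w A) f b ↔ Useful A f b := by
  have hle := fun b => occ_le_occ_insert f hw b
  unfold Useful
  rw [occ_insert_of_forall_ne f hw h1]
  refine or_congr_right (and_congr_right fun hb => ⟨?_, ?_⟩)
  · rintro ⟨u, hu, e, he, e', hne, h⟩
    have huA : u ∈ A := by
      rcases Finset.mem_insert.1 hu with rfl | hu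
      · exact absurd he (h1 e)
      · exact hu
    have h3 := hle (f u e')
    have h4 := one_le_occ f huA e'
    exact ⟨u, huA, e, he, e', hne, by omega⟩
  · rintro ⟨u, hu, e, he, e', hne, h⟩
    refine ⟨u, Finset.mem_insert_of_mem hu, e, he, e', hne, ?_⟩
    rw [occ_insert_of_forall_ne f hw, h]
    intro e₀ h0
    exact h2 u (Finset.mem_biUnion.2 ⟨e₀, Finset.mem_univ _,
      mem_lightItems hu h0.symm (by rw [h0]; omega)⟩) e he

/-- A bound for the effect of inserting one item. -/
def lip (ℓ : ℕ) : ℕ := 1 + 2 * ℓ + 4 * ℓ ^ 2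

theorem abs_card_sub_card_le {α : Type} [DecidableEq α] {s t u : Finset α} {c : ℕ}
    (hst : s ⊆ t ∪ u) (hts : t ⊆ s ∪ u) (hu : u.card ≤ c) :
    |(s.card : ℝ) - t.card| ≤ c := by
  have h1 := (Finset.card_le_card hst).trans (Finset.card_union_le _ _)
  have h2 := (Finset.card_le_card hts).trans (Finset.card_union_le _ _)
  have h1' : (s.card : ℝ) ≤ t.card + c := by exact_mod_cast h1.trans (by omega)
  have h2' : (t.card : ℝ) ≤ s.card + c := by exact_mod_cast h2.trans (by omega)
  rw [abs_le]
  constructor <;> linarith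

omit [Fintype V] [Fintype B] in
theorem abs_card_unresolved_insert_sub_le {A : Finset V} (f : V → Fin ℓ → B) {w : V}
    (hw : w ∉ A) :
    |((unresolved (insert w A) f).card : ℝ) - (unresolved A f).card| ≤ lip ℓ := by
  refine abs_card_sub_card_le
    (u := {w} ∪ (lightNeighbors A f (f w) ∪ secondNeighbors A f (f w))) (fun v hv => ?_)
    (fun v hv => ?_) ?_
  · by_contra hc
    simp only [Finset.mem_union, Finset.mem_singleton, not_or] at hc
    obtain ⟨h1, h2⟩ := mem_unresolved.1 hv
    have hvA := Finset.mem_of_mem_insert_of_ne h1 hc.2.1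
    exact hc.1 (mem_unresolved.2 ⟨hvA, fun h =>
      h2 ((resolved_insert_iff f hw hvA hc.2.2.1 hc.2.2.2).2 h)⟩)
  · by_contra hc
    simp only [Finset.mem_union, Finset.mem_singleton, not_or] at hc
    obtain ⟨hvA, h2⟩ := mem_unresolved.1 hv
    exact hc.1 (mem_unresolved.2 ⟨Finset.mem_insert_of_mem hvA, fun h =>
      h2 ((resolved_insert_iff f hw hvA hc.2.2.1 hc.2.2.2).1 h)⟩)
  · have h1 := card_lightNeighbors_le A f (f w)
    have h2 := card_secondNeighbors_le A f (f w)
    refine (Finset.card_union_le _ _).trans ?_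
    have h3 := Finset.card_union_le (lightNeighbors A f (f w)) (secondNeighbors A f (f w))
    rw [Finset.card_singleton, lip]
    nlinarith

omit [Fintype V] in
theorem abs_card_usefulBins_insert_sub_le {A : Finset V} (f : V → Fin ℓ → B) {w : V}
    (hw : w ∉ A) :
    |((usefulBins (insert w A) f).card : ℝ) - (usefulBins A f).card| ≤ lip ℓ := by
  have key : ∀ b ∉ Finset.univ.image (f w) ∪
      (lightNeighbors A f (f w)).biUnion (fun u => Finset.univ.image (f u)),
      (Useful (insert w A) f b ↔ Useful A f b) := fun b hb => by
    simp only [Finset.mem_union, Finset.mem_image, Finset.mem_univ, true_and, Finset.mem_biUnion,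
      not_or, not_exists, not_and] at hb
    exact useful_insert_iff f hw hb.1 hb.2
  refine abs_card_sub_card_le (u := Finset.univ.image (f w) ∪
      (lightNeighbors A f (f w)).biUnion (fun u => Finset.univ.image (f u))) (fun b hb => ?_)
    (fun b hb => ?_) ?_
  · by_contra hc
    rw [Finset.mem_union, not_or] at hc
    exact hc.1 (mem_usefulBins.2 ((key b hc.2).1 (mem_usefulBins.1 hb)))
  · by_contra hc
    rw [Finset.mem_union, not_or] at hc
    exact hc.1 (mem_usefulBins.2 ((key b hc.2).2 (mem_usefulBins.1 hb)))
  · have him : ∀ u, (Finset.univ.image (f u)).card ≤ ℓ := fun u =>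
      Finset.card_image_le.trans (by simp)
    have h1 := card_lightNeighbors_le A f (f w)
    have h2 := Finset.card_biUnion_le_card_mul (lightNeighbors A f (f w))
      (fun u => Finset.univ.image (f u)) ℓ fun u _ => him u
    have h3 := him w
    refine (Finset.card_union_le _ _).trans ?_
    rw [lip]
    nlinarith

omit [Fintype V] in
theorem abs_card_emptyBins_insert_sub_le {A : Finset V} (f : V → Fin ℓ → B) {w : V}
    (hw : w ∉ A) :
    |((emptyBins (insert w A) f).card : ℝ) - (emptyBins A f).card| ≤ lip ℓ := by
  have key : ∀ b ∉ Finset.univ.image (f w), occ (insert w A) f b = occ A f b := fun b hb => by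
    simp only [Finset.mem_image, Finset.mem_univ, true_and, not_exists] at hb
    exact occ_insert_of_forall_ne f hw hb
  refine abs_card_sub_card_le (u := Finset.univ.image (f w)) (fun b hb => ?_)
    (fun b hb => ?_) ?_
  · by_contra hc
    rw [Finset.mem_union, not_or] at hc
    exact hc.1 (Finset.mem_filter.2 ⟨Finset.mem_univ _,
      (key b hc.2).symm.trans (Finset.mem_filter.1 hb).2⟩)
  · by_contra hc
    rw [Finset.mem_union, not_or] at hc
    exact hc.1 (Finset.mem_filter.2 ⟨Finset.mem_univ _,
      (key b hc.2).trans (Finset.mem_filter.1 hb).2⟩)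
  · refine Finset.card_image_le.trans ?_
    rw [lip, Finset.card_univ, Fintype.card_fin]
    nlinarith

omit [Fintype V] [Fintype B] [DecidableEq B] in
/-- A function of a configuration that depends on the items in `A`, and changes by at most `c` when
an item is inserted, changes by at most `2 * c` when the bins of one item are changed. -/
theorem abs_sub_update_le (Φ : Finset V → (V → Fin ℓ → B) → ℝ) (c : ℝ) (hc : 0 ≤ c)
    (hcongr : ∀ A f g, (∀ v ∈ A, f v = g v) → Φ A f = Φ A g)
    (hins : ∀ A f, ∀ w ∉ A, |Φ (insert w A) f - Φ A f| ≤ c)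
    (A : Finset V) (f : V → Fin ℓ → B) (w : V) (x : Fin ℓ → B) :
    |Φ A f - Φ A (Function.update f w x)| ≤ 2 * c := by
  have hagree : ∀ A : Finset V, w ∉ A → Φ A f = Φ A (Function.update f w x) := fun A hA =>
    hcongr A _ _ fun v hv => by
      rw [Function.update_of_ne]
      rintro rfl
      exact hA hv
  by_cases hw : w ∈ A
  -- Delete `w`, change its bins and insert it again: each of the two configurations is within `c`
  -- of the common one without `w`.
  · have h0 := hagree _ (Finset.notMem_erase w A)
    have h1 := hins (A.erase w) f w (Finset.notMem_erase w A)
    have h2 := hins (A.erase w) (Function.update f w x) w (Finset.notMem_erase w A)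
    rw [Finset.insert_erase hw] at h1 h2
    rw [abs_le] at *
    constructor <;> linarith [h1.1, h1.2, h2.1, h2.2]
  · rw [hagree A hw, sub_self, abs_zero]
    linarith

end Model
/-! ### Resampling one coordinate -/

section Resample

/-- Exchanging coordinate `v` with a fresh independent value is an involution of the product space.
It is used to expose one item after all the others. -/
theorem expect_update {V X : Type} [Fintype V] [DecidableEq V] [Fintype X] [Nonempty X] (v : V)
    (H : (V → X) → ℝ) : 𝔼 f, H f = 𝔼 f, 𝔼 x, H (Function.update f v x) := by
  have h1 : 𝔼 f, H f = 𝔼 p : (V → X) × X, H p.1 := by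
    rw [← Finset.univ_product_univ, Finset.expect_product]
    exact Finset.expect_congr rfl fun f _ => (Fintype.expect_const (ι := X) (H f)).symm
  have h2 : 𝔼 f, 𝔼 x, H (Function.update f v x) =
      𝔼 p : (V → X) × X, H (Function.update p.1 v p.2) := by
    rw [← Finset.univ_product_univ, Finset.expect_product]
  rw [h1, h2]
  let e : (V → X) × X ≃ (V → X) × X :=
    { toFun := fun p => (Function.update p.1 v p.2, p.1 v)
      invFun := fun p => (Function.update p.1 v p.2, p.1 v)
      left_inv := fun p => by simp
      right_inv := fun p => by simp }
  exact (Fintype.expect_equiv e _ _ fun p => rfl).symm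

theorem prob_update {V X : Type} [Fintype V] [DecidableEq V] [Fintype X] [Nonempty X] (v : V)
    (E : (V → X) → Prop) : prob E = 𝔼 f, prob fun x => E (Function.update f v x) := by
  classical
  simp only [prob_eq_expect]
  exact expect_update v _

variable {B : Type} [Fintype B] [DecidableEq B] {ℓ : ℕ}

omit [DecidableEq B] in
theorem prob_mem (T : Finset B) : prob (fun b => b ∈ T) = T.card / Fintype.card B := by
  rw [prob, Nat.card_eq_fintype_card, Nat.card_eq_fintype_card, Fintype.card_coe]

omit [DecidableEq B] in
theorem prob_forall_mem {ι : Type} [Fintype ι] [DecidableEq ι] (T : ι → Finset B) :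
    prob (fun x : ι → B => ∀ e, x e ∈ T e) = ∏ e, ((T e).card : ℝ) / Fintype.card B := by
  classical
  have h : Nat.card {x : ι → B // ∀ e, x e ∈ T e} = ∏ e, (T e).card := by
    rw [← Fintype.card_piFinset, Nat.card_eq_fintype_card, Fintype.card_subtype]
    congr 1
    ext x
    simp
  rw [prob, h, Nat.card_eq_fintype_card, Finset.prod_div_distrib]
  simp

theorem prob_forall_notMem [Nonempty B] (T : Finset B) :
    prob (fun x : Fin ℓ → B => ∀ e, x e ∉ T) = (1 - (T.card : ℝ) / Fintype.card B) ^ ℓ := by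
  have h := prob_forall_mem (fun _ : Fin ℓ => Tᶜ)
  simp only [Finset.mem_compl] at h
  rw [h, Finset.prod_const, Finset.card_univ, Fintype.card_fin, Finset.card_compl,
    Nat.cast_sub (Finset.card_le_univ T), sub_div, div_self]
  exact_mod_cast Fintype.card_ne_zero

omit [DecidableEq B] in
/-- A coordinate is unlikely to be in a small set that depends on the other coordinates. -/
theorem prob_mem_le [Nonempty B] (T : (Fin ℓ → B) → Finset B) (e : Fin ℓ) (k : ℕ)
    (hT : ∀ x b, T (Function.update x e b) = T x) (hk : ∀ x, (T x).card ≤ k) :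
    prob (fun x => x e ∈ T x) ≤ k / Fintype.card B := by
  rw [prob_update e]
  refine Finset.expect_le Finset.univ_nonempty fun x _ => ?_
  simp only [hT, Function.update_self]
  rw [prob_mem]
  gcongr
  exact hk x

/-- The rate at which an edge hits a set of density `q` together with another edge of its item. -/
noncomputable def pairRate (ℓ : ℕ) (q : ℝ) : ℝ := q * (1 - (1 - q) ^ (ℓ - 1))

theorem pairRate_nonneg (ℓ : ℕ) {q : ℝ} (h0 : 0 ≤ q) (h1 : q ≤ 1) : 0 ≤ pairRate ℓ q :=
  mul_nonneg h0 (sub_nonneg.2 (pow_le_one₀ (by linarith) (by linarith)))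

theorem pairRate_mono (ℓ : ℕ) {q q' : ℝ} (h0 : 0 ≤ q) (h : q ≤ q') (h1 : q' ≤ 1) :
    pairRate ℓ q ≤ pairRate ℓ q' := by
  have h2 : (1 - q') ^ (ℓ - 1) ≤ (1 - q) ^ (ℓ - 1) :=
    pow_le_pow_left₀ (by linarith) (by linarith) _
  have h3 : (1 - q) ^ (ℓ - 1) ≤ 1 := pow_le_one₀ (by linarith) (by linarith)
  exact mul_le_mul h (by linarith) (by linarith) (h0.trans h)

/-- Edge `e` hits `T` with probability `q`, and is the only one to do so with probability `q * (1 -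
q) ^ (ℓ - 1)`; the difference is `pairRate`. -/
theorem pairRate_le_prob [Nonempty B] (T : Finset B) (e : Fin ℓ) :
    pairRate ℓ (T.card / Fintype.card B) ≤
      prob (fun x : Fin ℓ → B => x e ∈ T ∧ ∃ e', e' ≠ e ∧ x e' ∈ T) := by
  set q : ℝ := T.card / Fintype.card B with hq
  have hB : (Fintype.card B : ℝ) ≠ 0 := by exact_mod_cast Fintype.card_ne_zero
  have hprod : ∀ c : ℝ, ∏ e' : Fin ℓ, (if e' = e then q else c) = q * c ^ (ℓ - 1) := fun c => by
    rw [Fintype.prod_eq_mul_prod_compl e, if_pos rfl, Finset.prod_congr rfl fun e' he' =>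
      if_neg (by simpa using he'), Finset.prod_const, Finset.card_compl]
    simp
  have h1 : prob (fun x : Fin ℓ → B => x e ∈ T) = q := by
    have h := prob_forall_mem (fun e' : Fin ℓ => if e' = e then T else Finset.univ)
    have hs : ∀ x : Fin ℓ → B, (∀ e', x e' ∈ if e' = e then T else Finset.univ) ↔ x e ∈ T :=
      fun x => ⟨fun h => by simpa using h e, fun h e' => by
        split_ifs with he
        · rwa [he]
        · exact Finset.mem_univ _⟩
    simp only [hs] at h
    rw [h, Finset.prod_congr rfl fun e' _ => show ((if e' = e then T else Finset.univ).card : ℝ) /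
      Fintype.card B = if e' = e then q else 1 by
        split_ifs
        · rfl
        · rw [Finset.card_univ, div_self hB], hprod, one_pow, mul_one]
  have h2 : prob (fun x : Fin ℓ → B => x e ∈ T ∧ ∀ e', e' ≠ e → x e' ∉ T) =
      q * (1 - q) ^ (ℓ - 1) := by
    have h := prob_forall_mem (fun e' : Fin ℓ => if e' = e then T else Tᶜ)
    have hs : ∀ x : Fin ℓ → B, (∀ e', x e' ∈ if e' = e then T else Tᶜ) ↔
        (x e ∈ T ∧ ∀ e', e' ≠ e → x e' ∉ T) :=
      fun x => ⟨fun h => ⟨by simpa using h e, fun e' he => by simpa [he] using h e'⟩,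
        fun h e' => by
        split_ifs with he
        · rw [he]; exact h.1
        · exact Finset.mem_compl.2 (h.2 e' he)⟩
    simp only [hs] at h
    rw [h, Finset.prod_congr rfl fun e' _ => show ((if e' = e then T else Tᶜ).card : ℝ) /
      Fintype.card B = if e' = e then q else 1 - q by
        split_ifs
        · rfl
        · rw [Finset.card_compl, Nat.cast_sub (Finset.card_le_univ T), sub_div, div_self hB],
      hprod]
  have h3 : prob (fun x : Fin ℓ → B => x e ∈ T) ≤
      prob (fun x : Fin ℓ → B => x e ∈ T ∧ ∃ e', e' ≠ e ∧ x e' ∈ T) +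
        prob (fun x : Fin ℓ → B => x e ∈ T ∧ ∀ e', e' ≠ e → x e' ∉ T) := by
    refine (prob_mono fun x hx => ?_).trans (prob_or_le _ _)
    by_cases h : ∃ e', e' ≠ e ∧ x e' ∈ T
    · exact Or.inl ⟨hx, h⟩
    · push Not at h
      exact Or.inr ⟨hx, h⟩
  rw [h1, h2] at h3
  unfold pairRate
  linarith

end Resample

/-! ### Mean numbers of empty bins, useful bins and unresolved items -/

section Mean
variable {V B : Type} [Fintype V] [DecidableEq V] [Fintype B] [DecidableEq B] {ℓ : ℕ}

omit [Fintype V] [Fintype B] [DecidableEq B] in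
theorem update_agree {A : Finset V} (f : V → Fin ℓ → B) {v : V} (hv : v ∉ A) (x : Fin ℓ → B) :
    ∀ u ∈ A, Function.update f v x u = f u := fun u hu =>
  Function.update_of_ne (by rintro rfl; exact hv hu) _ _

theorem prob_occ_eq_zero [Nonempty B] (A : Finset V) (b : B) :
    prob (fun f : V → Fin ℓ → B => occ A f b = 0) =
      (1 - 1 / (Fintype.card B : ℝ)) ^ (ℓ * A.card) := by
  classical
  induction A using Finset.induction_on with
  | empty =>
    have : ∀ f : V → Fin ℓ → B, occ ∅ f b = 0 := fun f => occ_eq_zero_iff.2 (by simp)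
    simp only [this]
    rw [prob_eq_expect]
    simp
  | insert v A hv ih =>
    have hstep : ∀ (f : V → Fin ℓ → B), prob (fun x => occ (insert v A) (Function.update f v x) b = 0)
        = (if occ A f b = 0 then (1 : ℝ) else 0) * (1 - 1 / (Fintype.card B : ℝ)) ^ ℓ := by
      intro f
      have hiff : ∀ x, occ (insert v A) (Function.update f v x) b = 0 ↔
          occ A f b = 0 ∧ ∀ e, x e ∉ ({b} : Finset B) := fun x => by
        rw [← occ_congr (update_agree f hv x), occ_eq_zero_iff, occ_eq_zero_iff]
        simp [and_comm]
      simp only [hiff]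
      split_ifs with h
      · have h2 := prob_forall_notMem (ℓ := ℓ) ({b} : Finset B)
        rw [Finset.card_singleton, Nat.cast_one] at h2
        simpa [h] using h2
      · simp [h, prob]
    rw [prob_update v, Finset.expect_congr rfl fun f _ => hstep f, ← Finset.expect_mul,
      ← prob_eq_expect, ih, Finset.card_insert_of_notMem hv, mul_add, mul_one, pow_add]

theorem expect_card_filter {Ω β : Type} [Fintype Ω] (s : Finset β) (P : Ω → β → Prop)
    [∀ ω, DecidablePred (P ω)] :
    𝔼 ω, ((s.filter (P ω)).card : ℝ) = ∑ b ∈ s, prob fun ω => P ω b := by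
  classical
  simp only [prob_eq_expect]
  rw [← Finset.expect_sum_comm]
  refine Finset.expect_congr rfl fun ω _ => ?_
  rw [Finset.sum_boole]

theorem expect_card_emptyBins [Nonempty B] (A : Finset V) :
    𝔼 f : V → Fin ℓ → B, ((emptyBins A f).card : ℝ) =
      Fintype.card B * (1 - 1 / (Fintype.card B : ℝ)) ^ (ℓ * A.card) := by
  unfold emptyBins
  rw [expect_card_filter Finset.univ (fun (f : V → Fin ℓ → B) b => occ A f b = 0),
    Finset.sum_congr rfl fun b _ => prob_occ_eq_zero A b, Finset.sum_const, Finset.card_univ,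
    nsmul_eq_mul]

/-- Two edges with bins `x` meet, or one of them hits a bin of the occupant of a light bin of the
other. -/
def Clash (A : Finset V) (f : V → Fin ℓ → B) (x : Fin ℓ → B) : Prop :=
  ∃ q ∈ (Finset.univ : Finset (Fin ℓ × Fin ℓ)), q.1 ≠ q.2 ∧
    x q.2 ∈ {x q.1} ∪ (lightItems A f (x q.1)).biUnion fun u => Finset.univ.image (f u)

omit [Fintype V] in
-- For each ordered pair of edges, the second one must land in a set of at most `1 + 2ℓ` bins
-- determined by the first. Clashes are therefore a correction of order `1/M`.
theorem prob_clash_le [Nonempty B] (A : Finset V) (f : V → Fin ℓ → B) :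
    prob (Clash A f) ≤ ℓ ^ 2 * (1 + 2 * ℓ) / Fintype.card B := by
  refine (prob_exists_le _ _).trans ?_
  refine (Finset.sum_le_card_nsmul _ _ ((1 + 2 * ℓ : ℕ) / Fintype.card B : ℝ)
    fun q _ => ?_).trans_eq ?_
  · by_cases hq : q.1 = q.2
    · have : prob (fun x : Fin ℓ → B => q.1 ≠ q.2 ∧ x q.2 ∈ ({x q.1} ∪
          (lightItems A f (x q.1)).biUnion fun u => Finset.univ.image (f u) : Finset B)) = 0 := by
        simp [prob, hq]
      rw [this]
      positivity
    · refine (prob_mono fun x hx => hx.2).trans (prob_mem_le (fun x => {x q.1} ∪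
        (lightItems A f (x q.1)).biUnion fun u => Finset.univ.image (f u)) q.2 (1 + 2 * ℓ)
        (fun x b => by simp only [Function.update_of_ne hq]) fun x => ?_)
      refine (Finset.card_union_le _ _).trans (Nat.add_le_add (by simp) ?_)
      exact (Finset.card_biUnion_le_card_mul _ _ ℓ fun u _ =>
        Finset.card_image_le.trans (by simp)).trans
        (Nat.mul_le_mul_right _ (card_lightItems_le A f _))
  · rw [Finset.card_univ, Fintype.card_prod, Fintype.card_fin, nsmul_eq_mul]
    push_cast
    ring

omit [Fintype V] [Fintype B] in
theorem injective_of_not_clash {A : Finset V} {f : V → Fin ℓ → B} {x : Fin ℓ → B}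
    (h : ¬ Clash A f x) : Function.Injective x := by
  intro e e' hee
  by_contra hne
  exact h ⟨(e, e'), Finset.mem_univ _, hne, by simp [hee]⟩

omit [Fintype V] [Fintype B] in
-- The danger is that `v` itself spoils the useful bin: by a second edge there, or by another edge
-- into the bin that isolates its occupant `u`. Both are clashes.
theorem resolved_of_useful {A : Finset V} {f : V → Fin ℓ → B} {v : V} (hv : v ∉ A)
    (hc : ¬ Clash A f (f v)) {e : Fin ℓ} (hu : Useful A f (f v e)) :
    Resolved (insert v A) f v := by
  have hinj := injective_of_not_clash hc
  refine ⟨e, ?_⟩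
  rw [occ_insert_of_injective f hv hinj]
  rcases hu with h | ⟨h, u, hu, e₁, he₁, e', hne, h1⟩
  · exact Or.inl (by omega)
  · refine Or.inr ⟨by omega, u, Finset.mem_insert_of_mem hu, fun h => hv (h ▸ hu), ⟨e₁, he₁⟩, e',
      ?_⟩
    rw [occ_insert_of_forall_ne f hv, h1]
    intro e₂ h2
    -- If the bin isolating `u` were the shared bin, `u` would have two edges in a bin of occupancy
    -- one; otherwise a different edge of `v` hits a bin of `u`.
    by_cases hee : e₂ = e
    · have h3 : (u, e') = (u, e₁) := by
        refine Finset.card_le_one.1 (le_of_eq h) _ (mem_edgesAt.2 ⟨hu, ?_⟩) _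
          (mem_edgesAt.2 ⟨hu, he₁⟩)
        rw [← h2, hee]
      exact hne (congrArg Prod.snd h3)
    · refine hc ⟨(e, e₂), Finset.mem_univ _, Ne.symm hee, Finset.mem_union_right _
        (Finset.mem_biUnion.2 ⟨u, mem_lightItems hu he₁ (h.trans_le (by norm_num)),
          Finset.mem_image.2 ⟨e', Finset.mem_univ _, h2.symm⟩⟩)⟩

/-- Expose the other items first. An edge of `u` that falls into a bin empty for them is alone
there, unless the edges of `u` clash. The correction terms pay for too few empty bins (`η`) and for
a clash. -/
theorem pairRate_sub_le_prob [Nonempty B] {A : Finset V} {u : V} (hu : u ∈ A) (e : Fin ℓ)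
    (a η : ℝ) (ha0 : 0 ≤ a) (ha1 : a ≤ 1)
    (hη : prob (fun f : V → Fin ℓ → B =>
      ((emptyBins (A.erase u) f).card : ℝ) ≤ a * Fintype.card B) ≤ η) :
    pairRate ℓ a * (1 - η) - ℓ ^ 2 * (1 + 2 * ℓ) / Fintype.card B ≤
      prob (fun f : V → Fin ℓ → B =>
        occ A f (f u e) = 1 ∧ ∃ e', e' ≠ e ∧ occ A f (f u e') = 1) := by
  classical
  set A' := A.erase u with hA'
  have huA : u ∉ A' := Finset.notMem_erase u A
  have hA : insert u A' = A := Finset.insert_erase hu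
  have hB : (0 : ℝ) < Fintype.card B := by exact_mod_cast Fintype.card_pos
  have hstep : ∀ f : V → Fin ℓ → B,
      pairRate ℓ ((emptyBins A' f).card / Fintype.card B) -
        ℓ ^ 2 * (1 + 2 * ℓ) / Fintype.card B ≤
      prob (fun x => occ A (Function.update f u x) (Function.update f u x u e) = 1 ∧
        ∃ e', e' ≠ e ∧ occ A (Function.update f u x) (Function.update f u x u e') = 1) := by
    intro f
    have h1 := pairRate_le_prob (emptyBins A' f) e
    have h2 := prob_clash_le A' f
    have h3 : prob (fun x : Fin ℓ → B => x e ∈ emptyBins A' f ∧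
        ∃ e', e' ≠ e ∧ x e' ∈ emptyBins A' f) ≤ prob (fun x =>
          occ A (Function.update f u x) (Function.update f u x u e) = 1 ∧
          ∃ e', e' ≠ e ∧ occ A (Function.update f u x) (Function.update f u x u e') = 1) +
        prob (Clash A' f) := by
      refine (prob_mono fun x hx => ?_).trans (prob_or_le _ _)
      by_cases hcl : Clash A' f x
      · exact Or.inr hcl
      · left
        have hinj : Function.Injective (Function.update f u x u) := by
          rw [Function.update_self]; exact injective_of_not_clash hcl
        have hocc : ∀ e', x e' ∈ emptyBins A' f →
            occ A (Function.update f u x) (Function.update f u x u e') = 1 := fun e' he' => by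
          rw [← hA, occ_insert_of_injective _ huA hinj, occ_congr (update_agree f huA x),
            Function.update_self, (Finset.mem_filter.1 he').2]
        obtain ⟨h1, e', hne, h2⟩ := hx
        exact ⟨hocc e h1, e', hne, hocc e' h2⟩
    linarith
  have hmean : pairRate ℓ a * (1 - η) ≤
      𝔼 f : V → Fin ℓ → B, pairRate ℓ ((emptyBins A' f).card / Fintype.card B) := by
    have hpt : ∀ f : V → Fin ℓ → B, pairRate ℓ a *
        (1 - if ((emptyBins A' f).card : ℝ) ≤ a * Fintype.card B then (1 : ℝ) else 0) ≤
        pairRate ℓ ((emptyBins A' f).card / Fintype.card B) := by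
      intro f
      have hq1 : ((emptyBins A' f).card : ℝ) / Fintype.card B ≤ 1 :=
        div_le_one_of_le₀ (by exact_mod_cast Finset.card_le_univ _) hB.le
      split_ifs with h
      · rw [sub_self, mul_zero]
        exact pairRate_nonneg ℓ (by positivity) hq1
      · rw [sub_zero, mul_one]
        refine pairRate_mono ℓ ha0 ?_ hq1
        rw [le_div_iff₀ hB]
        exact (not_le.1 h).le
    refine le_trans ?_ (Finset.expect_le_expect fun f _ => hpt f)
    rw [← Finset.mul_expect, Finset.expect_sub_distrib, Fintype.expect_const, ← prob_eq_expect]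
    exact mul_le_mul_of_nonneg_left (by linarith) (pairRate_nonneg ℓ ha0 ha1)
  rw [prob_update u]
  refine le_trans ?_ (Finset.expect_le_expect fun f _ => hstep f)
  rw [Finset.expect_sub_distrib, Fintype.expect_const]
  linarith

omit [Fintype V] [DecidableEq V] in
-- An edge that is alone in its bin is determined by the bin, so the counted edges correspond to
-- distinct useful bins of occupancy one, disjoint from the empty ones.
theorem card_emptyBins_add_le (A : Finset V) (f : V → Fin ℓ → B)
    [DecidablePred fun q : V × Fin ℓ => occ A f (f q.1 q.2) = 1 ∧
      ∃ e', e' ≠ q.2 ∧ occ A f (f q.1 e') = 1] :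
    (emptyBins A f).card + ((A ×ˢ (Finset.univ : Finset (Fin ℓ))).filter fun q =>
      occ A f (f q.1 q.2) = 1 ∧ ∃ e', e' ≠ q.2 ∧ occ A f (f q.1 e') = 1).card ≤
      (usefulBins A f).card := by
  rw [← Finset.card_image_of_injOn (f := fun q : V × Fin ℓ => f q.1 q.2),
    ← Finset.card_union_of_disjoint]
  · refine Finset.card_le_card fun b hb => ?_
    rw [mem_usefulBins]
    rcases Finset.mem_union.1 hb with hb | hb
    · exact Or.inl (Finset.mem_filter.1 hb).2
    · obtain ⟨q, hq, rfl⟩ := Finset.mem_image.1 hb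
      obtain ⟨hq1, h1, h2⟩ := Finset.mem_filter.1 hq
      exact Or.inr ⟨h1, q.1, (Finset.mem_product.1 hq1).1, q.2, rfl, h2⟩
  · rw [Finset.disjoint_left]
    intro b hb hb'
    obtain ⟨q, hq, rfl⟩ := Finset.mem_image.1 hb'
    have h1 := (Finset.mem_filter.1 hb).2
    have h2 := (Finset.mem_filter.1 hq).2.1
    omega
  · intro q hq q' hq' hqq
    have h := Finset.mem_filter.1 (Finset.mem_coe.1 hq)
    have h' := Finset.mem_filter.1 (Finset.mem_coe.1 hq')
    exact Finset.card_le_one.1 (le_of_eq h.2.1) _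
      (mem_edgesAt.2 ⟨(Finset.mem_product.1 h.1).1, rfl⟩) _
      (mem_edgesAt.2 ⟨(Finset.mem_product.1 h'.1).1, hqq.symm⟩)

/-- A lower bound for the mean number of useful bins. -/
theorem le_expect_card_usefulBins [Nonempty B] (A : Finset V) (a η : ℝ) (ha0 : 0 ≤ a)
    (ha1 : a ≤ 1)
    (hη : ∀ A : Finset V, prob (fun f : V → Fin ℓ → B =>
      ((emptyBins A f).card : ℝ) ≤ a * Fintype.card B) ≤ η) :
    Fintype.card B * (1 - 1 / (Fintype.card B : ℝ)) ^ (ℓ * A.card) + A.card * ℓ *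
      (pairRate ℓ a * (1 - η) - ℓ ^ 2 * (1 + 2 * ℓ) / Fintype.card B) ≤
      𝔼 f : V → Fin ℓ → B, ((usefulBins A f).card : ℝ) := by
  classical
  have h : 𝔼 f : V → Fin ℓ → B, (((emptyBins A f).card : ℝ) +
      (((A ×ˢ (Finset.univ : Finset (Fin ℓ))).filter fun q =>
        occ A f (f q.1 q.2) = 1 ∧ ∃ e', e' ≠ q.2 ∧ occ A f (f q.1 e') = 1).card : ℝ)) ≤
      𝔼 f : V → Fin ℓ → B, ((usefulBins A f).card : ℝ) :=
    Finset.expect_le_expect fun f _ => by exact_mod_cast card_emptyBins_add_le A f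
  refine le_trans ?_ h
  rw [Finset.expect_add_distrib, expect_card_emptyBins, expect_card_filter
    (A ×ˢ (Finset.univ : Finset (Fin ℓ))) (fun (f : V → Fin ℓ → B) (q : V × Fin ℓ) =>
      occ A f (f q.1 q.2) = 1 ∧ ∃ e', e' ≠ q.2 ∧ occ A f (f q.1 e') = 1)]
  have h2 := Finset.card_nsmul_le_sum (A ×ˢ (Finset.univ : Finset (Fin ℓ)))
    (fun q => prob fun f : V → Fin ℓ → B =>
      occ A f (f q.1 q.2) = 1 ∧ ∃ e', e' ≠ q.2 ∧ occ A f (f q.1 e') = 1)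
    (pairRate ℓ a * (1 - η) - ℓ ^ 2 * (1 + 2 * ℓ) / Fintype.card B)
    (fun q hq => pairRate_sub_le_prob (Finset.mem_product.1 hq).1 q.2 a η ha0 ha1 (hη _))
  rw [Finset.card_product, Finset.card_univ, Fintype.card_fin, nsmul_eq_mul, Nat.cast_mul] at h2
  linarith

/-- An upper bound for the probability that an item is not resolved. -/
theorem prob_not_resolved_le [Nonempty B] {A : Finset V} {v : V} (hv : v ∉ A) (b η : ℝ)
    (hb1 : b ≤ 1)
    (hη : prob (fun f : V → Fin ℓ → B =>
      ((usefulBins A f).card : ℝ) ≤ b * Fintype.card B) ≤ η) :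
    prob (fun f : V → Fin ℓ → B => ¬ Resolved (insert v A) f v) ≤
      (1 - b) ^ ℓ + ℓ ^ 2 * (1 + 2 * ℓ) / Fintype.card B + η := by
  have hB : (0 : ℝ) < Fintype.card B := by exact_mod_cast Fintype.card_pos
  rw [prob_update v]
  refine (expect_le_add_prob _ (fun f : V → Fin ℓ → B =>
      ((usefulBins A f).card : ℝ) ≤ b * Fintype.card B)
    ((1 - b) ^ ℓ + ℓ ^ 2 * (1 + 2 * ℓ) / Fintype.card B) (fun f => prob_le_one _)
    (add_nonneg (pow_nonneg (by linarith) _) (by positivity)) fun f hf => ?_).trans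
    (by linarith)
  have h1 : prob (fun x => ¬ Resolved (insert v A) (Function.update f v x) v) ≤
      prob (fun x : Fin ℓ → B => ∀ e, x e ∉ usefulBins A f) + prob (Clash A f) := by
    refine (prob_mono fun x hx => ?_).trans (prob_or_le _ _)
    by_contra hc
    push Not at hc
    obtain ⟨⟨e, he⟩, hcl⟩ := hc
    refine hx (resolved_of_useful (e := e) hv ?_ ?_)
    · rw [Function.update_self]
      -- A clash involves `f` only through items of `A`, and `v` is not one of them.
      have : Clash A (Function.update f v x) x ↔ Clash A f x := by
        unfold Clash
        refine exists_congr fun q => and_congr_right fun _ => and_congr_right fun _ => ?_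
        have h2 : lightItems A (Function.update f v x) (x q.1) = lightItems A f (x q.1) := by
          have h3 : edgesAt A (Function.update f v x) (x q.1) = edgesAt A f (x q.1) := by
            ext r
            rw [mem_edgesAt, mem_edgesAt]
            exact and_congr_right fun hr => by rw [update_agree f hv x _ hr]
          rw [lightItems, lightItems, occ, occ, h3]
        rw [h2, Finset.mem_union, Finset.mem_union, Finset.mem_biUnion, Finset.mem_biUnion]
        refine or_congr_right (exists_congr fun u => and_congr_right fun hu => ?_)
        have huA : u ∈ A := by
          unfold lightItems at hu
          split at hu
          · obtain ⟨r, hr, rfl⟩ := Finset.mem_image.1 hu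
            exact (mem_edgesAt.1 hr).1
          · simp at hu
        rw [update_agree f hv x u huA]
      rwa [this]
    · rw [← mem_usefulBins, usefulBins_congr (update_agree f hv x), Function.update_self]
      exact he
  rw [prob_forall_notMem] at h1
  have h2 := prob_clash_le A f
  have h3 : (1 - ((usefulBins A f).card : ℝ) / Fintype.card B) ^ ℓ ≤ (1 - b) ^ ℓ := by
    refine pow_le_pow_left₀ (sub_nonneg.2 (div_le_one_of_le₀ ?_ hB.le)) ?_ _
    · exact_mod_cast Finset.card_le_univ _
    · have := (le_div_iff₀ hB).2 (not_le.1 hf).le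
      linarith
  linarith

/-- The number of items that are not resolved exceeds a multiple of its asymptotic mean with
exponentially small probability. -/
theorem prob_card_unresolved_le [Nonempty B] (K M a b δ β ε η : ℝ) (hK0 : 0 < K)
    (hK : Fintype.card V = K) (hM : Fintype.card B = M) (ha0 : 0 ≤ a) (ha1 : a ≤ 1)
    (hb1 : b ≤ 1) (hδ : 0 < δ) (hβ : β ≤ ε)
    (hη : Real.exp (-((δ * M) ^ 2 / (2 * K * (2 * lip ℓ) ^ 2))) ≤ η)
    (ha : a + δ ≤ (1 - 1 / M) ^ (ℓ * Fintype.card V))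
    (hb : b + δ ≤ a + δ + (K - 1) * ℓ / M *
      (pairRate ℓ a * (1 - η) - ℓ ^ 2 * (1 + 2 * ℓ) / M))
    (hbβ : (1 - b) ^ ℓ + ℓ ^ 2 * (1 + 2 * ℓ) / M + η ≤ β) :
    prob (fun f : V → Fin ℓ → B => ε * K < (unresolved Finset.univ f).card) ≤
      Real.exp (-(((ε - β) * K) ^ 2 / (2 * K * (2 * lip ℓ) ^ 2))) := by
  classical
  have hM0 : 0 < M := by rw [← hM]; exact_mod_cast Fintype.card_pos
  have hM1 : 1 ≤ M := by rw [← hM]; exact_mod_cast Fintype.card_pos (α := B)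
  have hlip : (0 : ℝ) < 2 * lip ℓ := by
    have : 0 < lip ℓ := by unfold lip; omega
    positivity
  have hbase0 : 0 ≤ 1 - 1 / M := sub_nonneg.2 ((div_le_one hM0).2 hM1)
  have hbase1 : 1 - 1 / M ≤ 1 := by
    have : 0 ≤ 1 / M := by positivity
    linarith
  -- Here `a` and `b` are lower densities for the empty and the useful bins, `δ` is the slack below
  -- their means, `η` bounds each of the two lower tails, and `β` bounds the resulting mean fraction
  -- of unresolved items. Fewer items leave more empty bins, so the hypothesis for all items covers
  -- every `A`.
  have hpow : ∀ A : Finset V, a + δ ≤ (1 - 1 / M) ^ (ℓ * A.card) := fun A =>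
    ha.trans (pow_le_pow_of_le_one hbase0 hbase1
      (Nat.mul_le_mul_left _ (Finset.card_le_univ A)))
  have hempty : ∀ A : Finset V, prob (fun f : V → Fin ℓ → B =>
      ((emptyBins A f).card : ℝ) ≤ a * Fintype.card B) ≤ η := by
    intro A
    refine le_trans ?_ hη
    refine (prob_mono fun f hf => ?_).trans (prob_le_le_of_bounded_differences (2 * lip ℓ) hlip
      (fun f : V → Fin ℓ → B => ((emptyBins A f).card : ℝ)) (abs_sub_update_le
        (fun A f => ((emptyBins A f).card : ℝ)) (lip ℓ) (by positivity)
        (fun A f g h => by rw [emptyBins_congr h])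
        (fun A f w hw => abs_card_emptyBins_insert_sub_le f hw) A)
      (δ * M) (by positivity) K hK0 hK.le)
    rw [expect_card_emptyBins, hM]
    rw [hM] at hf
    have := mul_le_mul_of_nonneg_left (hpow A) hM0.le
    linarith
  have huseful : ∀ v : V, prob (fun f : V → Fin ℓ → B =>
      ((usefulBins (Finset.univ.erase v) f).card : ℝ) ≤ b * Fintype.card B) ≤ η := by
    intro v
    refine le_trans ?_ hη
    refine (prob_mono fun f hf => ?_).trans (prob_le_le_of_bounded_differences (2 * lip ℓ) hlip
      (fun f : V → Fin ℓ → B => ((usefulBins (Finset.univ.erase v) f).card : ℝ))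
      (abs_sub_update_le
        (fun A f => ((usefulBins A f).card : ℝ)) (lip ℓ) (by positivity)
        (fun A f g h => by rw [usefulBins_congr h])
        (fun A f w hw => abs_card_usefulBins_insert_sub_le f hw) (Finset.univ.erase v))
      (δ * M) (by positivity) K hK0 hK.le)
    have h1 := le_expect_card_usefulBins (Finset.univ.erase v) a η ha0 ha1 hempty
    have h2 : ((Finset.univ.erase v).card : ℝ) = K - 1 := by
      rw [← hK, Finset.card_erase_of_mem (Finset.mem_univ v), Finset.card_univ,
        Nat.cast_sub (Fintype.card_pos_iff.2 ⟨v⟩), Nat.cast_one]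
    rw [hM, h2] at h1
    rw [hM] at hf
    have h3 := mul_le_mul_of_nonneg_left (hpow (Finset.univ.erase v)) hM0.le
    have h4 := mul_le_mul_of_nonneg_left hb hM0.le
    have h5 : M * ((K - 1) * ℓ / M * (pairRate ℓ a * (1 - η) - ℓ ^ 2 * (1 + 2 * ℓ) / M)) =
        (K - 1) * ℓ * (pairRate ℓ a * (1 - η) - ℓ ^ 2 * (1 + 2 * ℓ) / M) := by
      field_simp
    rw [mul_add M (a + δ), h5] at h4
    linarith
  have hmean : 𝔼 f : V → Fin ℓ → B, ((unresolved Finset.univ f).card : ℝ) ≤ β * K := by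
    unfold unresolved
    rw [expect_card_filter Finset.univ (fun (f : V → Fin ℓ → B) v =>
      ¬ Resolved Finset.univ f v)]
    refine (Finset.sum_le_card_nsmul _ _ β fun v _ => ?_).trans_eq ?_
    · have h1 := prob_not_resolved_le (Finset.notMem_erase v Finset.univ) b η hb1 (huseful v)
      rw [Finset.insert_erase (Finset.mem_univ v), hM] at h1
      exact h1.trans hbβ
    · rw [Finset.card_univ, nsmul_eq_mul, hK, mul_comm]
  refine (prob_mono fun f hf => ?_).trans (prob_ge_le_of_bounded_differences (2 * lip ℓ) hlip
      (fun f : V → Fin ℓ → B => ((unresolved Finset.univ f).card : ℝ)) (abs_sub_update_le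
        (fun A f => ((unresolved A f).card : ℝ)) (lip ℓ) (by positivity)
        (fun A f g h => by rw [unresolved_congr h])
        (fun A f w hw => abs_card_unresolved_insert_sub_le f hw) Finset.univ)
      ((ε - β) * K) (mul_nonneg (sub_nonneg.2 hβ) hK0.le) K hK0 hK.le)
  linarith

end Mean
/-! ### Uniformly random bijections -/

section Bijections
variable {α β τ : Type} [Fintype α] [DecidableEq α] [Fintype β] [DecidableEq β] [Fintype τ]
  [DecidableEq τ]

omit [DecidableEq τ] in
-- Relative to one bijection `σ₀` with the prescribed values, all the others are permutations of `α`
-- that fix the range of `ι` pointwise.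
theorem card_equiv_comp_eq_le (ι : τ → α) (hι : Function.Injective ι) (g : τ → β) :
    (Finset.univ.filter fun σ : α ≃ β => (fun t => σ (ι t)) = g).card ≤
      (Fintype.card α - Fintype.card τ).factorial := by
  classical
  rcases Finset.eq_empty_or_nonempty
    (Finset.univ.filter fun σ : α ≃ β => (fun t => σ (ι t)) = g) with h | ⟨σ₀, hσ₀⟩
  · rw [h]; simp
  have hσ₀' := (Finset.mem_filter.1 hσ₀).2
  let p : α → Prop := fun a => a ∉ Set.range ι
  have hcard : Fintype.card {f : Equiv.Perm α // ∀ a, ¬ p a → f a = a} =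
      (Fintype.card α - Fintype.card τ).factorial := by
    rw [← Fintype.card_congr (Equiv.Perm.subtypeEquivSubtypePerm p), Fintype.card_perm,
      Fintype.card_subtype_compl]
    congr 2
    exact Fintype.card_congr (Equiv.ofInjective ι hι).symm
  rw [← hcard, ← Fintype.card_coe]
  refine Fintype.card_le_of_injective (fun σ => ⟨σ.1.trans σ₀.symm, fun a ha => ?_⟩) ?_
  · obtain ⟨t, rfl⟩ := not_not.1 ha
    have h1 := congrFun (Finset.mem_filter.1 σ.2).2 t
    have h2 := congrFun hσ₀' t
    rw [Equiv.trans_apply, Equiv.symm_apply_eq]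
    exact h1.trans h2.symm
  · intro σ σ' h
    apply Subtype.ext
    ext a
    have := congrArg (fun f => f a) (congrArg Subtype.val h)
    simpa using this

/-- The restriction of a random bijection to a few points is almost a random function. -/
theorem prob_equiv_comp_le [Nonempty (α ≃ β)] (ι : τ → α) (hι : Function.Injective ι)
    (P : (τ → β) → Prop) (hk : Fintype.card τ < Fintype.card α) :
    prob (fun σ : α ≃ β => P fun t => σ (ι t)) ≤
      prob P * ((Fintype.card α : ℝ) / (Fintype.card α - Fintype.card τ)) ^ Fintype.card τ := by
  classical
  set n := Fintype.card α with hn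
  set k := Fintype.card τ with hkdef
  have e : α ≃ β := Classical.arbitrary _
  have hβ : Fintype.card β = n := (Fintype.card_congr e).symm
  have hcount : Nat.card {σ : α ≃ β // P fun t => σ (ι t)} ≤
      (n - k).factorial * Nat.card {g : τ → β // P g} := by
    rw [Nat.card_eq_fintype_card, Nat.card_eq_fintype_card, Fintype.card_subtype,
      Fintype.card_subtype]
    refine Finset.card_le_mul_card_image_of_maps_to (f := fun (σ : α ≃ β) t => σ (ι t))
      (fun σ hσ => ?_) _ fun g _ => ?_
    · exact Finset.mem_filter.2 ⟨Finset.mem_univ _, (Finset.mem_filter.1 hσ).2⟩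
    · refine (Finset.card_le_card ?_).trans (card_equiv_comp_eq_le ι hι g)
      exact Finset.filter_subset_filter _ (Finset.filter_subset _ _)
  have hσ : Nat.card (α ≃ β) = n.factorial := by
    rw [Nat.card_eq_fintype_card, Fintype.card_equiv e]
  have hg : Nat.card (τ → β) = n ^ k := by
    rw [Nat.card_eq_fintype_card, Fintype.card_fun, hβ]
  -- A given restriction has probability at most `(n - k)! / n! ≤ (n - k) ^ (-k)`, against `n ^
  -- (-k)` for a random function.
  have hfac : ((n - k).factorial : ℝ) * ((n : ℝ) - k) ^ k ≤ n.factorial := by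
    have := Nat.factorial_mul_pow_sub_le_factorial (n := n - k) (m := n) (by omega)
    rw [show n - (n - k) = k by omega] at this
    rw [← Nat.cast_sub hk.le]
    exact_mod_cast this
  have hn0 : (0 : ℝ) < n := by exact_mod_cast (Nat.zero_le k).trans_lt hk
  have hnk : (0 : ℝ) < (n : ℝ) - k := sub_pos.2 (by exact_mod_cast hk)
  unfold prob
  rw [hσ, hg, div_pow, Nat.cast_pow, div_mul_div_comm, mul_comm ((n : ℝ) ^ k),
    mul_div_mul_right _ _ (by positivity), div_le_div_iff₀ (by positivity) (by positivity)]
  calc (Nat.card {σ : α ≃ β // P fun t => σ (ι t)} : ℝ) * ((n : ℝ) - k) ^ k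
      ≤ ((n - k).factorial * Nat.card {g : τ → β // P g} : ℝ) * ((n : ℝ) - k) ^ k :=
        mul_le_mul_of_nonneg_right (by exact_mod_cast hcount) (by positivity)
    _ = Nat.card {g : τ → β // P g} * ((n - k).factorial * ((n : ℝ) - k) ^ k) := by ring
    _ ≤ Nat.card {g : τ → β // P g} * n.factorial :=
        mul_le_mul_of_nonneg_left hfac (by positivity)

end Bijections

/-! ### Resolved items are decoded -/

section Decoded
variable {N M ℓ r p : ℕ}

/-- The bins of the defective items. -/
def config (G : Graph N M ℓ r) (S : Finset (Fin N)) : S → Fin ℓ → Fin M := fun v e => (G (v, e)).1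

theorem defectivePositions_of_occ_eq_one {G : Graph N M ℓ r} {S : Finset (Fin N)} {i : Fin M}
    (v : S) (e : Fin ℓ) (hv : config G S v e = i) (h : occ Finset.univ (config G S) i = 1)
    (hm : (v : Fin N) ∈ binItems G i) :
    defectivePositions G S i = {position G i v hm} := by
  ext j
  rw [Finset.mem_singleton]
  constructor
  · intro hj
    obtain ⟨u, hS, hu, rfl⟩ := exists_of_mem_defectivePositions hj
    obtain ⟨e', he'⟩ := mem_binItems.1 hu
    have := Finset.card_le_one.1 (le_of_eq h) (⟨u, hS⟩, e')
      (mem_edgesAt.2 ⟨Finset.mem_univ _, he'⟩) (v, e) (mem_edgesAt.2 ⟨Finset.mem_univ _, hv⟩)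
    have huv : u = v := congrArg (fun q => (q.1 : Fin N)) this
    subst huv
    rfl
  · rintro rfl
    exact (position_mem_defectivePositions _).2 v.2

theorem defectivePositions_of_occ_eq_two {G : Graph N M ℓ r} {S : Finset (Fin N)} {i : Fin M}
    (u v : S) (e e' : Fin ℓ) (huv : u ≠ v) (hu : config G S u e = i) (hv : config G S v e' = i)
    (h : occ Finset.univ (config G S) i = 2) (hmu : (u : Fin N) ∈ binItems G i)
    (hmv : (v : Fin N) ∈ binItems G i) :
    defectivePositions G S i = {position G i u hmu, position G i v hmv} := by
  classical
  have hE : ({(u, e), (v, e')} : Finset (S × Fin ℓ)) = edgesAt Finset.univ (config G S) i := by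
    refine Finset.eq_of_subset_of_card_le (fun q hq => ?_) ?_
    · rcases Finset.mem_insert.1 hq with rfl | hq
      · exact mem_edgesAt.2 ⟨Finset.mem_univ _, hu⟩
      · rw [Finset.mem_singleton.1 hq]
        exact mem_edgesAt.2 ⟨Finset.mem_univ _, hv⟩
    · rw [Finset.card_pair (fun h => huv (congrArg Prod.fst h))]
      exact le_of_eq h
  ext j
  rw [Finset.mem_insert, Finset.mem_singleton]
  constructor
  · intro hj
    obtain ⟨w, hS, hw, rfl⟩ := exists_of_mem_defectivePositions hj
    obtain ⟨e'', he''⟩ := mem_binItems.1 hw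
    have : ((⟨w, hS⟩, e'') : S × Fin ℓ) ∈ edgesAt Finset.univ (config G S) i :=
      mem_edgesAt.2 ⟨Finset.mem_univ _, he''⟩
    rw [← hE, Finset.mem_insert, Finset.mem_singleton] at this
    rcases this with h | h
    · have hwu : w = u := congrArg (fun q => (q.1 : Fin N)) h
      subst hwu
      exact Or.inl rfl
    · have hwv : w = v := congrArg (fun q => (q.1 : Fin N)) h
      subst hwv
      exact Or.inr rfl
  · rintro (rfl | rfl)
    · exact (position_mem_defectivePositions _).2 u.2
    · exact (position_mem_defectivePositions _).2 v.2

theorem mem_run_of_isolated [NeZero p] (S : Finset (Fin N)) (ω : Outcome N M ℓ r p) (v : S)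
    (e : Fin ℓ) (h : occ Finset.univ (config ω.1 S) (config ω.1 S v e) = 1) :
    (v : Fin N) ∈ (run S ω).val :=
  mem_decode_of_singleton ω _ (i := config ω.1 S v e) (decodeSingleton_eq_some S ω _ v
    (mem_binItems.2 ⟨e, rfl⟩) (defectivePositions_of_occ_eq_one v e rfl h _))

/-- The isolated partner `u` is found in the singleton phase. Everything in the output has been
peeled, so the bin that `u` shares with `v` was given to the double-ton decoder. -/
theorem mem_run_of_resolved [NeZero p] (S : Finset (Fin N)) (ω : Outcome N M ℓ r p) (v : S)
    (h : Resolved Finset.univ (config ω.1 S) v) : (v : Fin N) ∈ (run S ω).val := by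
  obtain ⟨e, h | ⟨h, u, -, huv, ⟨e', he'⟩, e'', h1⟩⟩ := h
  · exact mem_run_of_isolated S ω v e h
  · have hu := mem_run_of_isolated S ω u e'' h1
    refine mem_decode_of_neighbor ω _ (e := e') hu ?_
    have hi : (ω.1 ((u : Fin N), e')).1 = config ω.1 S v e := he'
    unfold neighbor
    rw [hi]
    exact decodeDoubleton_eq_some S ω _ u v (mem_binItems.2 ⟨e', hi⟩) (mem_binItems.2 ⟨e, rfl⟩)
      (defectivePositions_of_occ_eq_two u v e' e huv he' rfl h _ _)

theorem card_le_card_run_add [NeZero p] (S : Finset (Fin N)) (ω : Outcome N M ℓ r p) :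
    S.card ≤ (run S ω).val.card + (unresolved Finset.univ (config ω.1 S)).card := by
  classical
  have h : S ⊆ (run S ω).val ∪
      (unresolved Finset.univ (config ω.1 S)).image (fun v : S => (v : Fin N)) := fun v hv => by
    by_cases hr : Resolved Finset.univ (config ω.1 S) ⟨v, hv⟩
    · exact Finset.mem_union_left _ (mem_run_of_resolved S ω ⟨v, hv⟩ hr)
    · exact Finset.mem_union_right _ (Finset.mem_image.2
        ⟨⟨v, hv⟩, mem_unresolved.2 ⟨Finset.mem_univ _, hr⟩, rfl⟩)
  exact (Finset.card_le_card h).trans ((Finset.card_union_le _ _).trans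
    (Nat.add_le_add_left Finset.card_image_le _))

/-- The number of unresolved items for the random graph, compared with independent choices. -/
theorem prob_unresolved_graph_le [Nonempty (Graph N M ℓ r)] (hr : 0 < r) (hℓ : 0 < ℓ)
    (S : Finset (Fin N)) (t : ℝ) (hS : S.card < N) :
    prob (fun G : Graph N M ℓ r => t < (unresolved Finset.univ (config G S)).card) ≤
      prob (fun f : S → Fin ℓ → Fin M => t < (unresolved Finset.univ f).card) *
        ((N : ℝ) / (N - S.card)) ^ (S.card * ℓ) := by
  classical
  have hne : Nonempty (Fin r) := ⟨⟨0, hr⟩⟩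
  have h := prob_equiv_comp_le (α := Fin N × Fin ℓ) (β := Fin M × Fin r) (τ := S × Fin ℓ)
    (fun q => ((q.1 : Fin N), q.2)) (fun q q' h => by
      have h1 := congrArg Prod.fst h
      have h2 := congrArg Prod.snd h
      exact Prod.ext (Subtype.ext h1) h2)
    (fun g => t < (unresolved Finset.univ (fun (v : S) (e : Fin ℓ) => (g (v, e)).1)).card) (by
      simp only [Fintype.card_prod, Fintype.card_fin, Fintype.card_coe]
      exact Nat.mul_lt_mul_of_pos_right hS hℓ)
  -- The event ignores the slot inside the bin, so the slot coordinates are averaged out, leaving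
  -- independent uniform bins.
  have hP : prob (fun g : S × Fin ℓ → Fin M × Fin r =>
      t < (unresolved Finset.univ (fun (v : S) (e : Fin ℓ) => (g (v, e)).1)).card) =
      prob (fun f : S → Fin ℓ → Fin M => t < (unresolved Finset.univ f).card) := by
    rw [← prob_fst (Ω' := S × Fin ℓ → Fin r)
      (fun f : S → Fin ℓ → Fin M => t < (unresolved Finset.univ f).card)]
    exact prob_equiv ((Equiv.arrowProdEquivProdArrow (S × Fin ℓ) (fun _ => Fin M)
      (fun _ => Fin r)).trans
      (Equiv.prodCongr (Equiv.curry S (Fin ℓ) (Fin M)) (Equiv.refl (S × Fin ℓ → Fin r))))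
      (fun q : (S → Fin ℓ → Fin M) × (S × Fin ℓ → Fin r) =>
        t < (unresolved Finset.univ q.1).card)
  rw [hP] at h
  refine h.trans_eq ?_
  have hℓ' : (ℓ : ℝ) ≠ 0 := by positivity
  simp only [Fintype.card_prod, Fintype.card_fin, Fintype.card_coe]
  rw [Nat.cast_mul, Nat.cast_mul, ← sub_mul, mul_div_mul_right _ _ hℓ']

end Decoded

/-! ### False positives -/

section FalsePositives
variable {N M ℓ r p : ℕ}

/-- The half-edges of the bin `i` that belong to defective items. -/
def defectiveSlots (G : Graph N M ℓ r) (S : Finset (Fin N)) (i : Fin M) : Finset (Fin r) :=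
  Finset.univ.filter fun j => (G.symm (i, j)).1 ∈ S

theorem card_defectivePositions_le (G : Graph N M ℓ r) (S : Finset (Fin N)) (i : Fin M) :
    (defectivePositions G S i).card ≤ (defectiveSlots G S i).card := by
  classical
  have h : ∀ j, j ∈ defectivePositions G S i →
      (binItems G i)[(j : ℕ)]? ∈ (defectiveSlots G S i).image fun j => some (G.symm (i, j)).1 := by
    intro j hj
    obtain ⟨v, hv, hjv⟩ := mem_defectivePositions.1 hj
    obtain ⟨e, he⟩ := mem_binItems.1 (List.mem_of_getElem? hjv)
    have hs : (G.symm (i, (G (v, e)).2)).1 = v := by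
      rw [← he, Prod.mk.eta, Equiv.symm_apply_apply]
    refine Finset.mem_image.2 ⟨(G (v, e)).2, Finset.mem_filter.2 ⟨Finset.mem_univ _, ?_⟩, ?_⟩
    · rwa [hs]
    · rw [hs, hjv]
  refine (Finset.card_le_card_of_injOn (fun j : Fin r => (binItems G i)[(j : ℕ)]?)
    (fun j hj => Finset.mem_coe.2 (h j hj)) ?_).trans Finset.card_image_le
  intro j hj j' hj' hjj
  obtain ⟨v, hv, hjv⟩ := mem_defectivePositions.1 hj
  obtain ⟨v', hv', hjv'⟩ := mem_defectivePositions.1 hj'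
  have hvv : v = v' := Option.some.inj (hjv.symm.trans (hjj.trans hjv'))
  subst hvv
  rw [eq_position hjv (List.mem_of_getElem? hjv), eq_position hjv' (List.mem_of_getElem? hjv)]

/-- For each `σ` at most one position outside `D` completes the section, and by the swap symmetry
position `l` is at most as likely to do so as any other. The `r - |D|` probabilities sum to at most
one. -/
theorem prob_covers_le (D : Finset (Fin r)) (l₀ l : Fin r) (h₀ : l₀ ∈ D) (hl : l ∉ D) (d : ℝ)
    (hd : 0 < d) (hD : d ≤ (r : ℝ) - D.card) :
    prob (fun σ : Equiv.Perm (Fin r) => Covers D l₀ σ l) ≤ 1 / d := by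
  classical
  have hsum : ∑ x ∈ Dᶜ, prob (fun σ : Equiv.Perm (Fin r) => Covers D l₀ σ x) ≤ 1 := by
    simp only [prob_eq_expect]
    rw [← Finset.expect_sum_comm]
    refine Finset.expect_le Finset.univ_nonempty fun σ _ => ?_
    rw [Finset.sum_boole]
    have : (Dᶜ.filter fun x => Covers D l₀ σ x).card ≤ 1 :=
      Finset.card_le_one.2 fun x hx y hy =>
        (Finset.mem_filter.1 hx).2.unique (Finset.mem_filter.1 hy).2
    exact_mod_cast this
  have hge : ∀ x ∈ Dᶜ, prob (fun σ : Equiv.Perm (Fin r) => Covers D l₀ σ l) ≤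
      prob (fun σ : Equiv.Perm (Fin r) => Covers D l₀ σ x) := by
    intro x hx
    rw [← prob_equiv (Equiv.mulRight (Equiv.swap l x))
      (fun σ : Equiv.Perm (Fin r) => Covers D l₀ σ x)]
    exact prob_mono fun σ h => h.mul_swap h₀ hl (Finset.mem_compl.1 hx)
  have h := (Finset.card_nsmul_le_sum _ _ _ hge).trans hsum
  rw [nsmul_eq_mul, Finset.card_compl, Fintype.card_fin, Nat.cast_sub
    (by simpa using Finset.card_le_univ D)] at h
  rw [le_div_iff₀ hd, mul_comm]
  exact (mul_le_mul_of_nonneg_right hD (prob_nonneg _)).trans h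

/-- The double-ton decoder at edge `e` of item `v` declares an item that is not defective. -/
def FalseNeighbor [NeZero p] (S : Finset (Fin N)) (ω : Outcome N M ℓ r p) (q : Fin N × Fin ℓ) :
    Prop :=
  ∃ w ∉ S, (neighbor ω (results S ω) q.1 q.2).val = some w

/-- Section `0` is not random given the graph, so it fixes the false candidate `l` before the
permutations are drawn. The `p - 1` remaining sections then have to accept this `l` independently.
-/
theorem prob_falseNeighbor_le [NeZero p] (S : Finset (Fin N)) (G : Graph N M ℓ r)
    (q : Fin N × Fin ℓ) (hq : q.1 ∈ S) (d : ℝ) (hd : 0 < d)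
    (hD : d ≤ (r : ℝ) - (defectivePositions G S (G q).1).card) :
    prob (fun π : Fin (p - 1) → Equiv.Perm (Fin r) =>
      FalseNeighbor S ((G, π) : Outcome N M ℓ r p) q) ≤ (1 / d) ^ (p - 1) := by
  classical
  obtain ⟨v, e⟩ := q
  set i := (G (v, e)).1 with hi
  have hm : v ∈ binItems G i := mem_binItems.2 ⟨e, rfl⟩
  have key : ∀ π, FalseNeighbor S ((G, π) : Outcome N M ℓ r p) (v, e) →
      ∃ l ∉ defectivePositions G S i, Covers (defectivePositions G S i) (position G i v hm) 1 l ∧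
        ∀ k, Covers (defectivePositions G S i) (position G i v hm) (π k) l := by
    rintro π ⟨w, hw, h⟩
    obtain ⟨l, hl, hc⟩ := exists_covers_of_decodeDoubleton S (G, π) i v w hm h hw
    refine ⟨l, hl, ?_, fun k => ?_⟩
    · have := hc 0
      rwa [sectionPerm_zero] at this
    · have := hc ⟨k + 1, by have := k.isLt; omega⟩
      rwa [sectionPerm_succ] at this
  by_cases hex : ∃ l ∉ defectivePositions G S i,
      Covers (defectivePositions G S i) (position G i v hm) 1 l
  · obtain ⟨l, hl, hc⟩ := hex
    have hle := prob_covers_le (defectivePositions G S i) (position G i v hm) l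
      ((position_mem_defectivePositions _).2 hq) hl d hd hD
    have hprod := prob_forall_mem (ι := Fin (p - 1)) fun _ => Finset.univ.filter
      fun σ : Equiv.Perm (Fin r) => Covers (defectivePositions G S i) (position G i v hm) σ l
    simp only [Finset.mem_filter, Finset.mem_univ, true_and] at hprod
    rw [Finset.prod_const, Finset.card_univ, Fintype.card_fin, ← Fintype.card_subtype,
      ← Nat.card_eq_fintype_card, ← Nat.card_eq_fintype_card (α := Equiv.Perm (Fin r))] at hprod
    refine (prob_mono fun π hπ => ?_).trans (hprod.le.trans
      (pow_le_pow_left₀ (prob_nonneg _) hle _))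
    obtain ⟨l', hl', hc', hk⟩ := key π hπ
    rwa [hc.unique hc']
  · have : prob (fun π : Fin (p - 1) → Equiv.Perm (Fin r) =>
        FalseNeighbor S ((G, π) : Outcome N M ℓ r p) (v, e)) ≤
        prob (fun _ : Fin (p - 1) → Equiv.Perm (Fin r) => False) :=
      prob_mono fun π hπ => by
        obtain ⟨l, hl, hc, -⟩ := key π hπ
        exact hex ⟨l, hl, hc⟩
    refine this.trans ?_
    simp only [prob, Nat.card_of_isEmpty, Nat.cast_zero, zero_div]
    positivity

/-- Union bound over the sets of `t` slots: there are at most `2 ^ r ≤ 4 ^ t` of them, and each is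
entirely defective with probability at most `(2K/N) ^ t`. The factor `2` is the price of replacing
the bijection by independent choices, as `2t ≤ M r`. -/
theorem prob_card_defectiveSlots_le [Nonempty (Graph N M ℓ r)] (S : Finset (Fin N)) (i : Fin M)
    (t : ℕ) (ht : t ≤ r) (hr : r ≤ 2 * t) (hM : 2 ≤ M) (hr0 : 0 < r) (hℓ : 0 < ℓ) :
    prob (fun G : Graph N M ℓ r => t ≤ (defectiveSlots G S i).card) ≤
      (8 * S.card / N : ℝ) ^ t := by
  classical
  have hcard : N * ℓ = M * r := by
    simpa using Fintype.card_congr (Classical.arbitrary (Graph N M ℓ r))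
  have hlt : 2 * t ≤ M * r := by nlinarith
  have hpos : 0 < M * r := by positivity
  have hQ : ∀ Q ∈ Finset.powersetCard t (Finset.univ : Finset (Fin r)),
      prob (fun G : Graph N M ℓ r => Q ⊆ defectiveSlots G S i) ≤ (2 * S.card / N : ℝ) ^ t := by
    intro Q hQ
    have hQt : Q.card = t := (Finset.mem_powersetCard.1 hQ).2
    have : Nonempty ((Fin M × Fin r) ≃ (Fin N × Fin ℓ)) :=
      ⟨(Classical.arbitrary (Graph N M ℓ r)).symm⟩
    have h := prob_equiv_comp_le (α := Fin M × Fin r) (β := Fin N × Fin ℓ) (τ := Q)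
      (fun j => (i, (j : Fin r))) (fun j j' h => Subtype.ext (congrArg Prod.snd h))
      (fun g => ∀ j, g j ∈ S ×ˢ (Finset.univ : Finset (Fin ℓ))) (by
        simp only [Fintype.card_prod, Fintype.card_fin, Fintype.card_coe]
        omega)
    rw [← prob_equiv (Equiv.symmEquiv (Fin N × Fin ℓ) (Fin M × Fin r))] at h
    have hsub : ∀ G : Graph N M ℓ r, Q ⊆ defectiveSlots G S i →
        ∀ j : Q, Equiv.symmEquiv (Fin N × Fin ℓ) (Fin M × Fin r) G (i, (j : Fin r)) ∈
          S ×ˢ (Finset.univ : Finset (Fin ℓ)) := fun G hG j =>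
      Finset.mem_product.2 ⟨(Finset.mem_filter.1 (hG j.2)).2, Finset.mem_univ _⟩
    refine (prob_mono hsub).trans (h.trans ?_)
    rw [prob_forall_mem, Finset.prod_const, Finset.card_univ, ← mul_pow, Fintype.card_coe, hQt]
    refine pow_le_pow_left₀ ?_ ?_ _
    · simp only [Fintype.card_prod, Fintype.card_fin]
      have : (t : ℝ) ≤ (M * r : ℕ) := by exact_mod_cast (by omega : t ≤ M * r)
      exact mul_nonneg (by positivity) (div_nonneg (by positivity) (by linarith))
    · simp only [Fintype.card_prod, Fintype.card_fin, Finset.card_product, Finset.card_univ]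
      have hℓ' : (ℓ : ℝ) ≠ 0 := by positivity
      have h1 : ((M * r : ℕ) : ℝ) / ((M * r : ℕ) - t) ≤ 2 := by
        have h2 : (2 * t : ℝ) ≤ (M * r : ℕ) := by exact_mod_cast hlt
        have h3 : (0 : ℝ) < (M * r : ℕ) := by exact_mod_cast hpos
        rw [div_le_iff₀ (by linarith)]
        linarith
      rw [Nat.cast_mul S.card, Nat.cast_mul N, mul_div_mul_right _ _ hℓ']
      calc (S.card : ℝ) / N * (((M * r : ℕ) : ℝ) / ((M * r : ℕ) - t)) ≤ S.card / N * 2 :=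
            mul_le_mul_of_nonneg_left h1 (by positivity)
        _ = 2 * S.card / N := by ring
  have hex : ∀ G : Graph N M ℓ r, t ≤ (defectiveSlots G S i).card →
      ∃ Q ∈ Finset.powersetCard t (Finset.univ : Finset (Fin r)), Q ⊆ defectiveSlots G S i := by
    intro G hG
    obtain ⟨Q, hQ, hQt⟩ := Finset.exists_subset_card_eq hG
    exact ⟨Q, Finset.mem_powersetCard.2 ⟨Finset.subset_univ _, hQt⟩, hQ⟩
  refine (prob_mono hex).trans ((prob_exists_le _ _).trans
    ((Finset.sum_le_card_nsmul _ _ _ hQ).trans ?_))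
  rw [Finset.card_powersetCard, Finset.card_univ, Fintype.card_fin, nsmul_eq_mul]
  calc ((r.choose t : ℕ) : ℝ) * (2 * S.card / N : ℝ) ^ t ≤ 4 ^ t * (2 * S.card / N : ℝ) ^ t := by
        refine mul_le_mul_of_nonneg_right ?_ (by positivity)
        have h1 : r.choose t ≤ 2 ^ r := Nat.choose_le_two_pow r t
        have h2 : 2 ^ r ≤ 2 ^ (2 * t) := Nat.pow_le_pow_right (by norm_num) hr
        rw [pow_mul] at h2
        exact_mod_cast h1.trans h2
    _ = (8 * S.card / N : ℝ) ^ t := by rw [← mul_pow]; congr 1; ring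

/-- The probability that a bin decoder declares an item that is not defective. -/
theorem prob_exists_falseNeighbor_le [NeZero p] [Nonempty (Graph N M ℓ r)] (S : Finset (Fin N))
    (hM : 2 ≤ M) (hr0 : 0 < r) (hℓ : 0 < ℓ) (hp : 2 * p ≤ r) (hN : 8 * S.card ≤ N) (hN0 : 0 < N) :
    prob (fun ω : Outcome N M ℓ r p =>
        ∃ q ∈ S ×ˢ (Finset.univ : Finset (Fin ℓ)), FalseNeighbor S ω q) ≤
      S.card * ℓ * (2 / r : ℝ) ^ (p - 1) + M * (8 * S.card / N : ℝ) ^ (p - 1) := by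
  classical
  -- With fewer than `⌈r/2⌉` defective slots, at least half of the positions are available to the
  -- symmetry argument. Also `t ≥ p` by `2p ≤ r`, so the exponent `t` may be lowered to `p - 1`.
  set t := (r + 1) / 2 with ht
  have hrpos : (0 : ℝ) < r := by exact_mod_cast hr0
  rw [prob_prod]
  refine (expect_le_add_prob _ (fun G : Graph N M ℓ r =>
    ∃ i ∈ (Finset.univ : Finset (Fin M)), t ≤ (defectiveSlots G S i).card)
    (S.card * ℓ * (2 / r : ℝ) ^ (p - 1)) (fun G => prob_le_one _) (by positivity)
    fun G hG => ?_).trans (add_le_add_right ?_ _)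
  · push Not at hG
    refine (prob_exists_le _ _).trans ((Finset.sum_le_card_nsmul _ _ ((2 / r : ℝ) ^ (p - 1))
      fun q hq => ?_).trans_eq ?_)
    · have h1 := card_defectivePositions_le G S (G q).1
      have h2 := hG (G q).1 (Finset.mem_univ _)
      have h3 : 2 * (defectivePositions G S (G q).1).card ≤ r := by omega
      have h4 : (2 * (defectivePositions G S (G q).1).card : ℝ) ≤ r := by exact_mod_cast h3
      have h := prob_falseNeighbor_le (p := p) S G q (Finset.mem_product.1 hq).1 (r / 2)
        (by positivity) (by linarith)
      rwa [one_div_div] at h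
    · rw [Finset.card_product, Finset.card_univ, Fintype.card_fin, nsmul_eq_mul, Nat.cast_mul]
  · refine (prob_exists_le _ _).trans ((Finset.sum_le_card_nsmul _ _
      ((8 * S.card / N : ℝ) ^ (p - 1)) fun i _ => ?_).trans_eq ?_)
    · refine (prob_card_defectiveSlots_le S i t (by omega) (by omega) hM hr0 hℓ).trans
        (pow_le_pow_of_le_one (by positivity) ?_ (by omega))
      rw [div_le_one (by exact_mod_cast hN0)]
      exact_mod_cast hN
    · rw [Finset.card_univ, Fintype.card_fin, nsmul_eq_mul]

theorem run_subset [NeZero p] (S : Finset (Fin N)) (ω : Outcome N M ℓ r p) (hr : 2 ≤ r)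
    (h : ¬ ∃ q ∈ S ×ˢ (Finset.univ : Finset (Fin ℓ)), FalseNeighbor S ω q) :
    (run S ω).val ⊆ S := by
  refine decode_subset ω _ S (fun i v hv => mem_of_decodeSingleton S ω i v hr hv)
    fun u hu e w hw => ?_
  by_contra hc
  exact h ⟨(u, e), Finset.mem_product.2 ⟨hu, Finset.mem_univ _⟩, w, hc, hw⟩

end FalsePositives

/-! ### The error floor -/

/-- Two rounds of peeling leave a fraction smaller than `ε` unresolved in the limit. -/
def ErrorFloor (ε : ℝ) (ℓ : ℕ) (c : ℝ) : Prop :=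
  0 < ℓ ∧ 0 < c ∧ ∃ a : ℝ, 0 ≤ a ∧ a < Real.exp (-(ℓ / c)) ∧
    (1 - a - ℓ / c * pairRate ℓ a) ^ ℓ < ε

theorem tendsto_ceil_mul_div (c : ℝ) (hc : 0 < c) :
    Tendsto (fun K : ℕ => (⌈c * (K : ℝ)⌉₊ : ℝ) / K) atTop (𝓝 c) :=
  (tendsto_nat_ceil_mul_div_atTop hc.le).comp tendsto_natCast_atTop_atTop

theorem tendsto_ceil_mul_atTop (c : ℝ) (hc : 0 < c) :
    Tendsto (fun K : ℕ => (⌈c * (K : ℝ)⌉₊ : ℝ)) atTop atTop :=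
  tendsto_atTop_mono (fun _ => Nat.le_ceil _)
    (tendsto_natCast_atTop_atTop.const_mul_atTop hc)

/-- Indeed `1 - 1/m` is the inverse of `1 + 1/(m - 1)`, which is at most `exp (1/(m - 1))`. -/
theorem exp_neg_le_one_sub_pow (m : ℝ) (hm : 1 < m) (k : ℕ) :
    Real.exp (-(k / (m - 1))) ≤ (1 - 1 / m) ^ k := by
  have h1 : 0 < m - 1 := by linarith
  have h2 : Real.exp (-(1 / (m - 1))) ≤ 1 - 1 / m := by
    rw [Real.exp_neg]
    refine inv_le_of_inv_le₀ (sub_pos.2 ((div_lt_one (by linarith)).2 hm)) ?_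
    have h3 := Real.add_one_le_exp (1 / (m - 1))
    refine le_trans (le_of_eq ?_) h3
    field_simp
    ring
  calc Real.exp (-(k / (m - 1))) = Real.exp (-(1 / (m - 1))) ^ k := by
        rw [← Real.exp_nat_mul]
        congr 1
        ring
    _ ≤ (1 - 1 / m) ^ k := pow_le_pow_left₀ (Real.exp_pos _).le h2 k

/-- The two strict inequalities of `ErrorFloor` leave room for the slacks `δ`, `b` and `β`, and all
the finite-size corrections tend to zero. The types `V` and `B` are quantified inside the
eventuality because `V` will be an arbitrary defective set. -/
theorem ErrorFloor.exists_rate {ε : ℝ} {ℓ : ℕ} {c : ℝ} (h : ErrorFloor ε ℓ c) :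
    ∃ γ : ℝ, 0 < γ ∧ ∀ᶠ K : ℕ in atTop, ∀ (V B : Type) [Fintype V] [DecidableEq V] [Fintype B]
      [DecidableEq B], Fintype.card V = K → Fintype.card B = ⌈c * (K : ℝ)⌉₊ →
      prob (fun f : V → Fin ℓ → B => ε * K < (unresolved Finset.univ f).card) ≤
        Real.exp (-γ * K) := by
  obtain ⟨hℓ, hc, a, ha0, ha, hε⟩ := h
  have hℓc : (0 : ℝ) < ℓ / c := by positivity
  have ha1 : a ≤ 1 := ha.le.trans (Real.exp_le_one_iff.2 (by linarith))
  set b₀ := a + ℓ / c * pairRate ℓ a with hb₀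
  have hh1 : pairRate ℓ a ≤ a := by
    unfold pairRate
    refine mul_le_of_le_one_right ha0 ?_
    have := pow_nonneg (show 0 ≤ 1 - a by linarith) (ℓ - 1)
    linarith
  -- This follows from `a < exp (-x)` and `x + 1 ≤ exp x` with `x = ℓ/c`; it keeps `1 - b`
  -- nonnegative.
  have hb₀1 : b₀ ≤ 1 := by
    have h1 : b₀ ≤ a * (ℓ / c + 1) := by
      have := mul_le_mul_of_nonneg_left hh1 hℓc.le
      rw [hb₀]; linarith
    have h2 : a * (ℓ / c + 1) ≤ Real.exp (-(ℓ / c)) * Real.exp (ℓ / c) :=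
      mul_le_mul ha.le (Real.add_one_le_exp _) (by linarith) (Real.exp_pos _).le
    rw [← Real.exp_add, neg_add_cancel, Real.exp_zero] at h2
    linarith
  obtain ⟨b, hb, hbε⟩ : ∃ b, b < b₀ ∧ (1 - b) ^ ℓ < ε := by
    have hcont : Tendsto (fun b : ℝ => (1 - b) ^ ℓ) (𝓝[<] b₀) (𝓝 ((1 - b₀) ^ ℓ)) :=
      (Continuous.tendsto (by fun_prop) b₀).mono_left nhdsWithin_le_nhds
    have hlt : (1 - b₀) ^ ℓ < ε := by rw [hb₀, ← sub_sub]; exact hε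
    obtain ⟨b, h1, h2⟩ := ((hcont.eventually_lt_const hlt).and self_mem_nhdsWithin).exists
    exact ⟨b, h2, h1⟩
  set δ := (Real.exp (-(ℓ / c)) - a) / 2 with hδ
  have hδ0 : 0 < δ := by rw [hδ]; linarith
  set β := ((1 - b) ^ ℓ + ε) / 2 with hβ
  have hL : (0 : ℝ) < 2 * lip ℓ := by
    have : 0 < lip ℓ := by unfold lip; omega
    positivity
  let M : ℕ → ℝ := fun K => (⌈c * (K : ℝ)⌉₊ : ℝ)
  let η : ℕ → ℝ := fun K => Real.exp (-((δ * M K) ^ 2 / (2 * K * (2 * lip ℓ) ^ 2)))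
  have hM : Tendsto M atTop atTop := tendsto_ceil_mul_atTop c hc
  have hMK : Tendsto (fun K : ℕ => M K / K) atTop (𝓝 c) := tendsto_ceil_mul_div c hc
  have hKM : Tendsto (fun K : ℕ => (K : ℝ) / M K) atTop (𝓝 (1 / c)) := by
    have := hMK.inv₀ hc.ne'
    rw [one_div]
    exact this.congr fun K => inv_div _ _
  have hMinv : ∀ x : ℝ, Tendsto (fun K => x / M K) atTop (𝓝 0) := fun x => hM.const_div_atTop x
  have hη : Tendsto η atTop (𝓝 0) := by
    refine Real.tendsto_exp_neg_atTop_nhds_zero.comp ?_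
    have h1 : Tendsto (fun K : ℕ => M K * (M K / K * (δ ^ 2 / (2 * (2 * lip ℓ) ^ 2)))) atTop
        atTop := hM.atTop_mul_pos (by positivity : 0 < c * (δ ^ 2 / (2 * (2 * lip ℓ) ^ 2)))
      (hMK.mul_const _)
    refine h1.congr fun K => ?_
    rcases Nat.eq_zero_or_pos K with rfl | hK
    · simp
    · have : (K : ℝ) ≠ 0 := by positivity
      field_simp
  have hKM1 : Tendsto (fun K : ℕ => (ℓ * K : ℕ) / (M K - 1)) atTop (𝓝 (ℓ / c)) := by
    have h1 : Tendsto (fun K : ℕ => (ℓ * (K / M K)) / (1 - 1 / M K)) atTop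
        (𝓝 (ℓ * (1 / c) / (1 - 0))) :=
      (hKM.const_mul _).div (tendsto_const_nhds.sub (hMinv 1)) (by norm_num)
    rw [sub_zero, div_one, mul_one_div] at h1
    refine h1.congr' ?_
    filter_upwards [hM.eventually_gt_atTop 1] with K hK
    have h2 : M K - 1 ≠ 0 := by linarith
    have h3 : M K ≠ 0 := by linarith
    push_cast
    field_simp
  have e1 : ∀ᶠ K : ℕ in atTop, a + δ ≤ (1 - 1 / M K) ^ (ℓ * K) := by
    have h1 : Tendsto (fun K : ℕ => Real.exp (-((ℓ * K : ℕ) / (M K - 1)))) atTop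
        (𝓝 (Real.exp (-(ℓ / c)))) := (Real.continuous_exp.tendsto _).comp hKM1.neg
    filter_upwards [h1.eventually_const_le (show a + δ < Real.exp (-(ℓ / c)) by linarith),
      hM.eventually_gt_atTop 1] with K hK hK1
    exact hK.trans (exp_neg_le_one_sub_pow (M K) hK1 (ℓ * K))
  have e2 : ∀ᶠ K : ℕ in atTop, b + δ ≤ a + δ + ((K : ℝ) - 1) * ℓ / M K *
      (pairRate ℓ a * (1 - η K) - ℓ ^ 2 * (1 + 2 * ℓ) / M K) := by
    have h1 : Tendsto (fun K : ℕ => a + δ + ((K : ℝ) / M K * ℓ - ℓ / M K) *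
        (pairRate ℓ a * (1 - η K) - ℓ ^ 2 * (1 + 2 * ℓ) / M K)) atTop
        (𝓝 (a + δ + (1 / c * ℓ - 0) * (pairRate ℓ a * (1 - 0) - 0))) :=
      tendsto_const_nhds.add (((hKM.mul_const _).sub (hMinv _)).mul
        (((tendsto_const_nhds.sub hη).const_mul _).sub (hMinv _)))
    have h2 : b + δ < a + δ + (1 / c * ℓ - 0) * (pairRate ℓ a * (1 - 0) - 0) := by
      have : (1 / c * ℓ - 0) * (pairRate ℓ a * (1 - 0) - 0) = ℓ / c * pairRate ℓ a := by ring
      rw [this]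
      linarith
    filter_upwards [h1.eventually_const_le h2] with K hK
    refine hK.trans_eq ?_
    ring
  have e3 : ∀ᶠ K : ℕ in atTop,
      (1 - b) ^ ℓ + ℓ ^ 2 * (1 + 2 * ℓ) / M K + η K ≤ β := by
    have h1 : Tendsto (fun K : ℕ => (1 - b) ^ ℓ + ℓ ^ 2 * (1 + 2 * ℓ) / M K + η K) atTop
        (𝓝 ((1 - b) ^ ℓ + 0 + 0)) := (tendsto_const_nhds.add (hMinv _)).add hη
    exact h1.eventually_le_const (by rw [hβ]; linarith)
  refine ⟨(ε - β) ^ 2 / (2 * (2 * lip ℓ) ^ 2), ?_, ?_⟩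
  · have : 0 < ε - β := by rw [hβ]; linarith
    positivity
  filter_upwards [e1, e2, e3, eventually_gt_atTop 0, hM.eventually_gt_atTop 0] with K h1 h2 h3 h4
    h5 V B _ _ _ _ hV hB
  have hK0 : (0 : ℝ) < K := by exact_mod_cast h4
  have hBne : Nonempty B := by
    rw [← Fintype.card_pos_iff, hB]
    exact Nat.cast_pos.1 h5
  refine (prob_card_unresolved_le (K := K) (M := M K) (a := a) (b := b) (δ := δ) (β := β)
    (ε := ε) (η := η K) hK0 (by rw [hV]) (by rw [hB]) ha0 ha1 (by linarith) hδ0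
    (by rw [hβ]; linarith) le_rfl (by rw [hV]; exact h1) h2 h3).trans_eq ?_
  congr 1
  field_simp

/-! ### The tabulated constants -/

/-- The tangent to `exp (-x)` at `x = 1`, with `0.3678 < exp (-1)`. It is accurate enough because
`ℓ/c` lies between `1` and `1.15` in every row of the table. -/
theorem mul_one_sub_lt_exp {a x : ℝ} (hx : x ≤ 2) (h : a ≤ 0.3678 * (2 - x)) :
    a < Real.exp (-x) := by
  have h1 := Real.exp_neg_one_gt_d9
  have h2 := Real.add_one_le_exp (1 - x)
  have h3 : Real.exp (-x) = Real.exp (-1) * Real.exp (1 - x) := by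
    rw [← Real.exp_add]; congr 1; ring
  rw [h3]
  rcases hx.lt_or_eq with hx | rfl
  · calc a ≤ 0.3678 * (2 - x) := h
      _ < Real.exp (-1) * (2 - x) := mul_lt_mul_of_pos_right (by linarith) (by linarith)
      _ ≤ Real.exp (-1) * Real.exp (1 - x) :=
        mul_le_mul_of_nonneg_left (by linarith) (Real.exp_pos _).le
  · have : a ≤ 0 := by linarith
    exact this.trans_lt (by positivity)

theorem errorFloor_table : ∀ row ∈ table, ErrorFloor row.1 row.2.1 row.2.2 := by
  intro row hrow
  simp only [table, List.mem_cons, List.not_mem_nil, or_false] at hrow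
  rcases hrow with rfl | rfl | rfl | rfl | rfl | rfl | rfl
  -- In each row, `a` is `0.3678 * (2 - ℓ/c)` rounded down to three decimals.
  · exact ⟨by norm_num, by norm_num, 0.315, by norm_num,
      mul_one_sub_lt_exp (by norm_num) (by norm_num), by norm_num [pairRate]⟩
  · exact ⟨by norm_num, by norm_num, 0.315, by norm_num,
      mul_one_sub_lt_exp (by norm_num) (by norm_num), by norm_num [pairRate]⟩
  · exact ⟨by norm_num, by norm_num, 0.353, by norm_num,
      mul_one_sub_lt_exp (by norm_num) (by norm_num), by norm_num [pairRate]⟩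
  · exact ⟨by norm_num, by norm_num, 0.347, by norm_num,
      mul_one_sub_lt_exp (by norm_num) (by norm_num), by norm_num [pairRate]⟩
  · exact ⟨by norm_num, by norm_num, 0.342, by norm_num,
      mul_one_sub_lt_exp (by norm_num) (by norm_num), by norm_num [pairRate]⟩
  · exact ⟨by norm_num, by norm_num, 0.363, by norm_num,
      mul_one_sub_lt_exp (by norm_num) (by norm_num), by norm_num [pairRate]⟩
  · exact ⟨by norm_num, by norm_num, 0.358, by norm_num,
      mul_one_sub_lt_exp (by norm_num) (by norm_num), by norm_num [pairRate]⟩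

/-- Outside the table any valid choice will do. With `c = ℓ = n` and `a = 1/3 < exp (-1)`, the first
round alone gives at most `(2/3) ^ n`. -/
theorem exists_errorFloor (ε : ℝ) (h0 : 0 < ε) (h1 : ε < 1) : ∃ ℓ c, ErrorFloor ε ℓ c := by
  obtain ⟨n, hn⟩ := exists_pow_lt_of_lt_one h0 (show (2 / 3 : ℝ) < 1 by norm_num)
  have hn0 : 0 < n := by
    rcases Nat.eq_zero_or_pos n with rfl | h
    · rw [pow_zero] at hn; linarith
    · exact h
  have hnR : (n : ℝ) ≠ 0 := by positivity
  refine ⟨n, n, hn0, by positivity, 1 / 3, by norm_num, ?_, ?_⟩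
  · rw [div_self hnR]
    exact mul_one_sub_lt_exp (by norm_num) (by norm_num)
  · rw [div_self hnR, one_mul]
    have h2 := pairRate_nonneg n (show (0 : ℝ) ≤ 1 / 3 by norm_num) (by norm_num)
    have h3 : pairRate n (1 / 3) ≤ 1 / 3 := by
      unfold pairRate
      refine mul_le_of_le_one_right (by norm_num) ?_
      have := pow_nonneg (show (0 : ℝ) ≤ 1 - 1 / 3 by norm_num) (n - 1)
      linarith
    exact (pow_le_pow_left₀ (by linarith) (by linarith) n).trans_lt hn

/-- The rows have different `ε`, so looking up `ℓ` and `c` by `ε` is well defined. -/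
theorem table_injective : ∀ row ∈ table, ∀ row' ∈ table, row.1 = row'.1 → row = row' := by
  intro row hrow row' hrow' h
  simp only [table, List.mem_cons, List.not_mem_nil, or_false] at hrow hrow'
  rcases hrow with rfl | rfl | rfl | rfl | rfl | rfl | rfl <;>
    rcases hrow' with rfl | rfl | rfl | rfl | rfl | rfl | rfl <;>
    first | rfl | (exfalso; norm_num at h)

theorem exists_constants : ∃ (ℓ : ℝ → ℕ) (c : ℝ → ℝ),
    (∀ row ∈ table, ℓ row.1 = row.2.1 ∧ c row.1 = row.2.2) ∧
      ∀ ε, 0 < ε → ε < 1 → ErrorFloor ε (ℓ ε) (c ε) := by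
  have h : ∀ ε : ℝ, ∃ q : ℕ × ℝ, (∀ row ∈ table, row.1 = ε → q = row.2) ∧
      (0 < ε → ε < 1 → ErrorFloor ε q.1 q.2) := by
    intro ε
    by_cases hex : ∃ row ∈ table, row.1 = ε
    · obtain ⟨row, hrow, rfl⟩ := hex
      exact ⟨row.2, fun row' hrow' h => by rw [table_injective row' hrow' row hrow h],
        fun _ _ => errorFloor_table row hrow⟩
    · by_cases h01 : 0 < ε ∧ ε < 1
      · obtain ⟨ℓ, c, h⟩ := exists_errorFloor ε h01.1 h01.2
        exact ⟨(ℓ, c), fun row hrow h => absurd ⟨row, hrow, h⟩ hex, fun _ _ => h⟩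
      · exact ⟨(0, 0), fun row hrow h => absurd ⟨row, hrow, h⟩ hex,
          fun h0 h1 => absurd ⟨h0, h1⟩ h01⟩
  choose q hq using h
  exact ⟨fun ε => (q ε).1, fun ε => (q ε).2, fun row hrow => by
    simp only [(hq row.1).1 row hrow rfl, and_self], fun ε => (hq ε).2⟩

/-! ### The asymptotic regime -/

/-- The sequences of parameters of the main theorem. -/
structure Regime (ℓ : ℕ) (c : ℝ) (p : ℕ) (N K M r : ℕ → ℕ) : Prop where
  ℓ_pos : 0 < ℓ
  c_pos : 0 < c
  p_pos : 0 < p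
  tendsto_K : Tendsto K atTop atTop
  isLittleO : (fun n => (K n : ℝ)) =o[atTop] (fun n => (N n : ℝ) ^ (1 - 1 / (p : ℝ)))
  M_eq : ∀ n, M n = ⌈c * (K n : ℝ)⌉₊
  edges : ∀ n, M n * r n = N n * ℓ

/-- The constant of the bound for the number of steps. -/
noncomputable def stepConstant (ℓ : ℕ) (c : ℝ) (p : ℕ) : ℝ :=
  ((c + 1) * (8 + 10 * p) + (2 + ℓ * (10 + 10 * p)) + 1) *
    (((1 + Real.log ℓ) / Real.log 2 + 2) * p)

theorem stepConstant_pos {ℓ : ℕ} {c : ℝ} {p : ℕ} (hℓ : 0 < ℓ) (hc : 0 < c) (hp : 0 < p) :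
    0 < stepConstant ℓ c p := by
  have h1 : (1 : ℝ) ≤ ℓ := by exact_mod_cast hℓ
  have h2 := Real.log_nonneg h1
  have hlog2 : 0 < Real.log 2 := Real.log_pos (by norm_num)
  unfold stepConstant
  positivity

/-- The constant of the bound for the probability of a false positive. -/
noncomputable def falseConstant (ℓ : ℕ) (c : ℝ) (p : ℕ) : ℝ :=
  ℓ * (2 * (c + 1)) ^ (p - 1) + (c + 1) * 8 ^ (p - 1)

namespace Regime
variable {ℓ : ℕ} {c : ℝ} {p : ℕ} {N K M r : ℕ → ℕ} (h : Regime ℓ c p N K M r)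
include h

theorem tendsto_K_real : Tendsto (fun n => (K n : ℝ)) atTop atTop :=
  tendsto_natCast_atTop_atTop.comp h.tendsto_K

theorem eventually_K_le : ∀ᶠ n in atTop, (K n : ℝ) ≤ (N n : ℝ) ^ (1 - 1 / (p : ℝ)) := by
  filter_upwards [h.isLittleO.bound (show (0 : ℝ) < 1 by norm_num)] with n hn
  rwa [one_mul, Real.norm_of_nonneg (by positivity), Real.norm_of_nonneg (by positivity)] at hn

theorem exponent_nonneg : 0 ≤ 1 - 1 / (p : ℝ) := by
  have : (1 : ℝ) ≤ p := by exact_mod_cast h.p_pos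
  have := (div_le_one (by linarith : (0 : ℝ) < p)).2 this
  linarith

theorem eventually_N_pos : ∀ᶠ n in atTop, 1 ≤ N n := by
  filter_upwards [h.eventually_K_le, h.tendsto_K_real.eventually_gt_atTop 1] with n h1 h2
  by_contra hN
  have h0 : N n = 0 := by omega
  rw [h0, Nat.cast_zero] at h1
  -- The exponent vanishes for `p = 1`, where `0 ^ 0 = 1`; there `K = o(1)` contradicts `K → ∞`, so
  -- that regime is empty.
  rcases h.exponent_nonneg.eq_or_lt with h3 | h3
  · rw [← h3, Real.rpow_zero] at h1; linarith
  · rw [Real.zero_rpow h3.ne'] at h1; linarith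

theorem eventually_rpow_le : ∀ᶠ n in atTop, (N n : ℝ) ^ (1 - 1 / (p : ℝ)) ≤ N n := by
  filter_upwards [h.eventually_N_pos] with n h1
  have h2 : (1 : ℝ) ≤ N n := by exact_mod_cast h1
  have : 0 ≤ 1 / (p : ℝ) := by positivity
  calc (N n : ℝ) ^ (1 - 1 / (p : ℝ)) ≤ (N n : ℝ) ^ (1 : ℝ) :=
        Real.rpow_le_rpow_of_exponent_le h2 (by linarith)
    _ = N n := Real.rpow_one _

theorem tendsto_N : Tendsto (fun n => (N n : ℝ)) atTop atTop := by
  refine tendsto_atTop_mono' _ ?_ h.tendsto_K_real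
  filter_upwards [h.eventually_K_le, h.eventually_rpow_le] with n h1 h2
  exact h1.trans h2

theorem tendsto_K_div_N : Tendsto (fun n => (K n : ℝ) / N n) atTop (𝓝 0) := by
  refine squeeze_zero' (Eventually.of_forall fun n => by positivity) ?_
    h.isLittleO.tendsto_div_nhds_zero
  filter_upwards [h.eventually_rpow_le, h.eventually_N_pos] with n h1 h2
  have h3 : (0 : ℝ) < N n := by exact_mod_cast h2
  exact div_le_div_of_nonneg_left (by positivity) (Real.rpow_pos_of_pos h3 _) h1

theorem tendsto_N_div_K : Tendsto (fun n => (N n : ℝ) / K n) atTop atTop := by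
  have h1 : Tendsto (fun n => (K n : ℝ) / N n) atTop (𝓝[>] 0) :=
    tendsto_nhdsWithin_iff.2 ⟨h.tendsto_K_div_N, by
      filter_upwards [h.eventually_N_pos, h.tendsto_K_real.eventually_gt_atTop 0] with n h1 h2
      have h3 : (0 : ℝ) < N n := by exact_mod_cast h1
      exact div_pos h2 h3⟩
  exact h1.inv_tendsto_nhdsGT_zero.congr fun n => inv_div _ _

/-- From `K ≤ N ^ (1 - 1/p)` one gets `N/K ≥ N ^ (1/p)`. This turns the word cost `log N` into the
`log (N/K)` of the theorem. -/
theorem eventually_log_le :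
    ∀ᶠ n in atTop, Real.log (N n) ≤ p * Real.log ((N n : ℝ) / K n) := by
  filter_upwards [h.eventually_K_le, h.eventually_N_pos,
    h.tendsto_K_real.eventually_gt_atTop 0] with n h1 h2 h3
  have h4 : (0 : ℝ) < N n := by exact_mod_cast h2
  have hp : (0 : ℝ) < p := by exact_mod_cast h.p_pos
  have h5 := Real.log_le_log h3 h1
  rw [Real.log_rpow h4] at h5
  rw [Real.log_div h4.ne' h3.ne']
  have h6 := mul_le_mul_of_nonneg_left h5 hp.le
  have h7 : (p : ℝ) * ((1 - 1 / (p : ℝ)) * Real.log (N n)) = p * Real.log (N n) -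
      Real.log (N n) := by
    field_simp
  linarith

/-- The ratio is the `p`-th power of `K / N ^ (1 - 1/p)`. -/
theorem tendsto_ratio : Tendsto (fun n => (K n : ℝ) ^ p / (N n : ℝ) ^ (p - 1)) atTop (𝓝 0) := by
  have h1 := h.isLittleO.tendsto_div_nhds_zero.pow p
  rw [zero_pow h.p_pos.ne'] at h1
  refine h1.congr' ?_
  filter_upwards [h.eventually_N_pos] with n h2
  have h4 : (0 : ℝ) ≤ N n := by positivity
  have hp : (p : ℝ) ≠ 0 := by exact_mod_cast h.p_pos.ne'
  rw [div_pow, ← Real.rpow_natCast ((N n : ℝ) ^ (1 - 1 / (p : ℝ))) p, ← Real.rpow_mul h4,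
    ← Real.rpow_natCast (N n : ℝ) (p - 1)]
  congr 2
  rw [Nat.cast_sub h.p_pos, Nat.cast_one]
  field_simp

theorem eventually_M_le : ∀ᶠ n in atTop, (M n : ℝ) ≤ (c + 1) * K n := by
  filter_upwards [h.tendsto_K_real.eventually_ge_atTop 1] with n h1
  have h2 : 0 ≤ c * (K n : ℝ) := mul_nonneg h.c_pos.le (by linarith)
  rw [h.M_eq]
  have := (Nat.ceil_lt_add_one h2).le
  linarith

theorem tendsto_M : Tendsto (fun n => (M n : ℝ)) atTop atTop := by
  simp only [h.M_eq]
  exact (tendsto_ceil_mul_atTop c h.c_pos).comp h.tendsto_K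

theorem eventually_M_ge : ∀ᶠ n in atTop, 2 ≤ M n := by
  filter_upwards [h.tendsto_M.eventually_ge_atTop 2] with n hn
  exact_mod_cast hn

theorem r_eq {n : ℕ} (hM : 2 ≤ M n) : (r n : ℝ) = (N n : ℝ) * ℓ / M n := by
  have h1 : (M n : ℝ) ≠ 0 := by positivity
  rw [eq_div_iff h1, mul_comm]
  exact_mod_cast h.edges n

theorem eventually_le_r : ∀ᶠ n in atTop, (N n : ℝ) / K n * (ℓ / (c + 1)) ≤ r n := by
  filter_upwards [h.eventually_M_le, h.eventually_M_ge, h.tendsto_K_real.eventually_gt_atTop 0]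
    with n h1 h2 h3
  have hM : (0 : ℝ) < M n := by positivity
  have hc := h.c_pos
  rw [h.r_eq h2, le_div_iff₀ hM]
  calc (N n : ℝ) / K n * (ℓ / (c + 1)) * M n
      ≤ (N n : ℝ) / K n * (ℓ / (c + 1)) * ((c + 1) * K n) :=
        mul_le_mul_of_nonneg_left h1 (by positivity)
    _ = N n * ℓ := by field_simp

theorem tendsto_r : Tendsto (fun n => (r n : ℝ)) atTop atTop := by
  have hℓ := h.ℓ_pos
  have hc := h.c_pos
  exact tendsto_atTop_mono' _ h.eventually_le_r (h.tendsto_N_div_K.atTop_mul_const (by positivity))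

theorem nonempty_graph (n : ℕ) : Nonempty (Graph (N n) (M n) ℓ (r n)) :=
  ⟨Fintype.equivOfCardEq (by simpa using (h.edges n).symm)⟩

/-! ### The number of tests -/

omit h in
theorem card_test (M p r : ℕ) : Fintype.card (Test M p r) = 2 * p * M * Nat.clog 2 r := by
  simp only [Fintype.card_prod, Fintype.card_fin, Fintype.card_bool]
  ring

theorem card_test_eq (n : ℕ) : (Fintype.card (Test (M n) p (r n)) : ℝ) =
    2 * p * M n * ⌈Real.logb 2 ((N n : ℝ) * ℓ / M n)⌉₊ := by
  rw [card_test]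
  rcases Nat.eq_zero_or_pos (M n) with h0 | h0
  · simp [h0]
  · have h1 : (M n : ℝ) ≠ 0 := by positivity
    have h2 : (N n : ℝ) * ℓ / M n = r n := by
      rw [div_eq_iff h1, mul_comm (r n : ℝ)]
      exact_mod_cast (h.edges n).symm
    have h3 := Real.natCeil_logb_natCast 2 (r n)
    rw [Nat.cast_ofNat] at h3
    rw [h2, h3]
    push_cast
    ring

theorem isEquivalent_M : (fun n => (M n : ℝ)) ~[atTop] fun n => c * (K n : ℝ) := by
  simp only [h.M_eq]
  exact isEquivalent_nat_ceil.comp_tendsto (h.tendsto_K_real.const_mul_atTop h.c_pos)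

/-- Replacing `M` by `cK` shifts the logarithm by `logb 2 (M / (cK)) → 0`, and rounding up shifts it
by less than one, while the logarithm itself tends to infinity. -/
theorem isEquivalent_logb : (fun n => (⌈Real.logb 2 ((N n : ℝ) * ℓ / M n)⌉₊ : ℝ)) ~[atTop]
    fun n => Real.logb 2 ((ℓ : ℝ) * N n / (c * K n)) := by
  have hℓ : (0 : ℝ) < ℓ := by exact_mod_cast h.ℓ_pos
  have hc := h.c_pos
  have h1 : Tendsto (fun n => Real.logb 2 ((N n : ℝ) * ℓ / M n)) atTop atTop := by
    refine (Real.tendsto_logb_atTop (by norm_num)).comp (h.tendsto_r.congr' ?_)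
    filter_upwards [h.eventually_M_ge] with n hn
    exact h.r_eq hn
  have h2 : (fun n => (⌈Real.logb 2 ((N n : ℝ) * ℓ / M n)⌉₊ : ℝ)) ~[atTop]
      fun n => Real.logb 2 ((N n : ℝ) * ℓ / M n) := isEquivalent_nat_ceil.comp_tendsto h1
  refine h2.trans ?_
  have h3 : Tendsto (fun n => Real.logb 2 ((N n : ℝ) * ℓ / M n) -
      Real.logb 2 ((ℓ : ℝ) * N n / (c * K n))) atTop (𝓝 0) := by
    have h4 : Tendsto (fun n => Real.logb 2 ((M n : ℝ) / (c * K n))) atTop (𝓝 0) := by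
      have h5 : Tendsto (fun n => (M n : ℝ) / (c * K n)) atTop (𝓝 1) :=
        (isEquivalent_iff_tendsto_one (by
          filter_upwards [h.tendsto_K_real.eventually_gt_atTop 0] with n hn
          positivity)).1 h.isEquivalent_M
      have h6 := (Real.continuousAt_logb (b := 2) one_ne_zero).tendsto.comp h5
      rwa [Real.logb_one] at h6
    have h7 := h4.neg
    rw [neg_zero] at h7
    refine h7.congr' ?_
    filter_upwards [h.eventually_M_ge, h.tendsto_K_real.eventually_gt_atTop 0,
      h.eventually_N_pos] with n h8 h9 h10
    have h11 : (0 : ℝ) < M n := by positivity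
    have h12 : (0 : ℝ) < N n := by exact_mod_cast h10
    rw [Real.logb_div h11.ne' (by positivity), Real.logb_div (by positivity) h11.ne',
      Real.logb_div (by positivity) (by positivity), mul_comm (ℓ : ℝ)]
    ring
  have h8 : Tendsto (fun n => Real.logb 2 ((ℓ : ℝ) * N n / (c * K n))) atTop atTop := by
    refine (h1.atTop_add (h3.neg)).congr fun n => ?_
    ring
  refine IsLittleO.isEquivalent ?_
  exact h3.isBigO_one ℝ |>.trans_isLittleO
    ((isLittleO_const_left.2 (Or.inr (tendsto_norm_atTop_atTop.comp h8))))

theorem isEquivalent_card_test :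
    (fun n => (Fintype.card (Test (M n) p (r n)) : ℝ)) ~[atTop]
      fun n => 2 * p * c * K n * Real.logb 2 ((ℓ : ℝ) * N n / (c * K n)) := by
  have h1 := ((IsEquivalent.refl (u := fun _ : ℕ => (2 * p : ℝ))).mul h.isEquivalent_M).mul
    h.isEquivalent_logb
  refine (h1.congr_left ?_).congr_right ?_
  · exact Eventually.of_forall fun n => (h.card_test_eq n).symm
  · exact Eventually.of_forall fun n => by simp only [Pi.mul_apply]; ring

/-! ### The number of steps -/

omit h in
theorem binCost_le (N M ℓ r p : ℕ) (hM : 0 < M) (hr : M * r = N * ℓ) :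
    binCost N ℓ r p ≤ (6 + 10 * p) * wordCost N ℓ := by
  have h1 : r ≤ N * ℓ := hr ▸ Nat.le_mul_of_pos_left r hM
  -- A position in a bin is not longer than an index of an edge, so bit operations are also counted
  -- in units of `wordCost`.
  have h2 : Nat.clog 2 r ≤ wordCost N ℓ := (Nat.clog_mono_right 2 h1).trans (Nat.le_succ _)
  have h3 := wordCost_pos N ℓ
  unfold binCost
  nlinarith

omit h in
theorem wordCost_le (N ℓ : ℕ) (hN : 3 ≤ N) (hℓ : 0 < ℓ) :
    (wordCost N ℓ : ℝ) ≤ ((1 + Real.log ℓ) / Real.log 2 + 2) * Real.log N := by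
  have hN' : (3 : ℝ) ≤ N := by exact_mod_cast hN
  have hℓ' : (1 : ℝ) ≤ ℓ := by exact_mod_cast hℓ
  -- Here `N ≥ 3 > e` is used; `log N ≥ 1` absorbs the additive constants.
  have hlogN : 1 ≤ Real.log N := by
    rw [Real.le_log_iff_exp_le (by linarith)]
    exact (Real.exp_one_lt_d9.le.trans (by norm_num)).trans hN'
  have hlogℓ : 0 ≤ Real.log ℓ := Real.log_nonneg hℓ'
  have hlog2 : 0 < Real.log 2 := Real.log_pos (by norm_num)
  have h1 := Real.natCeil_logb_natCast 2 (N * ℓ)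
  have hNℓ : (1 : ℝ) ≤ (N * ℓ : ℕ) := by
    have : 0 < N * ℓ := Nat.mul_pos (by omega) hℓ
    exact_mod_cast this
  have h2 := Nat.ceil_lt_add_one (Real.logb_nonneg (b := 2) (by norm_num) hNℓ)
  rw [Nat.cast_ofNat] at h1
  rw [h1, ← Real.log_div_log, Nat.cast_mul, Real.log_mul (by linarith) (by linarith)] at h2
  unfold wordCost
  push_cast
  calc (Nat.clog 2 (N * ℓ) : ℝ) + 1
      ≤ (Real.log N + Real.log ℓ) / Real.log 2 + 2 := by linarith
    _ ≤ (Real.log N + Real.log ℓ * Real.log N) / Real.log 2 + 2 * Real.log N := by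
        gcongr
        · exact le_mul_of_one_le_right hlogℓ hlogN
        · linarith
    _ = ((1 + Real.log ℓ) / Real.log 2 + 2) * Real.log N := by ring

/-- If nothing is wrongly declared, at most `K` items are peeled. So `M = O(K)` bins and `K` items
are handled, at `O(log N)` each. -/
theorem eventually_steps_le [NeZero p] : ∀ᶠ n in atTop, ∀ (S : Finset (Fin (N n)))
    (ω : Outcome (N n) (M n) ℓ (r n) p), S.card = K n → (run S ω).val ⊆ S →
      ((run S ω).steps : ℝ) ≤ stepConstant ℓ c p * (K n * Real.log ((N n : ℝ) / K n)) := by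
  filter_upwards [h.eventually_M_le, h.eventually_M_ge, h.eventually_log_le,
    h.tendsto_N.eventually_ge_atTop 3, h.tendsto_K_real.eventually_ge_atTop 1] with n h1 h2 h3 h4
    h5 S ω hS hsub
  have hc := h.c_pos
  have hsteps := decode_steps_le ω (results S ω)
  have hcard : (decode ω (results S ω)).val.card ≤ K n := hS ▸ Finset.card_le_card hsub
  have hb := binCost_le (N n) (M n) ℓ (r n) p (by omega) (h.edges n)
  have hw1 := wordCost_pos (N n) ℓ
  have hw2 := wordCost_le (N n) ℓ (by exact_mod_cast h4) h.ℓ_pos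
  set w := wordCost (N n) ℓ with hw
  have hi : itemCost (N n) ℓ (r n) p ≤ (2 + ℓ * (10 + 10 * p)) * w := by
    unfold itemCost
    rw [← hw]
    calc 2 * w + ℓ * (4 * w + binCost (N n) ℓ (r n) p)
        ≤ 2 * w + ℓ * (4 * w + (6 + 10 * p) * w) := by gcongr
      _ = (2 + ℓ * (10 + 10 * p)) * w := by ring
  have htot : (run S ω).steps ≤ M n * ((8 + 10 * p) * w) +
      K n * ((2 + ℓ * (10 + 10 * p)) * w) + w := by
    refine hsteps.trans ?_
    gcongr
    calc binCost (N n) ℓ (r n) p + 2 * w ≤ (6 + 10 * p) * w + 2 * w := by gcongr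
      _ = (8 + 10 * p) * w := by ring
  have hlogN : 0 ≤ Real.log (N n) := Real.log_nonneg (by linarith)
  have hlog2 : 0 < Real.log 2 := Real.log_pos (by norm_num)
  have hlogℓ : 0 ≤ Real.log ℓ := Real.log_nonneg (by exact_mod_cast h.ℓ_pos)
  calc ((run S ω).steps : ℝ)
      ≤ M n * ((8 + 10 * p) * w) + K n * ((2 + ℓ * (10 + 10 * p)) * w) + w := by
        exact_mod_cast htot
    _ ≤ (c + 1) * K n * ((8 + 10 * p) * w) + K n * ((2 + ℓ * (10 + 10 * p)) * w) + K n * w := by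
        gcongr
        exact le_mul_of_one_le_left (by positivity) h5
    _ = ((c + 1) * (8 + 10 * p) + (2 + ℓ * (10 + 10 * p)) + 1) * (K n * w) := by ring
    _ ≤ ((c + 1) * (8 + 10 * p) + (2 + ℓ * (10 + 10 * p)) + 1) *
          (K n * (((1 + Real.log ℓ) / Real.log 2 + 2) *
            (p * Real.log ((N n : ℝ) / K n)))) := by
        gcongr
        exact hw2.trans (mul_le_mul_of_nonneg_left h3 (by positivity))
    _ = stepConstant ℓ c p * (K n * Real.log ((N n : ℝ) / K n)) := by
        unfold stepConstant; ring

/-! ### The probability of failure -/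

theorem eventually_prob_falseNeighbor_le [NeZero p] : ∀ᶠ n in atTop,
    ∀ S : Finset (Fin (N n)), S.card = K n →
      prob (fun ω : Outcome (N n) (M n) ℓ (r n) p =>
        ∃ q ∈ S ×ˢ (Finset.univ : Finset (Fin ℓ)), FalseNeighbor S ω q) ≤
      falseConstant ℓ c p * ((K n : ℝ) ^ p / (N n : ℝ) ^ (p - 1)) := by
  filter_upwards [h.eventually_M_le, h.eventually_M_ge, h.eventually_le_r, h.eventually_N_pos,
    h.tendsto_r.eventually_ge_atTop (2 * p : ℝ), h.tendsto_N_div_K.eventually_ge_atTop 8,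
    h.tendsto_K_real.eventually_ge_atTop 1] with n h1 h2 h3 h4 h5 h6 h7 S hS
  have := h.nonempty_graph n
  have hc := h.c_pos
  have hp := h.p_pos
  have hℓ : (1 : ℝ) ≤ ℓ := by exact_mod_cast h.ℓ_pos
  have hr : 2 * p ≤ r n := by exact_mod_cast h5
  have hN : (0 : ℝ) < N n := by exact_mod_cast h4
  have hK : (0 : ℝ) < K n := by linarith
  have h8 : 8 * K n ≤ N n := by
    rw [le_div_iff₀ hK] at h6
    exact_mod_cast h6
  have hrpos : (0 : ℝ) < r n := by exact_mod_cast (by omega : 0 < r n)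
  have hb := prob_exists_falseNeighbor_le (p := p) (M := M n) (r := r n) S h2 (by omega) h.ℓ_pos
    hr (by rw [hS]; exact h8) (by omega)
  rw [hS] at hb
  refine hb.trans ?_
  -- This is where `r` being at least of order `N/K` turns `K * r ^ (1 - p)` into `K ^ p / N ^ (p -
  -- 1)`.
  have h9 : 2 / (r n : ℝ) ≤ 2 * (c + 1) * (K n / N n) := by
    rw [div_le_iff₀ hrpos]
    have h10 : (N n : ℝ) / K n * (1 / (c + 1)) ≤ r n := by
      refine le_trans ?_ h3
      gcongr
    calc (2 : ℝ) = 2 * (c + 1) * (K n / N n) * ((N n : ℝ) / K n * (1 / (c + 1))) := by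
          field_simp
      _ ≤ 2 * (c + 1) * (K n / N n) * r n := by gcongr
  have hKp : (K n : ℝ) ^ p = K n * (K n : ℝ) ^ (p - 1) := by
    rw [← pow_succ', Nat.sub_add_cancel hp]
  calc (K n : ℝ) * ℓ * (2 / r n : ℝ) ^ (p - 1) + M n * (8 * K n / N n : ℝ) ^ (p - 1)
      ≤ (K n : ℝ) * ℓ * (2 * (c + 1) * (K n / N n)) ^ (p - 1) +
          (c + 1) * K n * (8 * (K n / N n)) ^ (p - 1) := by
        rw [← mul_div_assoc 8]
        gcongr
    _ = falseConstant ℓ c p * ((K n : ℝ) ^ p / (N n : ℝ) ^ (p - 1)) := by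
        rw [falseConstant, hKp, mul_pow, mul_pow 8, div_pow]
        ring

/-- The factor for passing from independent choices to the bijection is at most `exp (ℓ K² / (N -
K))`. Since `K/N → 0`, its exponent is eventually at most half of `γ K`. -/
theorem eventually_prob_unresolved_le {ε γ : ℝ} (hγ : 0 < γ)
    (hrate : ∀ᶠ K : ℕ in atTop, ∀ (V B : Type) [Fintype V] [DecidableEq V] [Fintype B]
      [DecidableEq B], Fintype.card V = K → Fintype.card B = ⌈c * (K : ℝ)⌉₊ →
      prob (fun f : V → Fin ℓ → B => ε * K < (unresolved Finset.univ f).card) ≤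
        Real.exp (-γ * K)) : ∀ᶠ n in atTop,
    ∀ S : Finset (Fin (N n)), S.card = K n →
      prob (fun G : Graph (N n) (M n) ℓ (r n) =>
        ε * K n < (unresolved Finset.univ (config G S)).card) ≤
      Real.exp (-(γ / 2) * K n) := by
  have hlim : Tendsto (fun n => (ℓ * (K n / N n) : ℝ) / (1 - K n / N n)) atTop (𝓝 0) := by
    have := (h.tendsto_K_div_N.const_mul (ℓ : ℝ)).div
      (tendsto_const_nhds.sub h.tendsto_K_div_N : Tendsto (fun n => 1 - (K n : ℝ) / N n) atTop
        (𝓝 (1 - 0))) (by norm_num)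
    rw [mul_zero, zero_div] at this
    exact this
  filter_upwards [h.tendsto_K.eventually hrate, hlim.eventually_le_const (half_pos hγ),
    h.tendsto_K_div_N.eventually_lt_const (show (0 : ℝ) < 1 by norm_num), h.eventually_N_pos,
    h.tendsto_r.eventually_gt_atTop 0] with n h1 h2 h3 h4 h5 S hS
  have := h.nonempty_graph n
  have hN : (0 : ℝ) < N n := by exact_mod_cast h4
  rw [div_lt_one hN] at h3
  have hr : 0 < r n := by exact_mod_cast h5
  have hd : (0 : ℝ) < N n - K n := by linarith
  refine (prob_unresolved_graph_le hr h.ℓ_pos S _ (by rw [hS]; exact_mod_cast h3)).trans ?_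
  have h6 := h1 S (Fin (M n)) (by rw [Fintype.card_coe, hS]) (by rw [Fintype.card_fin, h.M_eq])
  rw [hS]
  have h7 : ((N n : ℝ) / (N n - K n)) ^ (K n * ℓ) ≤ Real.exp (γ / 2 * K n) := by
    have h8 : (N n : ℝ) / (N n - K n) ≤ Real.exp (K n / (N n - K n)) := by
      refine le_trans (le_of_eq ?_) (Real.add_one_le_exp _)
      field_simp
      ring
    calc ((N n : ℝ) / (N n - K n)) ^ (K n * ℓ)
        ≤ Real.exp (K n / (N n - K n)) ^ (K n * ℓ) := pow_le_pow_left₀ (by positivity) h8 _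
      _ = Real.exp ((ℓ * (K n / N n) : ℝ) / (1 - K n / N n) * K n) := by
          rw [← Real.exp_nat_mul]
          congr 1
          have : 1 - (K n : ℝ) / N n = (N n - K n) / N n := by field_simp
          rw [this]
          push_cast
          field_simp
      _ ≤ Real.exp (γ / 2 * K n) := Real.exp_le_exp.2 (by gcongr)
  calc _ ≤ Real.exp (-γ * K n) * Real.exp (γ / 2 * K n) :=
        mul_le_mul h6 h7 (by positivity) (Real.exp_pos _).le
    _ = Real.exp (-(γ / 2) * K n) := by
        rw [← Real.exp_add]
        congr 1
        ring

/-- Only two events can cause failure: a false neighbor, or more than `ε K` unresolved items.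
Without a false neighbor the output is sound, and the step bound then holds deterministically. -/
theorem eventually_prob_failure_le [NeZero p] {ε γ : ℝ} (hγ : 0 < γ)
    (hrate : ∀ᶠ K : ℕ in atTop, ∀ (V B : Type) [Fintype V] [DecidableEq V] [Fintype B]
      [DecidableEq B], Fintype.card V = K → Fintype.card B = ⌈c * (K : ℝ)⌉₊ →
      prob (fun f : V → Fin ℓ → B => ε * K < (unresolved Finset.univ f).card) ≤
        Real.exp (-γ * K)) : ∀ᶠ n in atTop,
    ∀ S : Finset (Fin (N n)), S.card = K n →
      prob (fun ω : Outcome (N n) (M n) ℓ (r n) p =>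
        ¬ Success ε (stepConstant ℓ c p * (K n * Real.log ((N n : ℝ) / K n))) S ω) ≤
      falseConstant ℓ c p * ((K n : ℝ) ^ p / (N n : ℝ) ^ (p - 1)) +
        Real.exp (-(γ / 2) * K n) := by
  filter_upwards [h.eventually_prob_falseNeighbor_le, h.eventually_prob_unresolved_le hγ hrate,
    h.eventually_steps_le, h.tendsto_r.eventually_ge_atTop 2] with n h1 h2 h3 h4 S hS
  have hr : 2 ≤ r n := by exact_mod_cast h4
  refine le_trans ?_ (add_le_add (h1 S hS) (h2 S hS))
  rw [← prob_fst (Ω' := Fin (p - 1) → Equiv.Perm (Fin (r n)))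
    (fun G : Graph (N n) (M n) ℓ (r n) =>
      ε * K n < (unresolved Finset.univ (config G S)).card)]
  refine (prob_mono fun ω hω => ?_).trans (prob_or_le _ _)
  by_contra hc
  rw [not_or, not_lt] at hc
  have hsub := run_subset S ω hr hc.1
  refine hω ⟨hsub, ?_, h3 S ω hS hsub⟩
  have h5 := card_le_card_run_add S ω
  have h6 : (S.card : ℝ) ≤ (run S ω).val.card +
      (unresolved Finset.univ (config ω.1 S)).card := by exact_mod_cast h5
  rw [hS] at h6 ⊢
  linarith [hc.2]

theorem tendsto_failure_bound (C γ : ℝ) (hγ : 0 < γ) :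
    Tendsto (fun n => C * ((K n : ℝ) ^ p / (N n : ℝ) ^ (p - 1)) + Real.exp (-γ * K n)) atTop
      (𝓝 0) := by
  have h1 : Tendsto (fun n => Real.exp (-γ * K n)) atTop (𝓝 0) := by
    refine (Real.tendsto_exp_neg_atTop_nhds_zero.comp
      (h.tendsto_K_real.const_mul_atTop hγ)).congr fun n => ?_
    rw [Function.comp_apply, neg_mul]
  simpa using (h.tendsto_ratio.const_mul C).add h1

/-- If `log N = o(K)`, then `N ^ (p - 1) ≤ exp (γ K)` eventually, while `K ^ p ≥ 1`; so the
exponential term is absorbed. -/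
theorem eventually_exp_le (γ : ℝ) (hγ : 0 < γ)
    (hlog : (fun n => Real.log (N n)) =o[atTop] (fun n => (K n : ℝ))) :
    ∀ᶠ n in atTop, Real.exp (-γ * K n) ≤ (K n : ℝ) ^ p / (N n : ℝ) ^ (p - 1) := by
  have hp : (0 : ℝ) < p := by exact_mod_cast h.p_pos
  filter_upwards [hlog.bound (show 0 < γ / p by positivity), h.eventually_N_pos,
    h.tendsto_K_real.eventually_ge_atTop 1] with n h1 h2 h3
  have hN : (1 : ℝ) ≤ N n := by exact_mod_cast h2
  have hlogN := Real.log_nonneg hN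
  rw [Real.norm_of_nonneg hlogN, Real.norm_of_nonneg (by positivity)] at h1
  rw [le_div_iff₀ (by positivity)]
  have h4 : (N n : ℝ) ^ (p - 1) ≤ Real.exp (γ * K n) := by
    calc (N n : ℝ) ^ (p - 1) ≤ (N n : ℝ) ^ p := pow_le_pow_right₀ hN (Nat.sub_le _ _)
      _ = Real.exp (p * Real.log (N n)) := by
          rw [Real.exp_nat_mul, Real.exp_log (by linarith)]
      _ ≤ Real.exp (γ * K n) := by
          refine Real.exp_le_exp.2 ?_
          calc (p : ℝ) * Real.log (N n) ≤ p * (γ / p * K n) := by gcongr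
            _ = γ * K n := by field_simp
  calc Real.exp (-γ * K n) * (N n : ℝ) ^ (p - 1)
      ≤ Real.exp (-γ * K n) * Real.exp (γ * K n) := by gcongr
    _ = 1 := by rw [← Real.exp_add, neg_mul, neg_add_cancel, Real.exp_zero]
    _ ≤ (K n : ℝ) ^ p := one_le_pow₀ h3

end Regime
end GroupTesting

/-! ### The main theorem -/

theorem mainTheorem1 :
    ∃ (ℓ : ℝ → ℕ) (c : ℝ → ℝ),
      (∀ row ∈ GroupTesting.table, ℓ row.1 = row.2.1 ∧ c row.1 = row.2.2) ∧
      ∀ ε : ℝ, 0 < ε → ε < 1 → 0 < ℓ ε ∧ 0 < c ε ∧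
        ∀ (p : ℕ) [NeZero p], ∃ T C γ : ℝ, 0 < T ∧ 0 < C ∧ 0 < γ ∧
          ∀ (N K M r : ℕ → ℕ),
            Tendsto K atTop atTop →
            (fun n => (K n : ℝ)) =o[atTop] (fun n => (N n : ℝ) ^ (1 - 1 / (p : ℝ))) →
            (∀ n, M n = ⌈c ε * (K n : ℝ)⌉₊) →
            (∀ n, M n * r n = N n * ℓ ε) →
            -- the number of tests
            (∀ n, (Fintype.card (GroupTesting.Test (M n) p (r n)) : ℝ) =
              2 * p * M n * ⌈Real.logb 2 ((N n : ℝ) * ℓ ε / M n)⌉₊) ∧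
            ((fun n => (Fintype.card (GroupTesting.Test (M n) p (r n)) : ℝ)) ~[atTop]
              fun n => 2 * p * c ε * K n * Real.logb 2 ((ℓ ε : ℝ) * N n / (c ε * K n))) ∧
            -- the probability of failure
            (∀ᶠ n in atTop, ∀ S : Finset (Fin (N n)), S.card = K n →
              GroupTesting.prob (fun ω : GroupTesting.Outcome (N n) (M n) (ℓ ε) (r n) p =>
                ¬ GroupTesting.Success ε (T * (K n * Real.log ((N n : ℝ) / K n))) S ω) ≤
              C * ((K n : ℝ) ^ p / (N n : ℝ) ^ (p - 1)) + Real.exp (-γ * K n)) ∧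
            -- the running time whenever no item is wrongly declared defective
            (∀ᶠ n in atTop, ∀ (S : Finset (Fin (N n)))
                (ω : GroupTesting.Outcome (N n) (M n) (ℓ ε) (r n) p), S.card = K n →
              (GroupTesting.run S ω).val ⊆ S →
              ((GroupTesting.run S ω).steps : ℝ) ≤ T * (K n * Real.log ((N n : ℝ) / K n))) ∧
            -- success with high probability, and the rate for `log N = o(K)`
            (∀ S : (n : ℕ) → Finset (Fin (N n)), (∀ᶠ n in atTop, (S n).card = K n) →
              Tendsto (fun n =>
                GroupTesting.prob (fun ω : GroupTesting.Outcome (N n) (M n) (ℓ ε) (r n) p =>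
                  GroupTesting.Success ε (T * (K n * Real.log ((N n : ℝ) / K n))) (S n) ω))
                atTop (𝓝 1) ∧
              ((fun n => Real.log (N n)) =o[atTop] (fun n => (K n : ℝ)) →
                (fun n =>
                  GroupTesting.prob (fun ω : GroupTesting.Outcome (N n) (M n) (ℓ ε) (r n) p =>
                    ¬ GroupTesting.Success ε (T * (K n * Real.log ((N n : ℝ) / K n))) (S n) ω))
                  =O[atTop] fun n => (K n : ℝ) ^ p / (N n : ℝ) ^ (p - 1))) := by
  obtain ⟨ℓ, c, htable, hfloor⟩ := GroupTesting.exists_constants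
  refine ⟨ℓ, c, htable, fun ε h0 h1 => ?_⟩
  have hE := hfloor ε h0 h1
  obtain ⟨γ, hγ, hrate⟩ := hE.exists_rate
  have hℓ := hE.1
  have hc := hE.2.1
  refine ⟨hℓ, hc, fun p _ => ?_⟩
  have hp : 0 < p := Nat.pos_of_ne_zero (NeZero.ne p)
  have hT : 0 < GroupTesting.stepConstant (ℓ ε) (c ε) p :=
    GroupTesting.stepConstant_pos hℓ hc hp
  have hC : 0 < GroupTesting.falseConstant (ℓ ε) (c ε) p := by
    unfold GroupTesting.falseConstant
    positivity
  refine ⟨GroupTesting.stepConstant (ℓ ε) (c ε) p, GroupTesting.falseConstant (ℓ ε) (c ε) p,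
    γ / 2, hT, hC, half_pos hγ, fun N K M r hK ho hM hr => ?_⟩
  have h : GroupTesting.Regime (ℓ ε) (c ε) p N K M r := ⟨hℓ, hc, hp, hK, ho, hM, hr⟩
  have hfail := h.eventually_prob_failure_le hγ hrate
  refine ⟨h.card_test_eq, h.isEquivalent_card_test, hfail, h.eventually_steps_le,
    fun S hS => ⟨?_, fun hlog => ?_⟩⟩
  · have hlow := (tendsto_const_nhds (x := (1 : ℝ))).sub
      (h.tendsto_failure_bound (GroupTesting.falseConstant (ℓ ε) (c ε) p) (γ / 2) (half_pos hγ))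
    rw [sub_zero] at hlow
    refine tendsto_of_tendsto_of_tendsto_of_le_of_le' hlow tendsto_const_nhds ?_
      (Eventually.of_forall fun n => GroupTesting.prob_le_one _)
    filter_upwards [hfail, hS] with n h2 h3
    -- Complementation needs a nonempty sample space, as `prob` is identically `0` on an empty one;
    -- `M r = N ℓ` provides a graph.
    have := h.nonempty_graph n
    have h4 := h2 (S n) h3
    rw [GroupTesting.prob_not] at h4
    linarith
  · refine IsBigO.of_bound (GroupTesting.falseConstant (ℓ ε) (c ε) p + 1) ?_
    filter_upwards [hfail, hS, h.eventually_exp_le (γ / 2) (half_pos hγ) hlog] with n h2 h3 h4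
    rw [Real.norm_of_nonneg (GroupTesting.prob_nonneg _), Real.norm_of_nonneg (by positivity)]
    linarith [h2 (S n) h3]
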